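/- Let $N\ge 1$. Put $\bar{\mathfrak t}=\bigoplus_{i=1}^N\mathbb C\epsilon_i^\vee$, $\mathfrak t'=\bar{\mathfrak t}\oplus\mathbb Cc$, $\bar{\mathfrak t}^*=\bigoplus_i\mathbb C\epsilon_i$, $(\mathfrak t')^*=\bar{\mathfrak t}^*\oplus\mathbb Cc^*$ (dual bases), and write $\zeta\mapsto\bar\zeta$ for the projection $(\mathfrak t')^*\to\bar{\mathfrak t}^*$. Let $\bar P=\bigoplus_i\mathbb Z\epsilon_i$ with the form $(\epsilon_i,\epsilon_j)=\delta_{ij}$, let $\bar W=S_N$ permute the $\epsilon_i$, and let $W=\bar W\ltimes\bar P$ with elements $t_\eta w$. Let $\bar R_+=\{\epsilon_i-\epsilon_j: i<j\}$, $\bar R=\bar R_+\sqcup-\bar R_+$, $\bar\Pi=\{\alpha_i=\epsilon_i-\epsilon_{i+1}: 1\le i<N\}$, let $R=\{\alpha+k\delta:\alpha\in\bar R,\ k\in\mathbb Z\}$, and let $R_+$ consist of the $\alpha+k\delta$ with $\alpha\in\bar R_+,k\ge0$ or $-\alpha\in\bar R_+,k>0$; $R_-=R\setminus R_+$. The simple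 roots are those of $\bar\Pi$ and, if $N\ge2$, $\alpha_0=\delta-(\epsilon_1-\epsilon_N)$. For $\alpha=\epsilon_i-\epsilon_j+k\delta$ put $\alpha^\vee=\epsilon_i^\vee-\epsilon_j^\vee+kc\in\mathfrak t'$, $(\zeta,\alpha)=\zeta(\alpha^\vee)$ and $s_\alpha=t_{-k(\epsilon_i-\epsilon_j)}\,(i\,j)\in W$; also $(\zeta,\delta)=\zeta(c)$, and $\delta$ vanishes on $\mathfrak t'$. The group $W$ acts with $\bar W$ permuting indices (fixing $c$, $c^*$, $\delta$) and $$t_\eta(\xi)=\xi-\eta(\xi)c\ \ (\xi\in\mathfrak t'),\qquad t_\eta(\zeta)=\zeta+(\zeta,\delta)\,\eta\ \ (\zeta\in(\mathfrak t')^*),\qquad t_\eta(\alpha)=\alpha-(\eta,\alpha)\delta\ \ (\alpha\in R).$$ Let $S(w)=R_+\cap w^{-1}(R_-)$, $l(w)=\sharp S(w)$, and let $\pi=t_{\epsilon_1}\sigma$, where $\sigma\in\bar W$ is the cycle $1\mapsto2\mapsto\cdots\mapsto N\mapsto1$. The degenerate double affine Hecke algebra $\mathcal H$ is the unital $\mathbb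 C$-algebra generated by $\mathbb C[W]$ and the symmetric algebra $S[\mathfrak t']$ with the relations $$s_\alpha\xi-s_\alpha(\xi)s_\alpha=-\alpha(\xi)\quad(\alpha\text{ simple}),\qquad \pi\xi=\pi(\xi)\pi\qquad(\xi\in\mathfrak t').$$ The degenerate affine Hecke algebra $\bar{\mathcal H}\subset\mathcal H$ is the subalgebra generated by $\bar W$ and $\bar{\mathfrak t}$. For simple $\alpha$ put $\varphi_\alpha=1+s_\alpha\alpha^\vee$, and for $w\in W$ put $\varphi_w=\pi^k\varphi_{\gamma_1}\cdots\varphi_{\gamma_m}$, where $w=\pi^ks_{\gamma_1}\cdots s_{\gamma_m}$ with $\gamma_1,\dots,\gamma_m$ simple and $m=l(w)$. Let $\beta$ be an ordered partition (composition) of $N$ into positive parts, and let $\bar R_\beta$ be the set of $\epsilon_i-\epsilon_j\in\bar R$ with $i,j$ in the same block of consecutive integers given by $\beta$. Put $\bar R_{\beta,+}=\bar R_+\cap\bar R_\beta$, $\bar\Pi_\beta=\bar\Pi\cap\bar R_\beta$, $\bar W_\beta=\langle s_\alpha:\alpha\in\bar\Pi_\beta\rangle$, and let $\mathcal H_\beta=\langle\bar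 W_\beta,\mathfrak t'\rangle\subset\mathcal H$, $\bar{\mathcal H}_\beta=\langle\bar W_\beta,\bar{\mathfrak t}\rangle\subset\bar{\mathcal H}$ be the generated subalgebras. Let $(\mathfrak t')^*_\beta$ (resp. $\bar{\mathfrak t}^*_\beta$) be the set of $\zeta$ in $(\mathfrak t')^*$ (resp. $\bar{\mathfrak t}^*$) with $(\zeta,\alpha)=-1$ for all $\alpha\in\bar\Pi_\beta$. Such a $\zeta$ defines a one-dimensional representation $\mathbb C1_\zeta$ of $\mathcal H_\beta$ (resp. $\bar{\mathcal H}_\beta$) by $w1_\zeta=1_\zeta$ $(w\in\bar W_\beta)$ and $\xi1_\zeta=\zeta(\xi)1_\zeta$. Put $$\mathcal Y_\beta(\zeta)=\mathcal H\otimes_{\mathcal H_\beta}\mathbb C1_\zeta,\qquad \bar{\mathcal Y}_\beta(\zeta)=\bar{\mathcal H}\otimes_{\bar{\mathcal H}_\beta}\mathbb C1_\zeta,\qquad \mathbf 1_\zeta=1\otimes1_\zeta .$$ Let $W^\beta=\{w\in W: l(wu)\ge l(w)\ \forall u\in\bar W_\beta\}$ and $\bar W^\beta=W^\beta\cap\bar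 W$. A weight $\zeta\in(\mathfrak t')^*_\beta$ is *$\beta$-generic* if $(\zeta,\alpha)\notin\{1,0,-1\}$ for all $\alpha\in\bigcup_{w\in W^\beta}S(w)$. Let $\bar P_-=\{\eta\in\bar P:(\eta,\alpha)\le0\ \forall\alpha\in\bar R_+\}$. For $w\in\bar W^\beta$ let $\eta_w\in\bar P_-$ be determined by $(\eta_w,\epsilon_1)=0$ and, for $1\le i<N$, $(\eta_w,\alpha_i)=-1$ if $\alpha_i\in w(\bar R_+\setminus\bar R_{\beta,+})$ and $(\eta_w,\alpha_i)=0$ otherwise. Let $$X^\beta=\{t_{\eta+\eta_w}w: w\in\bar W^\beta,\ \eta\in\bar P_-\},$$ which is a set of representatives of $\bar W\backslash W/\bar W_\beta$. For $x\in W$ let $\beta(x)$ be the ordered partition of $N$ with $\bar\Pi_{\beta(x)}=\bar\Pi\cap x(\bar R_{\beta,+})$. **Theorem.** Suppose that $\zeta\in(\mathfrak t')^*_\beta$ is $\beta$-generic and $(\zeta,\delta)\ne0$. Then, as $\bar{\mathcal H}$-modules, $$\mathcal Y_\beta(\zeta)=\bigoplus_{x\in X^\beta}\bar{\mathcal H}\cdot\varphi_x\mathbf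 1_\zeta .$$ Moreover, for each $x\in X^\beta$ one has $\overline{x(\zeta)}\in\bar{\mathfrak t}^*_{\beta(x)}$, and the $\bar{\mathcal H}$-module $\bar{\mathcal H}\cdot\varphi_x\mathbf 1_\zeta$ is irreducible and isomorphic to $\bar{\mathcal Y}_{\beta(x)}(\overline{x(\zeta)})$. -/

import Mathlib

open scoped TensorProduct

namespace DDAHA

section Weyl

theorem perm_inv_apply {A : Type*} (σ : Equiv.Perm A) (a : A) : σ⁻¹ (σ a) = a :=
  σ.symm_apply_apply a

variable (N : ℕ)

/-- `W̄ = S_N` acts on the lattice `P̄ = ⨁ ℤ ε_i` by `w (ε_i) = ε_{w i}`. -/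
def permLattice : Equiv.Perm (Fin N) →* MulAut (Multiplicative (Fin N → ℤ)) where
  toFun σ := AddEquiv.toMultiplicative
    { toFun := fun η j => η (σ⁻¹ j)
      invFun := fun η j => η (σ j)
      left_inv := fun η => by funext j; simp
      right_inv := fun η => by funext j; simp
      map_add' := fun η η' => rfl }
  map_one' := by ext η; rfl
  map_mul' σ τ := by ext η; rfl

/-- The extended affine Weyl group `W = W̄ ⋉ P̄` of type `A_{N-1}`. -/
abbrev W : Type := Multiplicative (Fin N → ℤ) ⋊[permLattice N] Equiv.Perm (Fin N)

variable {N}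

/-- The translation `t_η`, for `η ∈ P̄`. -/
def tr (η : Fin N → ℤ) : W N := SemidirectProduct.inl (Multiplicative.ofAdd η)

/-- The inclusion `W̄ ⊂ W`. -/
def fin : Equiv.Perm (Fin N) →* W N := SemidirectProduct.inr

/-- The `η ∈ P̄` in the decomposition `w = t_η σ`, `σ ∈ W̄`. -/
def lat (w : W N) : Fin N → ℤ := Multiplicative.toAdd w.left

theorem eq_tr_mul_fin (w : W N) : w = tr (lat w) * fin w.right := by
  ext <;> simp [tr, fin, lat]

variable (N)

/-- `𝔱' = 𝔱̄ ⊕ ℂ c`; the pair `(x, a)` is `∑ x_i ε_i^∨ + a c`. -/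
abbrev T : Type := (Fin N → ℂ) × ℂ

/-- `(𝔱')^* = 𝔱̄^* ⊕ ℂ c^*`; the pair `(z, κ)` is `∑ z_i ε_i + κ c^*`. -/
abbrev Wt : Type := (Fin N → ℂ) × ℂ

/-- The affine root `α_{ij} + k δ = ε_i - ε_j + k δ`, where `i ≠ j` and `k ∈ ℤ`. -/
@[ext]
structure AffRoot where
  i : Fin N
  j : Fin N
  ne : i ≠ j
  k : ℤ

variable {N}

/-- The value `ζ(ξ)`. -/
def pair (ζ : Wt N) (ξ : T N) : ℂ := ∑ m, ζ.1 m * ξ.1 m + ζ.2 * ξ.2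

/-- The action of `W` on `𝔱'`: `W̄` permutes the `ε_i^∨` and fixes `c`, and
`t_η (ξ) = ξ - η(ξ) c`. -/
def actT : Representation ℂ (W N) (T N) where
  toFun w :=
    { toFun := fun ξ => (fun m => ξ.1 (w.right⁻¹ m),
        ξ.2 - ∑ m, (lat w m : ℂ) * ξ.1 (w.right⁻¹ m))
      map_add' := fun ξ ξ' => by
        ext m
        · simp
        · simp [mul_add, Finset.sum_add_distrib]; ring
      map_smul' := fun a ξ => by
        ext m
        · simp
        · simp [mul_sub, Finset.mul_sum, mul_left_comm] }
  map_one' := by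
    refine LinearMap.ext fun ξ => ?_
    ext m <;> simp [lat]
  map_mul' w v := by
    refine LinearMap.ext fun ξ => ?_
    ext m
    · simp
    · have h : ∑ m, (lat v (w.right⁻¹ m) : ℂ) * ξ.1 (v.right⁻¹ (w.right⁻¹ m))
          = ∑ m, (lat v m : ℂ) * ξ.1 (v.right⁻¹ m) :=
        Equiv.sum_comp w.right⁻¹ fun m => (lat v m : ℂ) * ξ.1 (v.right⁻¹ m)
      have h' : ∀ m, lat (w * v) m = lat w m + lat v (w.right⁻¹ m) := fun m => rfl
      simp only [h', SemidirectProduct.mul_right, mul_inv_rev, Equiv.Perm.mul_apply,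
        LinearMap.coe_mk, AddHom.coe_mk, Module.End.mul_apply, Int.cast_add, add_mul,
        Finset.sum_add_distrib, h]
      ring

/-- The affine action of `W` on `(𝔱')^*`: `W̄` permutes the `ε_i` and fixes `c^*`, and
`t_η (ζ) = ζ + (δ, ζ) η`. -/
def actWt (w : W N) (ζ : Wt N) : Wt N :=
  (fun m => ζ.1 (w.right⁻¹ m) + ζ.2 * (lat w m : ℂ), ζ.2)

namespace AffRoot

/-- The positive roots: `α + k δ` with `α ∈ R̄₊`, `k ≥ 0`, and `-α + k δ` with `α ∈ R̄₊`,
`k > 0`. -/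
def IsPos (α : AffRoot N) : Prop := 0 < α.k ∨ (α.k = 0 ∧ α.i < α.j)

/-- The simple roots `α_m = ε_m - ε_{m+1}`, `1 ≤ m < N`, and `α_0 = δ - (ε_1 - ε_N)`. -/
def IsSimple (α : AffRoot N) : Prop :=
  (α.k = 0 ∧ (α.i : ℕ) + 1 = α.j) ∨ (α.k = 1 ∧ (α.i : ℕ) + 1 = N ∧ (α.j : ℕ) = 0)

/-- The action of `W` on roots: `W̄` permutes the `ε_i` and fixes `δ`, and
`t_η (α) = α - (η, α) δ`. -/
instance : MulAction (W N) (AffRoot N) where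
  smul w α := ⟨w.right α.i, w.right α.j, fun h => α.ne (w.right.injective h),
    α.k - (lat w (w.right α.i) - lat w (w.right α.j))⟩
  one_smul α := by
    ext
    · rfl
    · rfl
    · show α.k - (0 - 0) = α.k
      ring
  mul_smul w v α := by
    have h' : ∀ m, lat (w * v) m = lat w m + lat v (w.right⁻¹ m) := fun m => rfl
    ext
    · rfl
    · rfl
    · show α.k - (lat (w * v) (w.right (v.right α.i)) - lat (w * v) (w.right (v.right α.j)))
        = α.k - (lat v (v.right α.i) - lat v (v.right α.j))
          - (lat w (w.right (v.right α.i)) - lat w (w.right (v.right α.j)))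
      simp only [h', perm_inv_apply]
      ring

theorem smul_i (w : W N) (α : AffRoot N) : (w • α).i = w.right α.i := rfl
theorem smul_j (w : W N) (α : AffRoot N) : (w • α).j = w.right α.j := rfl
theorem smul_k (w : W N) (α : AffRoot N) :
    (w • α).k = α.k - (lat w (w.right α.i) - lat w (w.right α.j)) := rfl

/-- The coroot `α^∨ = ε_i^∨ - ε_j^∨ + k c`, the image of `α` under `𝔱^* ≅ 𝔱`. -/
def coroot (α : AffRoot N) : T N := (Pi.single α.i 1 - Pi.single α.j 1, (α.k : ℂ))

/-- The value `α(ξ)` for `ξ ∈ 𝔱'` (where `δ` vanishes). -/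
def eval (α : AffRoot N) (ξ : T N) : ℂ := ξ.1 α.i - ξ.1 α.j

/-- The pairing `(ζ, α)` for `ζ ∈ (𝔱')^*`, which is `ζ(α^∨)`. -/
def pairing (ζ : Wt N) (α : AffRoot N) : ℂ := pair ζ α.coroot

/-- The affine reflection `s_α = t_{-k ᾱ} s_ᾱ`, for `α = ᾱ + k δ`. -/
def refl (α : AffRoot N) : W N :=
  tr (-α.k • (Pi.single α.i 1 - Pi.single α.j 1)) * fin (Equiv.swap α.i α.j)

end AffRoot

/-- `π = t_{ε_1} s_1 ⋯ s_{N-1}`; the product `s_1 ⋯ s_{N-1}` is the cycle `1 ↦ 2 ↦ ⋯ ↦ N ↦ 1`. -/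
def piElt [NeZero N] : W N := tr (Pi.single 0 1) * fin (finRotate N)

/-- `S(w) = R₊ ∩ w⁻¹(R₋)`. -/
def S (w : W N) : Set (AffRoot N) := {α | α.IsPos ∧ ¬ (w • α).IsPos}

/-- The length `l(w) = ♯ S(w)` (`S(w)` is finite, see `S_finite`). -/
noncomputable def len (w : W N) : ℕ := (S w).ncard

end Weyl

open AffRoot

section Facts

variable {N : ℕ}

theorem lat_mul (w v : W N) (m : Fin N) : lat (w * v) m = lat w m + lat v (w.right⁻¹ m) := rfl

theorem lat_refl (α : AffRoot N) (m : Fin N) :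
    lat α.refl m = -α.k * ((if m = α.i then 1 else 0) - (if m = α.j then 1 else 0)) := by
  simp [AffRoot.refl, lat, tr, fin, Pi.single_apply]

theorem right_refl (α : AffRoot N) : (α.refl).right = Equiv.swap α.i α.j := by
  simp [AffRoot.refl, tr, fin]

/-- The function `ℤ/N → ℤ` that records the affine permutation attached to `w`. -/
def ht (w : W N) (m : Fin N) : ℤ := (w.right m : ℕ) + N * lat w (w.right m)

theorem isPos_iff (α : AffRoot N) : α.IsPos ↔ 0 < α.k * N + (α.j : ℕ) - (α.i : ℕ) := by
  have h1 := α.i.2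
  have h2 := α.j.2
  have h3 : (α.i : ℕ) ≠ α.j := fun h => α.ne (Fin.ext h)
  unfold AffRoot.IsPos
  rw [Fin.lt_def]
  rcases lt_trichotomy α.k 0 with h | h | h
  · have : α.k * N ≤ -1 * N := by gcongr; omega
    constructor <;> intro h' <;> omega
  · rw [h]; omega
  · have : 1 * (N : ℤ) ≤ α.k * N := by gcongr; omega
    constructor <;> intro h' <;> omega

theorem isPos_smul_iff (w : W N) (α : AffRoot N) :
    (w • α).IsPos ↔ 0 < α.k * N + ht w α.j - ht w α.i := by
  rw [isPos_iff, smul_i, smul_j, smul_k, ht, ht]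
  constructor <;> intro h <;> linarith

theorem S_finite (w : W N) : (S w).Finite := by
  classical
  let f : AffRoot N → Fin N × Fin N × ℤ := fun α => (α.i, α.j, α.k)
  have hf : Function.Injective f := by
    intro a b h
    simp only [f, Prod.mk.injEq] at h
    exact AffRoot.ext h.1 h.2.1 h.2.2
  refine Set.Finite.of_finite_image (f := f) ?_ hf.injOn
  obtain ⟨B, hB⟩ : ∃ B : ℤ, ∀ a b : Fin N,
      lat w (w.right a) - lat w (w.right b) ≤ B := by
    obtain ⟨B, hB⟩ := (Set.finite_range fun p : Fin N × Fin N =>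
      lat w (w.right p.1) - lat w (w.right p.2)).bddAbove
    exact ⟨B, fun a b => hB ⟨(a, b), rfl⟩⟩
  refine Set.Finite.subset ((Set.finite_univ (α := Fin N)).prod
    ((Set.finite_univ (α := Fin N)).prod (Set.finite_Icc (0 : ℤ) B))) ?_
  rintro _ ⟨α, ⟨h1, h2⟩, rfl⟩
  refine ⟨trivial, trivial, ?_⟩
  have h3 := hB α.i α.j
  unfold AffRoot.IsPos at h1 h2
  rw [smul_k] at h2
  push Not at h2
  constructor
  · show 0 ≤ α.k
    rcases h1 with h | h <;> omega
  · show α.k ≤ B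
    have := h2.1
    omega

theorem refl_mul_refl (α : AffRoot N) : α.refl * α.refl = 1 := by
  refine SemidirectProduct.ext ?_ ?_
  · apply Multiplicative.toAdd.injective
    funext m
    show lat (α.refl * α.refl) m = 0
    rw [lat_mul, lat_refl, lat_refl, right_refl]
    have h := α.ne
    simp only [Equiv.swap_inv, Equiv.swap_apply_def]
    split_ifs <;> simp_all
  · simp [right_refl]

theorem refl_inv (α : AffRoot N) : α.refl⁻¹ = α.refl := inv_eq_of_mul_eq_one_left (refl_mul_refl α)

theorem refl_smul (w : W N) (α : AffRoot N) : (w • α).refl * w = w * α.refl := by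
  refine SemidirectProduct.ext ?_ ?_
  · apply Multiplicative.toAdd.injective
    funext m
    show lat ((w • α).refl * w) m = lat (w * α.refl) m
    rw [lat_mul, lat_mul, lat_refl, lat_refl, right_refl, smul_i, smul_j, smul_k]
    have h := α.ne
    have e1 : w.right⁻¹ m = α.i ↔ m = w.right α.i := by
      rw [Equiv.Perm.inv_eq_iff_eq, eq_comm]
    have e2 : w.right⁻¹ m = α.j ↔ m = w.right α.j := by
      rw [Equiv.Perm.inv_eq_iff_eq, eq_comm]
    simp only [Equiv.swap_inv, Equiv.swap_apply_def, e1, e2]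
    by_cases h1 : m = w.right α.i
    · have h2 : m ≠ w.right α.j := fun h2 => h (w.right.injective (h1.symm.trans h2))
      have h3 : w.right α.i ≠ w.right α.j := fun h3 => h (w.right.injective h3)
      simp [h1, h]
      ring
    · by_cases h2 : m = w.right α.j
      · have h3 : w.right α.j ≠ w.right α.i := fun h3 => h (w.right.injective h3.symm)
        simp [h2, h.symm]
        ring
      · simp [h1, h2]
  · simp [right_refl, Equiv.swap_apply_apply, smul_i, smul_j]

theorem actT_refl (α : AffRoot N) (ξ : T N) :
    actT α.refl ξ = ξ - α.eval ξ • α.coroot := by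
  have h := α.ne
  ext m
  · show ξ.1 ((α.refl).right⁻¹ m) = _
    rw [right_refl]
    simp only [Equiv.swap_inv, Equiv.swap_apply_def, AffRoot.eval, AffRoot.coroot, Prod.fst_sub,
      Prod.smul_fst, Pi.sub_apply, Pi.smul_apply, Pi.single_apply, smul_eq_mul]
    split_ifs <;> simp_all
  · show ξ.2 - ∑ m, (lat α.refl m : ℂ) * ξ.1 ((α.refl).right⁻¹ m) = _
    rw [right_refl]
    simp only [lat_refl, AffRoot.eval, AffRoot.coroot, Prod.snd_sub, Prod.smul_snd, smul_eq_mul,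
      Int.cast_neg, Int.cast_sub, Int.cast_ite, Int.cast_zero,
      mul_sub, sub_mul, Finset.sum_sub_distrib, mul_ite, ite_mul, mul_one, mul_zero, zero_mul,
      Finset.sum_ite_eq', Finset.mem_univ, if_true, Equiv.swap_inv,
      Equiv.swap_apply_left, Equiv.swap_apply_right]
    ring

theorem eval_coroot (α : AffRoot N) : α.eval α.coroot = 2 := by
  have h := α.ne
  simp [AffRoot.eval, AffRoot.coroot, h, h.symm]
  norm_num

theorem actT_refl_coroot (α : AffRoot N) : actT α.refl α.coroot = -α.coroot := by
  rw [actT_refl, eval_coroot, two_smul]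
  abel

theorem eval_actT (w : W N) (α : AffRoot N) (ξ : T N) :
    (w • α).eval (actT w ξ) = α.eval ξ := by
  show ξ.1 (w.right⁻¹ (w.right α.i)) - ξ.1 (w.right⁻¹ (w.right α.j)) = _
  simp [AffRoot.eval]

theorem refl_smul_self_eq (α : AffRoot N) (ξ : T N) :
    α.eval (actT α.refl ξ) = -α.eval ξ := by
  rw [actT_refl]
  have := eval_coroot α
  simp only [AffRoot.eval, Prod.fst_sub, Prod.smul_fst, Pi.sub_apply, Pi.smul_apply,
    smul_eq_mul] at this ⊢
  linear_combination (-(ξ.1 α.i - ξ.1 α.j)) * this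

theorem IsSimple.isPos {α : AffRoot N} (h : α.IsSimple) : α.IsPos := by
  rcases h with ⟨h1, h2⟩ | ⟨h1, -⟩
  · exact Or.inr ⟨h1, by rw [Fin.lt_def]; omega⟩
  · exact Or.inl (by omega)

theorem simple_neg {α : AffRoot N} (h : α.IsSimple) : ¬ (α.refl • α).IsPos := by
  have h1 := isPos_iff α
  have h2 := isPos_iff (α.refl • α)
  have h3 := IsSimple.isPos h
  have h4 := α.ne
  rw [smul_i, smul_j, smul_k, right_refl] at h2
  simp only [lat_refl, Equiv.swap_apply_left, Equiv.swap_apply_right, if_true, if_neg h4,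
    if_neg h4.symm] at h2
  rw [h2]
  rw [h1] at h3
  have : (α.k - (-α.k * (0 - 1) - -α.k * (1 - 0))) = -α.k := by ring
  rw [this]
  linarith

/-- A simple reflection permutes the positive roots other than its own root. -/
theorem simple_pos {α : AffRoot N} (h : α.IsSimple) {γ : AffRoot N} (hγ : γ.IsPos)
    (hne : γ ≠ α) : (α.refl • γ).IsPos := by
  obtain ⟨a, b, hab, m⟩ := α
  obtain ⟨i, j, hij, k⟩ := γ
  have hne' : ¬ (i = a ∧ j = b ∧ k = m) := by
    rintro ⟨rfl, rfl, rfl⟩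
    exact hne rfl
  have h1 := a.2
  have h2 := b.2
  have h3 := i.2
  have h4 := j.2
  simp only [Fin.ext_iff] at hne'
  simp only [ne_eq, Fin.ext_iff] at hab hij
  unfold AffRoot.IsPos at hγ ⊢
  unfold AffRoot.IsSimple at h
  rw [smul_i, smul_j, smul_k, right_refl]
  simp only [lat_refl, Equiv.swap_apply_def, Fin.lt_def, Fin.ext_iff] at hγ h ⊢
  rcases h with ⟨rfl, h⟩ | ⟨rfl, h, h'⟩
  · split_ifs <;> simp <;> omega
  · split_ifs <;> simp_all <;> omega

theorem ht_piElt_mul [NeZero N] (w : W N) (m : Fin N) : ht (piElt * w) m = ht w m + 1 := by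
  obtain ⟨n, rfl⟩ := Nat.exists_eq_succ_of_ne_zero (NeZero.ne N)
  have hr : (piElt (N := n + 1)).right = finRotate (n + 1) := by simp [piElt, tr, fin]
  have hl : ∀ m, lat (piElt (N := n + 1)) m = if m = 0 then 1 else 0 := by
    intro m
    simp [piElt, tr, fin, lat, Pi.single_apply]
  unfold ht
  rw [SemidirectProduct.mul_right, lat_mul, hl, hr, Equiv.Perm.mul_apply, perm_inv_apply]
  by_cases h : w.right m = Fin.last n
  · rw [h, finRotate_last]
    simp
    ring
  · have h1 := coe_finRotate_of_ne_last h
    have h2 : finRotate (n + 1) (w.right m) ≠ 0 := fun h2 => by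
      rw [h2] at h1
      simp at h1
    rw [h1, if_neg h2]
    push_cast
    ring

theorem isPos_piElt_smul [NeZero N] (α : AffRoot N) : ((piElt : W N) • α).IsPos ↔ α.IsPos := by
  rw [isPos_smul_iff, isPos_iff]
  have h : ∀ m : Fin N, ht (piElt : W N) m = (m : ℕ) + 1 := fun m => by
    have := ht_piElt_mul (1 : W N) m
    rw [mul_one] at this
    rw [this]
    simp [ht, lat]
  rw [h, h]
  constructor <;> intro h' <;> linarith

end Facts

section Reduced

variable {N : ℕ}

theorem not_isPos_iff (α : AffRoot N) : ¬ α.IsPos ↔ α.k * N + (α.j : ℕ) - (α.i : ℕ) < 0 := by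
  rw [isPos_iff]
  have h1 := α.i.2
  have h2 := α.j.2
  have h3 : (α.i : ℕ) ≠ α.j := fun h => α.ne (Fin.ext h)
  rcases lt_trichotomy α.k 0 with h | h | h
  · have : α.k * N ≤ -1 * N := by gcongr; omega
    omega
  · rw [h]; omega
  · have : 1 * (N : ℤ) ≤ α.k * N := by gcongr; omega
    omega

theorem refl_smul_self (α : AffRoot N) : α.refl • α = ⟨α.j, α.i, α.ne.symm, -α.k⟩ := by
  have h4 := α.ne
  ext
  · simp [smul_i, right_refl]
  · simp [smul_j, right_refl]
  · simp only [smul_k, right_refl, lat_refl, Equiv.swap_apply_left, Equiv.swap_apply_right,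
      if_true, if_neg h4, if_neg h4.symm]
    ring

theorem isPos_smul_refl_smul (w : W N) (α : AffRoot N) :
    (w • α.refl • α).IsPos ↔ ¬ (w • α).IsPos := by
  rw [refl_smul_self, not_isPos_iff, isPos_iff]
  simp only [smul_i, smul_j, smul_k]
  constructor <;> intro h <;> linarith

theorem refl_smul_refl_smul (α γ : AffRoot N) : α.refl • α.refl • γ = γ := by
  rw [smul_smul, refl_mul_refl, one_smul]

/-- If `α` is simple and `w α < 0` then `S(w s_α) = s_α (S(w) \ {α})`. -/
theorem S_mul_refl {w : W N} {α : AffRoot N} (h : α.IsSimple) (hw : α ∈ S w) :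
    S (w * α.refl) = (fun γ => α.refl • γ) '' (S w \ {α}) := by
  ext γ
  constructor
  · rintro ⟨h1, h2⟩
    rw [mul_smul] at h2
    have hne : γ ≠ α := by
      rintro rfl
      exact h2 ((isPos_smul_refl_smul w γ).2 hw.2)
    refine ⟨α.refl • γ, ⟨⟨simple_pos h h1 hne, h2⟩, ?_⟩, refl_smul_refl_smul _ _⟩
    intro h3
    have h3' : α.refl • γ = α := h3
    have : α.refl • α = γ := (congrArg (fun x => α.refl • x) h3').symm.trans (refl_smul_refl_smul α γ)
    exact simple_neg h (this.symm ▸ h1)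
  · rintro ⟨γ, ⟨⟨h1, h2⟩, h3⟩, rfl⟩
    refine ⟨simple_pos h h1 h3, ?_⟩
    show ¬ ((w * α.refl) • α.refl • γ).IsPos
    rw [mul_smul, refl_smul_refl_smul]
    exact h2

theorem len_mul_refl {w : W N} {α : AffRoot N} (h : α.IsSimple) (hw : α ∈ S w) :
    len (w * α.refl) + 1 = len w := by
  unfold len
  rw [S_mul_refl h hw, Set.ncard_image_of_injective _ (MulAction.injective _)]
  exact Set.ncard_sdiff_singleton_add_one hw (S_finite w)

theorem ht_zpow [NeZero N] (k : ℤ) (w : W N) (m : Fin N) : ht (piElt ^ k * w) m = ht w m + k := by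
  induction k with
  | zero => simp
  | succ k ih => rw [add_comm, zpow_one_add, mul_assoc, ht_piElt_mul, ih]; ring
  | pred k ih =>
    have h := ht_piElt_mul (piElt ^ (-(k : ℤ) - 1) * w) m
    rw [← mul_assoc, ← zpow_one_add, show (1 : ℤ) + (-k - 1) = -k by ring, ih] at h
    linarith

theorem eq_one_of_ht {w : W N} (h : ∀ m, ht w m = (m : ℕ)) : w = 1 := by
  have key : ∀ m, w.right m = m ∧ lat w (w.right m) = 0 := by
    intro m
    have h1 := h m
    unfold ht at h1
    have h2 := (w.right m).2
    have h3 := m.2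
    have h4 : lat w (w.right m) = 0 := by
      rcases lt_trichotomy (lat w (w.right m)) 0 with h5 | h5 | h5
      · have : (N : ℤ) * lat w (w.right m) ≤ N * (-1) := by gcongr; omega
        omega
      · exact h5
      · have : (N : ℤ) * 1 ≤ N * lat w (w.right m) := by gcongr; omega
        omega
    rw [h4] at h1
    exact ⟨Fin.ext (by omega), h4⟩
  refine SemidirectProduct.ext ?_ ?_
  · apply Multiplicative.toAdd.injective
    funext m
    have := (key m).2
    rw [(key m).1] at this
    exact this
  · exact Equiv.ext fun m => (key m).1

variable [NeZero N]

theorem eq_zpow_of_simple {w : W N} (h : ∀ α : AffRoot N, α.IsSimple → (w • α).IsPos) :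
    w = piElt ^ (ht w 0) := by
  obtain ⟨n, rfl⟩ := Nat.exists_eq_succ_of_ne_zero (NeZero.ne N)
  have mono : ∀ b a : ℕ, ∀ hb : a + b < n + 1,
      ht w ⟨a, by omega⟩ + b ≤ ht w ⟨a + b, hb⟩ := by
    intro b
    induction b with
    | zero => intro a hb; simp
    | succ b ih =>
      intro a hb
      have h1 := ih a (by omega)
      have h2 := h ⟨⟨a + b, by omega⟩, ⟨a + b + 1, hb⟩, by simp, 0⟩ (Or.inl ⟨rfl, rfl⟩)
      rw [isPos_smul_iff] at h2
      simp only [zero_mul] at h2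
      have e : (⟨a + (b + 1), hb⟩ : Fin (n + 1)) = ⟨a + b + 1, hb⟩ := rfl
      rw [e]
      push_cast
      linarith
  have last : ht w ⟨n, by omega⟩ < ht w 0 + (n + 1 : ℕ) := by
    rcases Nat.eq_zero_or_pos n with hn | hn
    · subst hn
      simp
    · have h2 := h ⟨⟨n, by omega⟩, 0, by simp [Fin.ext_iff]; omega, 1⟩
        (Or.inr ⟨rfl, rfl, rfl⟩)
      rw [isPos_smul_iff] at h2
      simp only [Nat.succ_eq_add_one] at h2
      linarith
  have hm : ∀ m : Fin (n + 1), ht w m = ht w 0 + (m : ℕ) := by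
    intro m
    have h1 := mono m 0 (by omega)
    have h2 := mono (n - m) m (by omega)
    have h3 := m.2
    have e1 : (⟨0 + (m : ℕ), by omega⟩ : Fin (n + 1)) = m := Fin.ext (by simp)
    have e2 : (⟨(m : ℕ) + (n - m), by omega⟩ : Fin (n + 1)) = ⟨n, by omega⟩ :=
      Fin.ext (by simp; omega)
    have e3 : (⟨0, by omega⟩ : Fin (n + 1)) = 0 := rfl
    rw [e1, e3] at h1
    rw [e2] at h2
    have e4 : ((n - (m : ℕ) : ℕ) : ℤ) = n - (m : ℕ) := by omega
    rw [e4] at h2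
    push_cast at last
    linarith
  have : piElt ^ (-(ht w 0)) * w = 1 := by
    refine eq_one_of_ht fun m => ?_
    rw [ht_zpow, hm]
    ring
  rw [zpow_neg, inv_mul_eq_one] at this
  exact this.symm

/-- `w = π^k s_{j_1} ⋯ s_{j_m}` is a reduced expression, i.e. `m = l(w)`; the simple reflections
are listed by their simple roots. -/
def IsReducedExpr (w : W N) (k : ℤ) (js : List (AffRoot N)) : Prop :=
  (∀ α ∈ js, α.IsSimple) ∧ w = piElt ^ k * (js.map AffRoot.refl).prod ∧ js.length = len w

theorem exists_reduced (w : W N) : ∃ e : ℤ × List (AffRoot N), IsReducedExpr w e.1 e.2 := by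
  induction hn : len w generalizing w with
  | zero =>
    have h : ∀ α : AffRoot N, α.IsSimple → (w • α).IsPos := by
      intro α hα
      by_contra h
      have : α ∈ S w := ⟨IsSimple.isPos hα, h⟩
      rw [len, Set.ncard_eq_zero (S_finite w)] at hn
      rw [hn] at this
      exact this
    exact ⟨(ht w 0, []), by simp, by simpa using eq_zpow_of_simple h, by simp [hn]⟩
  | succ n ih =>
    by_cases h : ∀ α : AffRoot N, α.IsSimple → (w • α).IsPos
    · have hS : S w = ∅ := by
        rw [eq_zpow_of_simple h]
        ext α
        simp only [S, Set.mem_ofPred_eq, Set.mem_empty_iff_false, iff_false, not_and, not_not]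
        intro hα
        have e : ∀ m, ht (piElt ^ (ht w 0) : W N) m = (m : ℕ) + ht w 0 := fun m => by
          have := ht_zpow (ht w 0) (1 : W N) m
          rw [mul_one] at this
          rw [this]
          simp [ht, lat]
        rw [isPos_smul_iff, e, e]
        rw [isPos_iff] at hα
        linarith
      rw [len, hS] at hn
      simp at hn
    · push Not at h
      obtain ⟨α, hα, h⟩ := h
      have hw : α ∈ S w := ⟨IsSimple.isPos hα, h⟩
      have hl := len_mul_refl hα hw
      obtain ⟨⟨k, js⟩, h1, h2, h3⟩ := ih (w * α.refl) (by omega)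
      refine ⟨(k, js ++ [α]), ?_, ?_, ?_⟩
      · intro γ hγ
        rcases List.mem_append.1 hγ with h4 | h4
        · exact h1 _ h4
        · rw [List.mem_singleton] at h4
          exact h4 ▸ hα
      · simp only [List.map_append, List.prod_append, List.map_cons, List.map_nil,
          List.prod_singleton]
        rw [← mul_assoc, ← h2, mul_assoc, refl_mul_refl, mul_one]
      · simp only [List.length_append, List.length_singleton]
        dsimp only at h3
        omega

end Reduced

section Algebra

variable (N : ℕ) [NeZero N]

/-- The defining relations of `𝓗` on the generators `w ∈ W` and `ξ ∈ 𝔱'`: those of the group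
`W`, those of the symmetric algebra `S[𝔱']`, and
`s_α ξ - s_α(ξ) s_α = -α(ξ)` for the simple roots `α`, `π ξ = π(ξ) π`. -/
inductive Rel : FreeAlgebra ℂ (W N ⊕ T N) → FreeAlgebra ℂ (W N ⊕ T N) → Prop
  | one : Rel (FreeAlgebra.ι ℂ (Sum.inl 1)) 1
  | mul (w v : W N) : Rel (FreeAlgebra.ι ℂ (Sum.inl (w * v)))
      (FreeAlgebra.ι ℂ (Sum.inl w) * FreeAlgebra.ι ℂ (Sum.inl v))
  | add (ξ ξ' : T N) : Rel (FreeAlgebra.ι ℂ (Sum.inr (ξ + ξ')))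
      (FreeAlgebra.ι ℂ (Sum.inr ξ) + FreeAlgebra.ι ℂ (Sum.inr ξ'))
  | smul (a : ℂ) (ξ : T N) : Rel (FreeAlgebra.ι ℂ (Sum.inr (a • ξ)))
      (a • FreeAlgebra.ι ℂ (Sum.inr ξ))
  | comm (ξ ξ' : T N) : Rel (FreeAlgebra.ι ℂ (Sum.inr ξ) * FreeAlgebra.ι ℂ (Sum.inr ξ'))
      (FreeAlgebra.ι ℂ (Sum.inr ξ') * FreeAlgebra.ι ℂ (Sum.inr ξ))
  | simple (α : AffRoot N) (hα : α.IsSimple) (ξ : T N) :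
      Rel (FreeAlgebra.ι ℂ (Sum.inl α.refl) * FreeAlgebra.ι ℂ (Sum.inr ξ)
          - FreeAlgebra.ι ℂ (Sum.inr (actT α.refl ξ)) * FreeAlgebra.ι ℂ (Sum.inl α.refl))
        (algebraMap ℂ _ (-α.eval ξ))
  | pi (ξ : T N) : Rel (FreeAlgebra.ι ℂ (Sum.inl piElt) * FreeAlgebra.ι ℂ (Sum.inr ξ))
      (FreeAlgebra.ι ℂ (Sum.inr (actT piElt ξ)) * FreeAlgebra.ι ℂ (Sum.inl piElt))

/-- The degenerate double affine Hecke algebra `𝓗`. -/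
def H : Type := RingQuot (Rel N)

noncomputable instance : Ring (H N) := inferInstanceAs (Ring (RingQuot (Rel N)))

noncomputable instance : Algebra ℂ (H N) := inferInstanceAs (Algebra ℂ (RingQuot (Rel N)))

variable {N}

/-- The quotient map from the free algebra. -/
noncomputable def H.mk : FreeAlgebra ℂ (W N ⊕ T N) →ₐ[ℂ] H N := RingQuot.mkAlgHom ℂ (Rel N)

theorem H.mk_rel {x y : FreeAlgebra ℂ (W N ⊕ T N)} (h : Rel N x y) : H.mk x = H.mk y :=
  RingQuot.mkAlgHom_rel ℂ h

/-- The image of `w ∈ W` in `𝓗`. -/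
noncomputable def H.ofW : W N →* H N where
  toFun w := H.mk (FreeAlgebra.ι ℂ (Sum.inl w))
  map_one' := by rw [H.mk_rel Rel.one, map_one]
  map_mul' w v := by rw [H.mk_rel (Rel.mul w v), map_mul]

/-- The image of `ξ ∈ 𝔱'` in `𝓗`. -/
noncomputable def H.ofT : T N →ₗ[ℂ] H N where
  toFun ξ := H.mk (FreeAlgebra.ι ℂ (Sum.inr ξ))
  map_add' ξ ξ' := by rw [H.mk_rel (Rel.add ξ ξ'), map_add]
  map_smul' a ξ := by rw [H.mk_rel (Rel.smul a ξ), map_smul]; rfl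

/-- `φ_α = 1 + s_α α^∨`, used for simple roots `α`. -/
noncomputable def phiSimple (α : AffRoot N) : H N := 1 + H.ofW α.refl * H.ofT α.coroot

/-- The intertwiner `φ_w = π^k φ_{j_1} ⋯ φ_{j_m}`, for a reduced expression
`w = π^k s_{j_1} ⋯ s_{j_m}`. -/
noncomputable def phi (w : W N) : H N :=
  H.ofW (piElt ^ (exists_reduced w).choose.1) *
    ((exists_reduced w).choose.2.map phiSimple).prod

variable (N) in
/-- The degenerate affine Hecke algebra `𝓗̄`, the subalgebra of `𝓗` generated by `W̄` and `𝔱̄`. -/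
noncomputable def Hbar : Subalgebra ℂ (H N) :=
  Algebra.adjoin ℂ (Set.range (fun σ : Equiv.Perm (Fin N) => H.ofW (fin σ)) ∪
    Set.range (fun x : Fin N → ℂ => H.ofT (x, 0)))

end Algebra

section Principal

variable {N : ℕ}

/-- Left translation on `ℂ[W]`. -/
noncomputable def trans : Representation ℂ (W N) (W N →₀ ℂ) where
  toFun v := Finsupp.lmapDomain ℂ ℂ (fun w => v * w)
  map_one' := by
    refine Finsupp.lhom_ext fun w a => ?_
    simp
  map_mul' u v := by
    refine Finsupp.lhom_ext fun w a => ?_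
    simp [mul_assoc]

theorem trans_single (v w : W N) (a : ℂ) :
    trans v (Finsupp.single w a) = Finsupp.single (v * w) a := by
  simp [trans]

/-- The action of `ξ ∈ 𝔱'` on the representation of `𝓗` induced from the character `ζ` of
`S[𝔱']`, realized on `ℂ[W]`. -/
noncomputable def dOp (ζ : Wt N) (ξ : T N) : (W N →₀ ℂ) →ₗ[ℂ] (W N →₀ ℂ) :=
  Finsupp.linearCombination ℂ fun w => Finsupp.single w (pair ζ (actT w⁻¹ ξ)) -
    ∑ γ ∈ (S_finite w⁻¹).toFinset, Finsupp.single (γ.refl * w) (γ.eval ξ)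

theorem dOp_single (ζ : Wt N) (ξ : T N) (w : W N) :
    dOp ζ ξ (Finsupp.single w 1) = Finsupp.single w (pair ζ (actT w⁻¹ ξ)) -
      ∑ γ ∈ (S_finite w⁻¹).toFinset, Finsupp.single (γ.refl * w) (γ.eval ξ) := by
  simp [dOp]

theorem pair_add (ζ : Wt N) (ξ ξ' : T N) : pair ζ (ξ + ξ') = pair ζ ξ + pair ζ ξ' := by
  simp [pair, mul_add, Finset.sum_add_distrib]
  ring

theorem pair_smul (ζ : Wt N) (a : ℂ) (ξ : T N) : pair ζ (a • ξ) = a * pair ζ ξ := by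
  simp [pair, mul_add, Finset.mul_sum, mul_left_comm]

theorem eval_add (γ : AffRoot N) (ξ ξ' : T N) : γ.eval (ξ + ξ') = γ.eval ξ + γ.eval ξ' := by
  simp [AffRoot.eval]
  ring

theorem eval_smul (γ : AffRoot N) (a : ℂ) (ξ : T N) : γ.eval (a • ξ) = a * γ.eval ξ := by
  simp [AffRoot.eval, mul_sub]

theorem hom_ext_single {f g : (W N →₀ ℂ) →ₗ[ℂ] (W N →₀ ℂ)}
    (h : ∀ w, f (Finsupp.single w 1) = g (Finsupp.single w 1)) : f = g :=
  Finsupp.lhom_ext' fun w => LinearMap.ext_ring (h w)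

theorem dOp_add (ζ : Wt N) (ξ ξ' : T N) : dOp ζ (ξ + ξ') = dOp ζ ξ + dOp ζ ξ' := by
  refine hom_ext_single fun w => ?_
  simp only [LinearMap.add_apply, dOp_single, map_add, pair_add, eval_add, Finsupp.single_add,
    Finset.sum_add_distrib]
  abel

theorem dOp_smul (ζ : Wt N) (a : ℂ) (ξ : T N) : dOp ζ (a • ξ) = a • dOp ζ ξ := by
  refine hom_ext_single fun w => ?_
  simp only [LinearMap.smul_apply, dOp_single, map_smul, pair_smul, eval_smul, smul_sub,
    Finset.smul_sum, Finsupp.smul_single, smul_eq_mul]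

theorem mem_S_mul_refl {w : W N} {α : AffRoot N} (h : α.IsSimple) (hw : α ∉ S w) :
    α ∈ S (w * α.refl) := by
  refine ⟨IsSimple.isPos h, ?_⟩
  rw [mul_smul, isPos_smul_refl_smul, not_not]
  by_contra h'
  exact hw ⟨IsSimple.isPos h, h'⟩

/-- Reindexing of a sum over `S(w s_α)`, if `α ∈ S(w)` is simple. -/
theorem sum_S {M : Type*} [AddCommGroup M] {w v : W N} {α : AffRoot N} (h : α.IsSimple)
    (hw : α ∈ S w) (hv : v = w * α.refl) (G : AffRoot N → M) :
    ∑ γ ∈ (S_finite v).toFinset, G γ =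
      (∑ γ ∈ (S_finite w).toFinset, G (α.refl • γ)) - G (α.refl • α) := by
  classical
  subst hv
  have e : (S_finite (w * α.refl)).toFinset =
      ((S_finite w).toFinset.erase α).image (fun γ => α.refl • γ) := by
    ext γ
    rw [Set.Finite.mem_toFinset, S_mul_refl h hw]
    simp only [Finset.mem_image, Finset.mem_erase, Set.Finite.mem_toFinset, Set.mem_image,
      Set.mem_sdiff, Set.mem_singleton_iff]
    constructor
    · rintro ⟨x, ⟨h1, h2⟩, h3⟩
      exact ⟨x, ⟨h2, h1⟩, h3⟩
    · rintro ⟨x, ⟨h1, h2⟩, h3⟩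
      exact ⟨x, ⟨h2, h1⟩, h3⟩
  rw [e, Finset.sum_image (fun a _ b _ hab => MulAction.injective _ hab),
    ← Finset.sum_erase_add _ _ ((S_finite w).mem_toFinset.2 hw)]
  abel

theorem actT_mul (w v : W N) (ξ : T N) : actT (w * v) ξ = actT w (actT v ξ) := by
  rw [map_mul]
  rfl

theorem actT_inv_apply (w : W N) (ξ : T N) : actT w⁻¹ (actT w ξ) = ξ := by
  rw [← actT_mul, inv_mul_cancel, map_one]
  rfl

theorem actT_apply_inv (w : W N) (ξ : T N) : actT w (actT w⁻¹ ξ) = ξ := by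
  rw [← actT_mul, mul_inv_cancel, map_one]
  rfl

theorem dOp_simple (ζ : Wt N) {α : AffRoot N} (h : α.IsSimple) (ξ : T N) :
    trans α.refl * dOp ζ ξ - dOp ζ (actT α.refl ξ) * trans α.refl
      = algebraMap ℂ (Module.End ℂ (W N →₀ ℂ)) (-α.eval ξ) := by
  refine hom_ext_single fun w => ?_
  rw [LinearMap.sub_apply, Module.End.mul_apply, Module.End.mul_apply, trans_single, dOp_single,
    dOp_single, map_sub, trans_single, map_sum]
  simp only [trans_single]
  rw [mul_inv_rev, refl_inv, actT_mul, ← actT_mul α.refl, refl_mul_refl, map_one,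
    Module.End.one_apply]
  have e1 : ∀ γ : AffRoot N, (α.refl • γ).refl * (α.refl * w) = α.refl * (γ.refl * w) := by
    intro γ
    rw [← mul_assoc, refl_smul, mul_assoc]
  have e2 : ∀ γ : AffRoot N, (α.refl • γ).eval (actT α.refl ξ) = γ.eval ξ := fun γ =>
    eval_actT _ _ _
  have e3 : Finsupp.single (α.refl * (α.refl * w)) (α.eval ξ) =
      α.eval ξ • Finsupp.single w (1 : ℂ) := by
    rw [← mul_assoc, refl_mul_refl, one_mul, Finsupp.smul_single, smul_eq_mul, mul_one]
  rw [Module.algebraMap_end_apply, neg_smul, ← e3]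
  by_cases hw : α ∈ S w⁻¹
  · rw [sum_S h hw rfl fun γ => Finsupp.single (γ.refl * (α.refl * w)) (γ.eval (actT α.refl ξ))]
    simp only [e1, e2]
    abel
  · have hw' := mem_S_mul_refl h hw
    rw [sum_S (v := w⁻¹) h hw' (by rw [mul_assoc, refl_mul_refl, mul_one])
      fun γ => Finsupp.single (α.refl * (γ.refl * w)) (γ.eval ξ)]
    simp only [← e1, ← e2, refl_smul_refl_smul]
    rw [e2, refl_smul_self_eq, Finsupp.single_neg]
    abel

theorem S_one : S (1 : W N) = ∅ := by
  ext α
  simp only [S, Set.mem_ofPred_eq, Set.mem_empty_iff_false, iff_false, not_and, not_not, one_smul]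
  exact id

theorem dOp_one (ζ : Wt N) (ξ : T N) :
    dOp ζ ξ (Finsupp.single 1 1) = Finsupp.single 1 (pair ζ ξ) := by
  have : (S_finite (1 : W N)⁻¹).toFinset = ∅ := by
    rw [Set.Finite.toFinset_eq_empty, inv_one, S_one]
  rw [dOp_single, this, Finset.sum_empty, sub_zero, inv_one, map_one]
  rfl

theorem dOp_simple_apply (ζ : Wt N) {α : AffRoot N} (h : α.IsSimple) (ξ : T N) (x : W N →₀ ℂ) :
    dOp ζ ξ (trans α.refl x) = trans α.refl (dOp ζ (actT α.refl ξ) x) - α.eval ξ • x := by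
  have h1 := LinearMap.congr_fun (dOp_simple ζ h (actT α.refl ξ)) x
  rw [← actT_mul, refl_mul_refl, map_one, refl_smul_self_eq, neg_neg] at h1
  rw [LinearMap.sub_apply, Module.End.mul_apply, Module.End.mul_apply,
    Module.algebraMap_end_apply, Module.End.one_apply] at h1
  rw [← h1]
  abel

variable [NeZero N]

theorem dOp_pi (ζ : Wt N) (ξ : T N) :
    trans piElt * dOp ζ ξ = dOp ζ (actT piElt ξ) * trans piElt := by
  classical
  refine hom_ext_single fun w => ?_
  rw [Module.End.mul_apply, Module.End.mul_apply, trans_single, dOp_single,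
    dOp_single, map_sub, trans_single, map_sum]
  simp only [trans_single]
  rw [mul_inv_rev, actT_mul, actT_inv_apply]
  congr 1
  have e : (S_finite (w⁻¹ * piElt⁻¹)).toFinset =
      (S_finite w⁻¹).toFinset.image (fun γ => (piElt : W N) • γ) := by
    ext γ
    simp only [Set.Finite.mem_toFinset, Finset.mem_image]
    constructor
    · rintro ⟨h1, h2⟩
      refine ⟨piElt⁻¹ • γ, ⟨?_, ?_⟩, smul_inv_smul _ _⟩
      · rw [← isPos_piElt_smul, smul_inv_smul]
        exact h1
      · rw [smul_smul]
        exact h2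
    · rintro ⟨γ, ⟨h1, h2⟩, rfl⟩
      refine ⟨(isPos_piElt_smul γ).2 h1, ?_⟩
      rw [mul_smul, inv_smul_smul]
      exact h2
  rw [e, Finset.sum_image (fun a _ b _ hab => MulAction.injective _ hab)]
  refine Finset.sum_congr rfl fun γ _ => ?_
  show _ = Finsupp.single ((piElt • γ).refl * (piElt * w)) ((piElt • γ).eval (actT piElt ξ))
  rw [eval_actT, ← mul_assoc (piElt • γ).refl, refl_smul, mul_assoc]

theorem dOp_pi_apply (ζ : Wt N) (ξ : T N) (x : W N →₀ ℂ) :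
    dOp ζ ξ (trans piElt x) = trans piElt (dOp ζ (actT piElt⁻¹ ξ) x) := by
  have h1 := LinearMap.congr_fun (dOp_pi ζ (actT piElt⁻¹ ξ)) x
  rw [actT_apply_inv] at h1
  exact h1.symm

theorem dOp_pi_inv_apply (ζ : Wt N) (ξ : T N) (x : W N →₀ ℂ) :
    dOp ζ ξ (trans piElt⁻¹ x) = trans piElt⁻¹ (dOp ζ (actT piElt ξ) x) := by
  have h1 := dOp_pi_apply ζ (actT piElt ξ) (trans piElt⁻¹ x)
  rw [actT_inv_apply, ← Module.End.mul_apply (trans piElt), ← map_mul, mul_inv_cancel,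
    map_one, Module.End.one_apply] at h1
  rw [h1, ← Module.End.mul_apply (trans piElt⁻¹), ← map_mul, inv_mul_cancel, map_one,
    Module.End.one_apply]

/-- `W` is generated by the simple reflections and `π`. -/
theorem exists_word (w : W N) : ∃ (k : ℤ) (js : List (AffRoot N)),
    (∀ α ∈ js, α.IsSimple) ∧ w = piElt ^ k * (js.map AffRoot.refl).prod := by
  obtain ⟨e, h1, h2, -⟩ := exists_reduced w
  exact ⟨e.1, e.2, h1, h2⟩

theorem dOp_comm (ζ : Wt N) (ξ ξ' : T N) : dOp ζ ξ * dOp ζ ξ' = dOp ζ ξ' * dOp ζ ξ := by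
  let P : (W N →₀ ℂ) → Prop := fun x => ∀ ξ ξ', dOp ζ ξ (dOp ζ ξ' x) = dOp ζ ξ' (dOp ζ ξ x)
  have h1 : P (Finsupp.single 1 1) := by
    intro ξ ξ'
    have e : ∀ ξ, dOp ζ ξ (Finsupp.single 1 1) = pair ζ ξ • Finsupp.single 1 1 := fun ξ => by
      rw [dOp_one, Finsupp.smul_single, smul_eq_mul, mul_one]
    rw [e, e, map_smul, map_smul, e, e, smul_comm]
  have hs : ∀ α : AffRoot N, α.IsSimple → ∀ x, P x → P (trans α.refl x) := by
    intro α hα x hx ξ ξ'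
    simp only [dOp_simple_apply ζ hα, map_sub, map_smul]
    rw [hx, actT_refl, actT_refl]
    have e : ∀ (a : ℂ) (ξ η : T N) (y : W N →₀ ℂ),
        dOp ζ (ξ - a • η) y = dOp ζ ξ y - a • dOp ζ η y := fun a ξ η y => by
      have h2 := LinearMap.congr_fun (dOp_add ζ (ξ - a • η) (a • η)) y
      rw [sub_add_cancel, dOp_smul] at h2
      exact eq_sub_of_add_eq h2.symm
    simp only [e, smul_sub, map_sub, map_smul,
      smul_smul, mul_comm (α.eval ξ')]
    abel
  have hp : ∀ x, P x → P (trans piElt x) := by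
    intro x hx ξ ξ'
    simp only [dOp_pi_apply]
    rw [hx]
  have hp' : ∀ x, P x → P (trans piElt⁻¹ x) := by
    intro x hx ξ ξ'
    simp only [dOp_pi_inv_apply]
    rw [hx]
  have hl : ∀ js : List (AffRoot N), (∀ α ∈ js, α.IsSimple) →
      P (Finsupp.single ((js.map AffRoot.refl).prod) 1) := by
    intro js
    induction js with
    | nil => intro _; simpa using h1
    | cons α js ih =>
      intro h
      have := hs α (h α List.mem_cons_self) _ (ih fun γ hγ => h γ (List.mem_cons_of_mem _ hγ))
      rw [trans_single] at this
      rw [List.map_cons, List.prod_cons]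
      exact this
  refine hom_ext_single fun w => ?_
  obtain ⟨k, js, h, rfl⟩ := exists_word w
  have : P (Finsupp.single (piElt ^ k * (js.map AffRoot.refl).prod) 1) := by
    induction k with
    | zero => simpa using hl js h
    | succ k ih =>
      have := hp _ ih
      rw [trans_single, ← mul_assoc, ← zpow_one_add, add_comm] at this
      exact this
    | pred k ih =>
      have := hp' _ ih
      rw [trans_single, ← mul_assoc, ← zpow_neg_one, ← zpow_add,
        show (-1 : ℤ) + -(k : ℤ) = -k - 1 by ring] at this
      exact this
  exact this ξ ξ'

/-- The representation of `𝓗` induced from the character `ζ` of `S[𝔱']`, realized on `ℂ[W]`. -/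
noncomputable def principal (ζ : Wt N) : H N →ₐ[ℂ] Module.End ℂ (W N →₀ ℂ) :=
  RingQuot.liftAlgHom ℂ (s := Rel N)
    ⟨FreeAlgebra.lift ℂ (Sum.elim (fun w => trans w) fun ξ => dOp ζ ξ), by
      intro x y h
      induction h with
      | one => simp
      | mul w v => simp
      | add ξ ξ' => simp [dOp_add]
      | smul a ξ => simp [dOp_smul]
      | comm ξ ξ' => simpa using dOp_comm ζ ξ ξ'
      | simple α hα ξ =>
        simp only [map_sub, map_mul, FreeAlgebra.lift_ι_apply, Sum.elim_inl, Sum.elim_inr,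
          AlgHom.commutes]
        exact dOp_simple ζ hα ξ
      | pi ξ => simpa using dOp_pi ζ ξ⟩

theorem principal_ofW (ζ : Wt N) (w : W N) : principal ζ (H.ofW w) = trans w := by
  show RingQuot.liftAlgHom ℂ _ (RingQuot.mkAlgHom ℂ (Rel N) _) = _
  simp [RingQuot.liftAlgHom_mkAlgHom_apply]

theorem principal_ofT (ζ : Wt N) (ξ : T N) : principal ζ (H.ofT ξ) = dOp ζ ξ := by
  show RingQuot.liftAlgHom ℂ _ (RingQuot.mkAlgHom ℂ (Rel N) _) = _
  simp [RingQuot.liftAlgHom_mkAlgHom_apply]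

end Principal

section Parabolic

variable (N : ℕ)

/-- The finite simple roots `Π̄ = {α_1, …, α_{N-1}}`, `α_m = ε_m - ε_{m+1}`. -/
def PiBar : Set (AffRoot N) := {α | α.k = 0 ∧ (α.i : ℕ) + 1 = α.j}

/-- The finite positive roots `R̄₊ = {ε_i - ε_j | i < j}`. -/
def RBarPos : Set (AffRoot N) := {α | α.k = 0 ∧ α.i < α.j}

variable {N}

/-- The affine roots `ε_i - ε_j + k δ` with `i` and `j` in the same block `I_β^{(b)}` of the
ordered partition `β` of `N`. -/
def SameBlock (β : Composition N) : Set (AffRoot N) := {α | β.index α.i = β.index α.j}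

/-- `R̄_{β,+} = R̄₊ ∩ R̄_β`. -/
def RBarPosOf (β : Composition N) : Set (AffRoot N) := RBarPos N ∩ SameBlock β

/-- `Π̄_β = Π̄ ∩ R̄_β`. -/
def PiBarOf (β : Composition N) : Set (AffRoot N) := PiBar N ∩ SameBlock β

/-- `W̄_β`, the subgroup of `W̄` generated by the `s_α`, `α ∈ Π̄_β`. -/
def WBarOf (β : Composition N) : Subgroup (Equiv.Perm (Fin N)) :=
  Subgroup.closure {σ | ∃ α ∈ PiBarOf β, σ = Equiv.swap α.i α.j}

/-- `(𝔱')^*_β`. -/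
def tStar (β : Composition N) : Set (Wt N) := {ζ | ∀ α ∈ PiBarOf β, pairing ζ α = -1}

/-- `𝔱̄^*_β`; a vector `z` stands for `∑ z_i ε_i`. -/
def tBarStar (β : Composition N) : Set (Fin N → ℂ) :=
  {z | ∀ α ∈ PiBarOf β, z α.i - z α.j = -1}

theorem pairing_eq (ζ : Wt N) (α : AffRoot N) :
    pairing ζ α = ζ.1 α.i - ζ.1 α.j + α.k * ζ.2 := by
  simp [AffRoot.pairing, pair, AffRoot.coroot, mul_sub, Finset.sum_sub_distrib, Pi.single_apply]
  ring

theorem mem_tStar_of_mem_tBarStar {β : Composition N} {z : Fin N → ℂ} (h : z ∈ tBarStar β) :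
    ((z, 0) : Wt N) ∈ tStar β := by
  intro α hα
  rw [pairing_eq, mul_zero, add_zero]
  exact h α hα

/-- For every set of finite simple roots there is an ordered partition `β` of `N` such that
`Π̄_β` is this set. -/
theorem exists_composition (J : Set (AffRoot N)) (hJ : J ⊆ PiBar N) :
    ∃ β : Composition N, PiBarOf β = J := by
  classical
  let c : CompositionAsSet N :=
    { boundaries := Finset.univ.filter fun b : Fin (N + 1) => b = 0 ∨ b = Fin.last N ∨
        ∀ α ∈ J, (α.j : ℕ) ≠ b
      zero_mem := by simp
      getLast_mem := by simp }
  refine ⟨c.toComposition, ?_⟩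
  have hb := c.toComposition_boundaries
  set β := c.toComposition with hβ
  have key : ∀ i j : Fin N, (i : ℕ) + 1 = j →
      (β.index i = β.index j ↔ j.castSucc ∉ β.boundaries) := by
    intro i j hij
    have hi1 := β.sizeUpTo_index_le i
    have hi2 := β.lt_sizeUpTo_index_succ i
    have hj1 := β.sizeUpTo_index_le j
    have hj2 := β.lt_sizeUpTo_index_succ j
    rw [Fin.val_succ] at hi2 hj2
    have hm : ∀ q : Fin (β.length + 1), (β.boundary q : ℕ) = β.sizeUpTo q := fun q => rfl
    constructor
    · intro h hmem
      obtain ⟨q, -, hq⟩ := Finset.mem_map.1 hmem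
      have hq' : β.sizeUpTo q = j := by
        rw [← hm]
        exact congrArg Fin.val hq
      rw [← h] at hj1 hj2
      rcases Nat.lt_or_ge (β.index i : ℕ) q with h1 | h1
      · have := β.monotone_sizeUpTo (Nat.succ_le_of_lt h1)
        rw [Nat.succ_eq_add_one] at this
        omega
      · have := β.monotone_sizeUpTo h1
        omega
    · intro hmem
      have hle : β.index i ≤ β.index j := by
        by_contra h
        have h : (β.index j : ℕ) + 1 ≤ β.index i := by
          rw [not_le, Fin.lt_def] at h
          omega
        have := β.monotone_sizeUpTo h
        omega
      rcases hle.lt_or_eq with h | h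
      · exfalso
        have h : (β.index i : ℕ) + 1 ≤ β.index j := by
          rw [Fin.lt_def] at h
          omega
        have := β.monotone_sizeUpTo h
        apply hmem
        refine Finset.mem_map.2 ⟨(β.index i).succ, Finset.mem_univ _, Fin.ext ?_⟩
        show β.sizeUpTo (β.index i).succ = j
        rw [Fin.val_succ]
        omega
      · exact h
  ext α
  constructor
  · rintro ⟨h1, h2⟩
    have h3 := (key α.i α.j h1.2).1 h2
    rw [hb] at h3
    simp only [c, Finset.mem_filter, Finset.mem_univ, true_and, not_or, not_forall, not_not] at h3
    obtain ⟨-, -, γ, hγ, h4⟩ := h3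
    have h5 := hJ hγ
    have h6 : γ = α := by
      have hj : γ.j = α.j := Fin.ext h4
      refine AffRoot.ext (Fin.ext ?_) hj (h5.1.trans h1.1.symm)
      have := h5.2
      have := h1.2
      rw [Fin.val_castSucc] at h4
      omega
    exact h6 ▸ hγ
  · intro hα
    have h1 := hJ hα
    refine ⟨h1, (key α.i α.j h1.2).2 ?_⟩
    rw [hb]
    simp only [c, Finset.mem_filter, Finset.mem_univ, true_and, not_or, not_forall, not_not]
    refine ⟨?_, ?_, α, hα, rfl⟩
    · intro h
      have h2 := congrArg Fin.val h
      have h3 := h1.2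
      simp at h2
      omega
    · intro h
      have h2 := congrArg Fin.val h
      have h3 := α.j.2
      simp at h2
      omega

/-- The ordered partition `β(w)` of `N`, with `Π̄_{β(w)} = Π̄ ∩ w(R̄_{β,+})`. -/
noncomputable def betaOf (β : Composition N) (w : W N) : Composition N :=
  (exists_composition (PiBar N ∩ (fun α => w • α) '' RBarPosOf β) Set.inter_subset_left).choose

theorem PiBarOf_betaOf (β : Composition N) (w : W N) :
    PiBarOf (betaOf β w) = PiBar N ∩ (fun α => w • α) '' RBarPosOf β :=
  (exists_composition (PiBar N ∩ (fun α => w • α) '' RBarPosOf β)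
    Set.inter_subset_left).choose_spec

/-- `W^β = {w ∈ W | l(w u) ≥ l(w) for all u ∈ W̄_β}`. -/
def WSup (β : Composition N) : Set (W N) := {w | ∀ u ∈ WBarOf β, len w ≤ len (w * fin u)}

/-- `W̄^β = W^β ∩ W̄`. -/
def WBarSup (β : Composition N) : Set (Equiv.Perm (Fin N)) := {σ | fin σ ∈ WSup β}

/-- `ζ` is `β`-generic: `(ζ, α) ∉ {1, 0, -1}` for all `α ∈ ⋃_{w ∈ W^β} S(w)`. -/
def IsGeneric (β : Composition N) (ζ : Wt N) : Prop :=
  ∀ α ∈ ⋃ w ∈ WSup β, S w, pairing ζ α ∉ ({1, 0, -1} : Set ℂ)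

variable (N) in
/-- `P̄_- = {η ∈ P̄ | (η, α) ≤ 0 for all α ∈ R̄₊}`. -/
def PMinus : Set (Fin N → ℤ) := {η | ∀ α ∈ RBarPos N, η α.i - η α.j ≤ 0}

/-- `e` is the element `η_w ∈ P̄_-` attached to `w ∈ W̄^β`: `(η_w, ε_1) = 0` and `(η_w, α_i)`
is `-1` if `α_i ∈ w(R̄₊ ∖ R̄_{β,+})`, and `0` otherwise. -/
def IsEta [NeZero N] (β : Composition N) (w : Equiv.Perm (Fin N)) (e : Fin N → ℤ) : Prop :=
  e ∈ PMinus N ∧ e 0 = 0 ∧ ∀ α ∈ PiBar N,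
    (α ∈ (fun γ => fin w • γ) '' (RBarPos N \ RBarPosOf β) → e α.i - e α.j = -1) ∧
    (α ∉ (fun γ => fin w • γ) '' (RBarPos N \ RBarPosOf β) → e α.i - e α.j = 0)

/-- `P̄_-(w) = {η + η_w | η ∈ P̄_-}`. -/
def PMinusOf [NeZero N] (β : Composition N) (w : Equiv.Perm (Fin N)) : Set (Fin N → ℤ) :=
  {μ | ∃ η ∈ PMinus N, ∃ e, IsEta β w e ∧ μ = η + e}

/-- `X^β = {t_η w | w ∈ W̄^β, η ∈ P̄_-(w)}`, a set of representatives of `W̄ \ W / W̄_β`. -/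
def X [NeZero N] (β : Composition N) : Set (W N) :=
  {x | ∃ w ∈ WBarSup β, ∃ η ∈ PMinusOf β w, x = tr η * fin w}

theorem isSimple_of_mem {α : AffRoot N} (h : α ∈ PiBar N) : α.IsSimple := Or.inl h

theorem refl_of_mem {α : AffRoot N} (h : α ∈ PiBar N) : α.refl = fin (Equiv.swap α.i α.j) := by
  unfold AffRoot.refl
  rw [h.1, neg_zero, zero_smul]
  exact one_mul _

/-- The span of `W̄_β` in `ℂ[W]`. -/
noncomputable def blockSpan (β : Composition N) : Submodule ℂ (W N →₀ ℂ) :=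
  Submodule.span ℂ {x | ∃ σ ∈ WBarOf β, x = Finsupp.single (fin σ) 1}

/-- The augmentation of `ℂ[W]`. -/
noncomputable def augm : (W N →₀ ℂ) →ₗ[ℂ] ℂ := Finsupp.linearCombination ℂ fun _ => (1 : ℂ)

theorem augm_single (w : W N) (a : ℂ) : augm (Finsupp.single w a) = a := by simp [augm]

theorem augm_trans (v : W N) (x : W N →₀ ℂ) : augm (trans v x) = augm x := by
  have : augm ∘ₗ trans v = augm := by
    refine Finsupp.lhom_ext fun w a => ?_
    rw [LinearMap.comp_apply, trans_single, augm_single, augm_single]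
  exact LinearMap.congr_fun this x

theorem trans_mem_blockSpan {β : Composition N} {σ : Equiv.Perm (Fin N)} (hσ : σ ∈ WBarOf β)
    {x : W N →₀ ℂ} (hx : x ∈ blockSpan β) : trans (fin σ) x ∈ blockSpan β := by
  have : blockSpan β ≤ (blockSpan β).comap (trans (fin σ)) := by
    refine Submodule.span_le.2 ?_
    rintro _ ⟨τ, hτ, rfl⟩
    show trans (fin σ) _ ∈ blockSpan β
    rw [trans_single, ← map_mul]
    exact Submodule.subset_span ⟨_, mul_mem hσ hτ, rfl⟩
  exact this hx

theorem dOp_blockSpan {β : Composition N} {ζ : Wt N} (hζ : ζ ∈ tStar β) (ξ : T N)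
    {x : W N →₀ ℂ} (hx : x ∈ blockSpan β) :
    dOp ζ ξ x ∈ blockSpan β ∧ augm (dOp ζ ξ x) = pair ζ ξ * augm x := by
  have key : ∀ σ ∈ WBarOf β, ∀ ξ, dOp ζ ξ (Finsupp.single (fin σ) 1) ∈ blockSpan β ∧
      augm (dOp ζ ξ (Finsupp.single (fin σ) 1)) = pair ζ ξ := by
    have step : ∀ α ∈ PiBarOf β, ∀ τ ∈ WBarOf β,
        (∀ ξ, dOp ζ ξ (Finsupp.single (fin τ) 1) ∈ blockSpan β ∧
          augm (dOp ζ ξ (Finsupp.single (fin τ) 1)) = pair ζ ξ) →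
        ∀ ξ, dOp ζ ξ (Finsupp.single (fin (Equiv.swap α.i α.j * τ)) 1) ∈ blockSpan β ∧
          augm (dOp ζ ξ (Finsupp.single (fin (Equiv.swap α.i α.j * τ)) 1)) = pair ζ ξ := by
      intro α hα τ hτ h ξ
      have hs : Equiv.swap α.i α.j ∈ WBarOf β := Subgroup.subset_closure ⟨α, hα, rfl⟩
      have e : Finsupp.single (fin (Equiv.swap α.i α.j * τ)) (1 : ℂ) =
          trans α.refl (Finsupp.single (fin τ) 1) := by
        rw [trans_single, refl_of_mem hα.1, map_mul]
      rw [e, dOp_simple_apply ζ (isSimple_of_mem hα.1)]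
      constructor
      · refine sub_mem ?_ (Submodule.smul_mem _ _ (Submodule.subset_span ⟨τ, hτ, rfl⟩))
        rw [refl_of_mem hα.1]
        exact trans_mem_blockSpan hs (h _).1
      · rw [map_sub, augm_trans, (h _).2, map_smul, augm_single, actT_refl, sub_eq_add_neg ξ,
          ← neg_smul, pair_add, pair_smul]
        have : pair ζ α.coroot = -1 := hζ α hα
        rw [this, smul_eq_mul]
        ring
    intro σ hσ
    refine Subgroup.closure_induction_left
      (p := fun σ _ => ∀ ξ, dOp ζ ξ (Finsupp.single (fin σ) 1) ∈ blockSpan β ∧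
        augm (dOp ζ ξ (Finsupp.single (fin σ) 1)) = pair ζ ξ) ?_ ?_ ?_ hσ
    · intro ξ
      rw [map_one, dOp_one]
      refine ⟨?_, augm_single _ _⟩
      have : Finsupp.single (1 : W N) (pair ζ ξ) =
          pair ζ ξ • Finsupp.single (fin (1 : Equiv.Perm (Fin N))) (1 : ℂ) := by
        rw [map_one, Finsupp.smul_single, smul_eq_mul, mul_one]
      rw [this]
      exact Submodule.smul_mem _ _ (Submodule.subset_span ⟨1, one_mem _, rfl⟩)
    · rintro _ ⟨α, hα, rfl⟩ τ hτ h
      exact step α hα τ hτ h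
    · rintro _ ⟨α, hα, rfl⟩ τ hτ h
      rw [Equiv.swap_inv]
      exact step α hα τ hτ h
  refine Submodule.span_induction ?_ ?_ ?_ ?_ hx
  · rintro _ ⟨σ, hσ, rfl⟩
    rw [augm_single, mul_one]
    exact key σ hσ ξ
  · simp
  · intro x y _ _ h1 h2
    rw [map_add, map_add, map_add, h1.2, h2.2, mul_add]
    exact ⟨add_mem h1.1 h2.1, rfl⟩
  · intro a x _ h
    rw [map_smul, map_smul, map_smul, h.2, smul_eq_mul, smul_eq_mul, mul_left_comm]
    exact ⟨Submodule.smul_mem _ _ h.1, rfl⟩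

variable [NeZero N]

/-- The parabolic subalgebra `𝓗_β` of `𝓗`, generated by `W̄_β` and `𝔱'`. -/
noncomputable def HOf (β : Composition N) : Subalgebra ℂ (H N) :=
  Algebra.adjoin ℂ ((fun σ : Equiv.Perm (Fin N) => H.ofW (fin σ)) '' WBarOf β ∪
    Set.range fun ξ : T N => H.ofT ξ)

/-- The parabolic subalgebra `𝓗̄_β` of `𝓗̄`, generated by `W̄_β` and `𝔱̄`. -/
noncomputable def HBarOf (β : Composition N) : Subalgebra ℂ (H N) :=
  Algebra.adjoin ℂ ((fun σ : Equiv.Perm (Fin N) => H.ofW (fin σ)) '' WBarOf β ∪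
    Set.range fun x : Fin N → ℂ => H.ofT (x, 0))

theorem HBarOf_le_HOf (β : Composition N) : HBarOf β ≤ HOf β := by
  refine Algebra.adjoin_mono (Set.union_subset_union_right _ ?_)
  rintro _ ⟨x, rfl⟩
  exact ⟨(x, 0), rfl⟩

theorem HBarOf_le_Hbar (β : Composition N) : HBarOf β ≤ Hbar N := by
  refine Algebra.adjoin_mono (Set.union_subset_union_left _ ?_)
  rintro _ ⟨σ, -, rfl⟩
  exact ⟨σ, rfl⟩

/-- The value at `h` of the character of `𝓗_β`. -/
noncomputable def charFun (ζ : Wt N) (h : H N) : ℂ :=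
  augm (principal ζ h (Finsupp.single 1 1))

theorem principal_blockSpan {β : Composition N} {ζ : Wt N} (hζ : ζ ∈ tStar β) {h : H N}
    (hh : h ∈ HOf β) : ∀ x ∈ blockSpan β,
      principal ζ h x ∈ blockSpan β ∧ augm (principal ζ h x) = charFun ζ h * augm x := by
  have h1 : Finsupp.single (1 : W N) (1 : ℂ) ∈ blockSpan β :=
    Submodule.subset_span ⟨1, one_mem _, by rw [map_one]⟩
  suffices H : ∃ a : ℂ, ∀ x ∈ blockSpan β,
      principal ζ h x ∈ blockSpan β ∧ augm (principal ζ h x) = a * augm x by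
    obtain ⟨a, ha⟩ := H
    have : charFun ζ h = a := by
      rw [charFun, (ha _ h1).2, augm_single, mul_one]
    rw [this]
    exact ha
  refine Algebra.adjoin_induction
    (p := fun h _ => ∃ a : ℂ, ∀ x ∈ blockSpan β,
      principal ζ h x ∈ blockSpan β ∧ augm (principal ζ h x) = a * augm x) ?_ ?_ ?_ ?_ hh
  · rintro _ (⟨σ, hσ, rfl⟩ | ⟨ξ, rfl⟩)
    · refine ⟨1, fun x hx => ?_⟩
      show principal ζ (H.ofW (fin σ)) x ∈ _ ∧ augm (principal ζ (H.ofW (fin σ)) x) = _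
      rw [principal_ofW, augm_trans, one_mul]
      exact ⟨trans_mem_blockSpan hσ hx, rfl⟩
    · refine ⟨pair ζ ξ, fun x hx => ?_⟩
      show principal ζ (H.ofT ξ) x ∈ _ ∧ augm (principal ζ (H.ofT ξ) x) = _
      rw [principal_ofT]
      exact dOp_blockSpan hζ ξ hx
  · intro r
    refine ⟨r, fun x hx => ?_⟩
    rw [AlgHom.commutes, Module.algebraMap_end_apply, map_smul, smul_eq_mul]
    exact ⟨Submodule.smul_mem _ _ hx, rfl⟩
  · rintro y z _ _ ⟨a, ha⟩ ⟨b, hb⟩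
    refine ⟨a + b, fun x hx => ?_⟩
    rw [map_add, LinearMap.add_apply, map_add, (ha x hx).2, (hb x hx).2, add_mul]
    exact ⟨add_mem (ha x hx).1 (hb x hx).1, rfl⟩
  · rintro y z _ _ ⟨a, ha⟩ ⟨b, hb⟩
    refine ⟨a * b, fun x hx => ?_⟩
    rw [map_mul, Module.End.mul_apply, (ha _ (hb x hx).1).2, (hb x hx).2, mul_assoc]
    exact ⟨(ha _ (hb x hx).1).1, rfl⟩

/-- The character of `𝓗_β` given by `ζ ∈ (𝔱')^*_β`, with `w ↦ 1` for `w ∈ W̄_β` and `ξ ↦ ζ(ξ)`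
for `ξ ∈ 𝔱'`; see `character_ofW` and `character_ofT`. -/
noncomputable def character (β : Composition N) (ζ : Wt N) (hζ : ζ ∈ tStar β) :
    HOf β →ₐ[ℂ] ℂ where
  toFun h := charFun ζ h
  map_one' := by simp [charFun, augm_single]
  map_zero' := by simp [charFun]
  map_add' h h' := by simp [charFun]
  map_mul' h h' := by
    have h1 : Finsupp.single (1 : W N) (1 : ℂ) ∈ blockSpan β :=
      Submodule.subset_span ⟨1, one_mem _, by rw [map_one]⟩
    have h2 := principal_blockSpan hζ h'.2 _ h1
    show augm (principal ζ (h.1 * h'.1) _) = _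
    rw [map_mul, Module.End.mul_apply, (principal_blockSpan hζ h.2 _ h2.1).2]
    rfl
  commutes' r := by
    show augm (principal ζ (algebraMap ℂ (H N) r) _) = r
    rw [AlgHom.commutes, Module.algebraMap_end_apply, map_smul, augm_single, smul_eq_mul, mul_one]

theorem character_ofW (β : Composition N) (ζ : Wt N) (hζ : ζ ∈ tStar β)
    (σ : Equiv.Perm (Fin N)) (hσ : σ ∈ WBarOf β) :
    character β ζ hζ
      ⟨H.ofW (fin σ), Algebra.subset_adjoin (Or.inl ⟨σ, hσ, rfl⟩)⟩ = 1 := by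
  show augm (principal ζ (H.ofW (fin σ)) _) = 1
  rw [principal_ofW, augm_trans, augm_single]

theorem character_ofT (β : Composition N) (ζ : Wt N) (hζ : ζ ∈ tStar β) (ξ : T N) :
    character β ζ hζ ⟨H.ofT ξ, Algebra.subset_adjoin (Or.inr ⟨ξ, rfl⟩)⟩ = pair ζ ξ := by
  show augm (principal ζ (H.ofT ξ) _) = pair ζ ξ
  rw [principal_ofT, dOp_one, augm_single]

/-- The character of `𝓗̄_β` given by `z ∈ 𝔱̄^*_β`, with `w ↦ 1` for `w ∈ W̄_β` and
`ξ ↦ z(ξ)` for `ξ ∈ 𝔱̄`. -/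
noncomputable def characterBar (β : Composition N) (z : Fin N → ℂ) (hz : z ∈ tBarStar β) :
    HBarOf β →ₐ[ℂ] ℂ :=
  (character β (z, 0) (mem_tStar_of_mem_tBarStar hz)).comp
    (Subalgebra.inclusion (HBarOf_le_HOf β))

end Parabolic

section Induced

variable {A B V : Type} [Ring A] [Algebra ℂ A] [Ring B] [Algebra ℂ B] [AddCommGroup V]
  [Module ℂ V]

/-- The `A`-module `A ⊗_B V`, for an algebra homomorphism `f : B → A` and a representation `τ` of
`B` on `V`: the quotient of `A ⊗_ℂ V` by the relations `a f(b) ⊗ v = a ⊗ b v`. -/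
abbrev Induced (f : B →ₐ[ℂ] A) (τ : B →ₐ[ℂ] Module.End ℂ V) : Type :=
  (A ⊗[ℂ] V) ⧸ Submodule.span A
    {t : A ⊗[ℂ] V | ∃ (a : A) (b : B) (v : V), t = (a * f b) ⊗ₜ[ℂ] v - a ⊗ₜ[ℂ] τ b v}

/-- The one-dimensional representation of `B` given by a character. -/
noncomputable def oneDim (χ : B →ₐ[ℂ] ℂ) : B →ₐ[ℂ] Module.End ℂ ℂ :=
  (Algebra.lmul ℂ ℂ).comp χ

end Induced

section Modules

variable {N : ℕ} [NeZero N]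

/-- The induced module `𝒴_β(ζ) = 𝓗 ⊗_{𝓗_β} ℂ 1_ζ`. -/
abbrev Y (β : Composition N) (ζ : Wt N) (hζ : ζ ∈ tStar β) : Type :=
  Induced (HOf β).val (oneDim (character β ζ hζ))

/-- The cyclic vector `𝟏_ζ = 1 ⊗ 1_ζ` of `𝒴_β(ζ)`. -/
noncomputable def oneVec (β : Composition N) (ζ : Wt N) (hζ : ζ ∈ tStar β) : Y β ζ hζ :=
  Submodule.Quotient.mk ((1 : H N) ⊗ₜ[ℂ] (1 : ℂ))

/-- The induced module `𝒴̄_β(z) = 𝓗̄ ⊗_{𝓗̄_β} ℂ 1_z`. -/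
abbrev YBar (β : Composition N) (z : Fin N → ℂ) (hz : z ∈ tBarStar β) : Type :=
  Induced (Subalgebra.inclusion (HBarOf_le_Hbar β)) (oneDim (characterBar β z hz))

/-- The `𝓗̄`-submodule `𝓗̄ φ_x 𝟏_ζ` of `𝒴_β(ζ)`. -/
noncomputable def summand (β : Composition N) (ζ : Wt N) (hζ : ζ ∈ tStar β) (x : W N) :
    Submodule (Hbar N) (Y β ζ hζ) :=
  Submodule.span (Hbar N) {phi x • oneVec β ζ hζ}

end Modules

end DDAHA

/-! The module 𝒴_β(ζ) has a basis of weight vectors φ_w 𝟏_ζ, one for each w ∈ W^β, of weight w(ζ).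
The theorem is read off from how 𝓗̄ moves this basis.

Genericity enters in two ways. Since (ζ, α) ≠ 0 on inversions, each w ∈ W^β preserves the sign of
every root orthogonal to ζ. As (ζ, δ) ≠ 0, an element of the stabilizer of ζ with this property is
trivial (`eq_one_of_stabilizer`), so the weights w(ζ) are distinct. They are distinct already on 𝔱̄,
because W does not change the value at c. Excluding the values ±1 makes φ_α² = 1 - (α^∨)² a nonzero
scalar at each letter of a reduced word inside W^β, so the vectors φ_w 𝟏_ζ do not vanish
(`IsCyclicVec.word`). They are triangular in length with respect to the vectors w 𝟏_ζ, hence span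
(`IsCyclicVec.span_phi`), and are independent as joint eigenvectors with distinct eigenvalues. That
𝟏_ζ itself is not zero is seen in the representation of 𝓗 on ℂ[W] (`oneVec_ne_zero`).

For simple α, the vector φ_α φ_w 𝟏_ζ has weight s_α w(ζ). By uniqueness of weights it is a nonzero
multiple of φ_{s_α w} 𝟏_ζ if s_α w ∈ W^β, and zero otherwise; in the second case s_α fixes φ_w 𝟏_ζ
(`IsCyclicVec.phiSimple_smul_phi`, `IsCyclicVec.refl_smul_phi`). With α finite, this shows that 𝓗̄
preserves the span of the φ_w 𝟏_ζ over each coset W̄w, and that moves inside W^β are reversible. The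
part of W^β in a coset is connected under these moves and contains exactly one element of X^β,
namely the one sorted with respect to a suitable order on indices (`exists_sorted`, `mem_X_iff`).
This gives the direct sum. A nonzero submodule of a summand contains some φ_w 𝟏_ζ by separation of
weights, hence also the generator φ_x 𝟏_ζ, which gives irreducibility. Finally 𝒴̄_{β(x)} maps onto
the summand by its universal property. It is spanned by translates indexed by u ∈ W̄^{β(x)}, while
the summand contains the independent vectors φ_{ux} 𝟏_ζ, so the map is injective. -/

namespace DDAHA

open AffRoot

/-! ### Roots, lengths, the representatives W^β, and the weights w(ζ). -/

section Combinatorics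

variable {N : ℕ}

/-- The negative of a root. -/
def AffRoot.neg (α : AffRoot N) : AffRoot N := ⟨α.j, α.i, α.ne.symm, -α.k⟩

/-- The signed height of a root; it is positive exactly on positive roots, and `1` exactly on
simple roots. -/
def AffRoot.height (α : AffRoot N) : ℤ := α.k * N + (α.j : ℕ) - (α.i : ℕ)

theorem isPos_iff_height (α : AffRoot N) : α.IsPos ↔ 0 < α.height := isPos_iff α

theorem height_neg (α : AffRoot N) : α.neg.height = -α.height := by
  simp only [AffRoot.height, AffRoot.neg]; ring

theorem isPos_neg_iff (α : AffRoot N) : α.neg.IsPos ↔ ¬ α.IsPos := by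
  rw [not_isPos_iff, isPos_iff_height, height_neg]
  simp only [AffRoot.height]; omega

theorem neg_neg_root (α : AffRoot N) : α.neg.neg = α := by
  ext <;> simp [AffRoot.neg]

theorem smul_neg_root (w : W N) (α : AffRoot N) : w • α.neg = (w • α).neg := by
  ext
  · rfl
  · rfl
  · simp only [smul_k, AffRoot.neg, smul_i, smul_j]; ring

theorem height_smul (w : W N) (α : AffRoot N) :
    (w • α).height = α.k * N + ht w α.j - ht w α.i := by
  rw [AffRoot.height, smul_i, smul_j, smul_k, ht, ht]
  ring

theorem refl_smul_self' (α : AffRoot N) : α.refl • α = α.neg := refl_smul_self α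

theorem pairing_neg (ζ : Wt N) (α : AffRoot N) : pairing ζ α.neg = -pairing ζ α := by
  rw [pairing_eq, pairing_eq]
  simp only [AffRoot.neg]
  push_cast
  ring

theorem height_eq_one_of_isSimple {α : AffRoot N} (h : α.IsSimple) : α.height = 1 := by
  rw [AffRoot.height]
  rcases h with ⟨h1, h2⟩ | ⟨h1, h2, h3⟩
  · rw [h1]; omega
  · rw [h1]; omega

theorem isPos_refl_smul_iff {α γ : AffRoot N} (h : α.IsSimple) (h1 : γ ≠ α) (h2 : γ ≠ α.neg) :
    (α.refl • γ).IsPos ↔ γ.IsPos := by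
  constructor
  · intro h3
    have h4 : α.refl • γ ≠ α := by
      intro h4
      apply h2
      rw [← refl_smul_self', ← congrArg (fun a => α.refl • a) h4, refl_smul_refl_smul]
    have := simple_pos h h3 h4
    rwa [refl_smul_refl_smul] at this
  · intro h3
    exact simple_pos h h3 h1

/-- The map γ ↦ -wγ is a bijection from S(w) to S(w⁻¹). Inversion turns facts on right
multiplication by a simple reflection into facts on left multiplication. -/
theorem len_inv (w : W N) : len w⁻¹ = len w := by
  have key : S w⁻¹ = (fun γ => (w • γ).neg) '' S w := by
    ext γ
    constructor
    · rintro ⟨h1, h2⟩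
      refine ⟨(w⁻¹ • γ).neg, ⟨(isPos_neg_iff _).2 h2, ?_⟩, ?_⟩
      · rw [smul_neg_root, smul_inv_smul, isPos_neg_iff, not_not]
        exact h1
      · simp only [smul_neg_root, smul_inv_smul, neg_neg_root]
    · rintro ⟨γ, ⟨h1, h2⟩, rfl⟩
      refine ⟨(isPos_neg_iff _).2 h2, ?_⟩
      rw [smul_neg_root, inv_smul_smul, isPos_neg_iff, not_not]
      exact h1
  unfold len
  rw [key, Set.ncard_image_of_injective]
  intro a b hab
  have : w • a = w • b := by
    have := congrArg AffRoot.neg hab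
    simpa only [neg_neg_root] using this
  exact MulAction.injective _ this

theorem len_mul_refl_of_isPos {w : W N} {α : AffRoot N} (h : α.IsSimple) (hw : (w • α).IsPos) :
    len (w * α.refl) = len w + 1 := by
  have h1 := mem_S_mul_refl (w := w) h (fun h' => h'.2 hw)
  have h2 := len_mul_refl h h1
  rw [mul_assoc, refl_mul_refl, mul_one] at h2
  omega

theorem len_refl_mul_of_isPos {w : W N} {α : AffRoot N} (h : α.IsSimple)
    (hw : (w⁻¹ • α).IsPos) : len (α.refl * w) = len w + 1 := by
  rw [← len_inv, mul_inv_rev, refl_inv, len_mul_refl_of_isPos h hw, len_inv]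

theorem len_refl_mul_of_not_isPos {w : W N} {α : AffRoot N} (h : α.IsSimple)
    (hw : ¬ (w⁻¹ • α).IsPos) : len (α.refl * w) + 1 = len w := by
  rw [← len_inv, mul_inv_rev, refl_inv, len_mul_refl h ⟨IsSimple.isPos h, hw⟩, len_inv]

theorem len_one : len (1 : W N) = 0 := by
  rw [len, S_one, Set.ncard_empty]

theorem len_prod_refl_le {js : List (AffRoot N)} (h : ∀ α ∈ js, α.IsSimple) :
    len (js.map AffRoot.refl).prod ≤ js.length := by
  induction js with
  | nil => simp [len_one]
  | cons α js ih =>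
    have h1 := ih fun γ hγ => h γ (List.mem_cons_of_mem _ hγ)
    have h2 := h α List.mem_cons_self
    rw [List.map_cons, List.prod_cons, List.length_cons]
    by_cases hp : (((js.map AffRoot.refl).prod)⁻¹ • α).IsPos
    · rw [len_refl_mul_of_isPos h2 hp]; omega
    · have := len_refl_mul_of_not_isPos h2 hp; omega

theorem isPos_zpow_smul [NeZero N] (k : ℤ) (α : AffRoot N) :
    ((piElt ^ k : W N) • α).IsPos ↔ α.IsPos := by
  induction k with
  | zero => simp
  | succ k ih => rw [add_comm, zpow_one_add, mul_smul, isPos_piElt_smul, ih]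
  | pred k ih =>
    rw [← isPos_piElt_smul, smul_smul, ← zpow_one_add, show (1 : ℤ) + (-k - 1) = -k by ring, ih]

theorem len_zpow_mul [NeZero N] (k : ℤ) (w : W N) : len (piElt ^ k * w) = len w := by
  unfold len
  congr 1
  ext α
  simp only [S, Set.mem_ofPred_eq, mul_smul, isPos_zpow_smul]

/-! ### Blocks -/

theorem index_mono (β : Composition N) {i j : Fin N} (h : i ≤ j) : β.index i ≤ β.index j := by
  by_contra h'
  have h1 : (β.index j : ℕ) + 1 ≤ β.index i := by
    rw [not_le, Fin.lt_def] at h'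
    omega
  have h2 := β.monotone_sizeUpTo h1
  have h3 := β.sizeUpTo_index_le i
  have h4 := β.lt_sizeUpTo_index_succ j
  rw [Fin.val_succ] at h4
  rw [Fin.le_def] at h
  omega

theorem index_eq_of_mem_WBarOf {β : Composition N} {u : Equiv.Perm (Fin N)} (hu : u ∈ WBarOf β)
    (i : Fin N) : β.index (u i) = β.index i := by
  induction hu using Subgroup.closure_induction generalizing i with
  | mem u h =>
    obtain ⟨α, hα, rfl⟩ := h
    have h2 : β.index α.i = β.index α.j := hα.2
    rw [Equiv.swap_apply_def]
    split_ifs with h3 h4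
    · rw [h3, h2]
    · rw [h4, h2]
    · rfl
  | one => rfl
  | mul u v _ _ h1 h2 => rw [Equiv.Perm.mul_apply, h1, h2]
  | inv u _ h => rw [← h (u⁻¹ i), ← Equiv.Perm.mul_apply, mul_inv_cancel, Equiv.Perm.one_apply]

/-- Only neighbours between i and j are tested, so that the lemma can be used inside one block or
one interval of positions. -/
theorem strictMono_of_adjacent {α : Type*} [Preorder α] {f : Fin N → α} {i j : Fin N}
    (hij : i < j) (h : ∀ a b : Fin N, i ≤ a → b ≤ j → (a : ℕ) + 1 = b → f a < f b) :
    f i < f j := by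
  have key : ∀ d : ℕ, ∀ hd : (i : ℕ) + d + 1 ≤ j, f i < f ⟨i + d + 1, by omega⟩ := by
    intro d
    induction d with
    | zero =>
      intro hd
      exact h _ _ le_rfl (by rw [Fin.le_def]; exact hd) rfl
    | succ d ih =>
      intro hd
      refine (ih (by omega)).trans (h _ _ ?_ ?_ rfl)
      · rw [Fin.le_def]; simp only []; omega
      · rw [Fin.le_def]; exact hd
  rw [Fin.lt_def] at hij
  have := key (j - i - 1) (by omega)
  have e : (⟨i + (j - i - 1) + 1, by omega⟩ : Fin N) = j := Fin.ext (by simp only []; omega)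
  rwa [e] at this

/-- The `w ∈ W` with `w(R̄_{β,+}) ⊂ R₊`. -/
def BlockIncr (β : Composition N) (w : W N) : Prop :=
  ∀ i j : Fin N, i < j → β.index i = β.index j → ht w i < ht w j

theorem isPos_smul_iff_of_mem {w : W N} {α : AffRoot N} (h : α.k = 0) :
    (w • α).IsPos ↔ ht w α.i < ht w α.j := by
  rw [isPos_smul_iff, h, zero_mul]
  constructor <;> intro h <;> linarith

/-- Blocks are intervals, so the chain of neighbours from i to j stays in one block and runs through
roots of Π̄_β. -/
theorem blockIncr_of_simple {β : Composition N} {w : W N}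
    (h : ∀ α ∈ PiBarOf β, (w • α).IsPos) : BlockIncr β w := by
  intro i j hij hb
  refine strictMono_of_adjacent hij fun a b ha hb' hab => ?_
  have h1 := index_mono β ha
  have h2 := index_mono β hb'
  have h3 : a ≤ b := by rw [Fin.le_def]; omega
  have h4 := index_mono β h3
  have h5 : β.index a = β.index b :=
    le_antisymm h4 (h2.trans (hb.symm.le.trans h1))
  have := h ⟨a, b, fun e => by rw [e] at hab; omega, 0⟩ ⟨⟨rfl, hab⟩, h5⟩
  exact (isPos_smul_iff_of_mem rfl).1 this

theorem swap_mem_WBarOf {β : Composition N} {α : AffRoot N} (h : α ∈ PiBarOf β) :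
    Equiv.swap α.i α.j ∈ WBarOf β := Subgroup.subset_closure ⟨α, h, rfl⟩

/-- If w makes a root of Π̄_β negative, the reflection in this root shortens w. Conversely γ ↦ u⁻¹γ
embeds S(w) in S(wu): as u⁻¹ preserves the blocks, it can make a positive root negative only if k =
0 and both indices lie in one block, and such a root is not an inversion of w. -/
theorem mem_WSup_iff {β : Composition N} {w : W N} : w ∈ WSup β ↔ BlockIncr β w := by
  constructor
  · intro h
    refine blockIncr_of_simple fun α hα => ?_
    by_contra hw
    have h1 := h _ (swap_mem_WBarOf hα)
    rw [← refl_of_mem hα.1] at h1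
    have h2 := len_mul_refl (isSimple_of_mem hα.1) ⟨IsSimple.isPos (isSimple_of_mem hα.1), hw⟩
    omega
  · intro h u hu
    unfold len
    refine Set.ncard_le_ncard_of_injOn (fun γ => (fin u)⁻¹ • γ) ?_
      (MulAction.injective _).injOn (S_finite _)
    rintro γ ⟨h1, h2⟩
    refine ⟨?_, ?_⟩
    · have hu' := inv_mem hu
      have e1 := index_eq_of_mem_WBarOf hu' γ.i
      have e2 := index_eq_of_mem_WBarOf hu' γ.j
      rw [← map_inv]
      rcases h1 with h1 | ⟨h1, h3⟩
      · left
        have : (fin u⁻¹ • γ).k = γ.k - (0 - 0) := rfl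
        rw [this]; omega
      · right
        refine ⟨?_, ?_⟩
        · have : (fin u⁻¹ • γ).k = γ.k - (0 - 0) := rfl
          rw [this]; omega
        · show u⁻¹ γ.i < u⁻¹ γ.j
          have h4 : β.index γ.i ≠ β.index γ.j := fun h4 =>
            h2 ((isPos_smul_iff_of_mem h1).2 (h _ _ h3 h4))
          have h5 := (index_mono β h3.le).lt_of_ne h4
          by_contra h6
          have h7 := index_mono β (not_lt.1 h6)
          rw [e1, e2] at h7
          exact absurd h5 (not_lt.2 h7)
    · show ¬ ((w * fin u) • (fin u)⁻¹ • γ).IsPos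
      rw [mul_smul, smul_inv_smul]
      exact h2

theorem isPos_smul_of_mem_WSup {β : Composition N} {w : W N} (hw : w ∈ WSup β) {α : AffRoot N}
    (h : α ∈ RBarPosOf β) : (w • α).IsPos :=
  (isPos_smul_iff_of_mem h.1.1).2 (mem_WSup_iff.1 hw _ _ h.1.2 h.2)

theorem PiBarOf_subset_RBarPosOf (β : Composition N) : PiBarOf β ⊆ RBarPosOf β := fun α h =>
  ⟨⟨h.1.1, by have := h.1.2; rw [Fin.lt_def]; omega⟩, h.2⟩

theorem one_mem_WSup (β : Composition N) : (1 : W N) ∈ WSup β := fun u _ => by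
  rw [len_one]; exact Nat.zero_le _

/-- Every coset `w W̄_β` meets `W^β` in an element that is not longer than `w`. -/
theorem exists_mul_mem_WSup (β : Composition N) (w : W N) :
    ∃ u ∈ WBarOf β, w * fin u ∈ WSup β ∧ len (w * fin u) ≤ len w := by
  induction hn : len w using Nat.strong_induction_on generalizing w with
  | _ n ih =>
    by_cases h : ∀ α ∈ PiBarOf β, (w • α).IsPos
    · exact ⟨1, one_mem _, by rw [map_one, mul_one]; exact mem_WSup_iff.2 (blockIncr_of_simple h),
        by rw [map_one, mul_one, hn]⟩
    · push Not at h
      obtain ⟨α, hα, h⟩ := h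
      have h2 := len_mul_refl (isSimple_of_mem hα.1) ⟨IsSimple.isPos (isSimple_of_mem hα.1), h⟩
      obtain ⟨u, hu, h3, h4⟩ := ih (len (w * α.refl)) (by omega) _ rfl
      have e : w * fin (Equiv.swap α.i α.j * u) = w * α.refl * fin u := by
        rw [map_mul, ← refl_of_mem hα.1, mul_assoc]
      exact ⟨_, mul_mem (swap_mem_WBarOf hα) hu, by rwa [e], by rw [e]; omega⟩

/-- If a simple reflection moves `w` out of `W^β` then it acts on `w W̄_β` trivially. -/
theorem inv_smul_mem_PiBarOf {β : Composition N} {w : W N} (hw : w ∈ WSup β) {α : AffRoot N}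
    (hα : α.IsSimple) (h : α.refl * w ∉ WSup β) : w⁻¹ • α ∈ PiBarOf β := by
  rw [mem_WSup_iff] at hw h
  unfold BlockIncr at h
  push Not at h
  obtain ⟨i, j, hij, hb, h⟩ := h
  let γ : AffRoot N := ⟨i, j, hij.ne, 0⟩
  have h1 : (w • γ).IsPos := (isPos_smul_iff_of_mem rfl).2 (hw i j hij hb)
  have h2 : ¬ (α.refl • w • γ).IsPos := by
    rw [smul_smul, isPos_smul_iff_of_mem rfl, not_lt]
    exact h
  have h3 : w • γ = α := by
    by_contra h3
    exact h2 (simple_pos hα h1 h3)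
  have h4 : w⁻¹ • α = γ := by rw [← h3, inv_smul_smul]
  rw [h4]
  refine ⟨⟨rfl, ?_⟩, hb⟩
  -- A simple root has height 1, so `ht w j = ht w i + 1`. An index strictly between i and j would
  -- belong to the same block and force a difference of at least 2.
  have h5 := height_smul w γ
  rw [h3, height_eq_one_of_isSimple hα] at h5
  simp only [γ, zero_mul, zero_add] at h5
  by_contra h6
  have h7 : (i : ℕ) + 1 < j := by
    rw [Fin.lt_def] at hij
    change ¬ (i : ℕ) + 1 = j at h6
    omega
  let m : Fin N := ⟨i + 1, by omega⟩
  have h8 : i < m := by rw [Fin.lt_def]; simp [m]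
  have h9 : m < j := by rw [Fin.lt_def]; exact h7
  have h10 : β.index i = β.index m :=
    le_antisymm (index_mono β h8.le) ((index_mono β h9.le).trans hb.symm.le)
  have h11 := hw i m h8 h10
  have h12 := hw m j h9 (h10.symm.trans hb)
  omega

/-! ### Weights -/

theorem actWt_mul (w v : W N) (ζ : Wt N) : actWt (w * v) ζ = actWt w (actWt v ζ) := by
  ext m
  · simp only [actWt, lat_mul, SemidirectProduct.mul_right, mul_inv_rev, Equiv.Perm.mul_apply]
    push_cast
    ring
  · rfl

theorem actWt_one (ζ : Wt N) : actWt 1 ζ = ζ := by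
  ext m
  · simp [actWt, lat]
  · rfl

theorem pair_actWt (w : W N) (ζ : Wt N) (ξ : T N) : pair (actWt w ζ) (actT w ξ) = pair ζ ξ := by
  show ∑ m, (ζ.1 (w.right⁻¹ m) + ζ.2 * (lat w m : ℂ)) * ξ.1 (w.right⁻¹ m) +
    ζ.2 * (ξ.2 - ∑ m, (lat w m : ℂ) * ξ.1 (w.right⁻¹ m)) = ∑ m, ζ.1 m * ξ.1 m + ζ.2 * ξ.2
  have h : ∑ m, ζ.1 (w.right⁻¹ m) * ξ.1 (w.right⁻¹ m) = ∑ m, ζ.1 m * ξ.1 m :=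
    Equiv.sum_comp w.right⁻¹ fun m => ζ.1 m * ξ.1 m
  simp only [add_mul, Finset.sum_add_distrib, h, mul_assoc, ← Finset.mul_sum]
  ring

theorem pair_actWt_eq (w : W N) (ζ : Wt N) (ξ : T N) :
    pair (actWt w ζ) ξ = pair ζ (actT w⁻¹ ξ) := by
  rw [← pair_actWt w ζ, actT_apply_inv]

theorem coroot_smul (w : W N) (α : AffRoot N) : (w • α).coroot = actT w α.coroot := by
  ext m
  · show (Pi.single (w.right α.i) 1 - Pi.single (w.right α.j) 1 : Fin N → ℂ) m =
      (Pi.single α.i 1 - Pi.single α.j 1 : Fin N → ℂ) (w.right⁻¹ m)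
    simp only [Pi.sub_apply, Pi.single_apply, Equiv.Perm.inv_eq_iff_eq]
  · show ((w • α).k : ℂ) = (α.k : ℂ) - ∑ m, (lat w m : ℂ) *
      (Pi.single α.i 1 - Pi.single α.j 1 : Fin N → ℂ) (w.right⁻¹ m)
    have h : ∑ m, (lat w m : ℂ) *
        (Pi.single α.i 1 - Pi.single α.j 1 : Fin N → ℂ) (w.right⁻¹ m) =
        ∑ m, (lat w (w.right m) : ℂ) * (Pi.single α.i 1 - Pi.single α.j 1 : Fin N → ℂ) m := by
      rw [← Equiv.sum_comp w.right]
      simp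
    rw [h, smul_k]
    simp [mul_sub, Finset.sum_sub_distrib, Pi.single_apply]

theorem pairing_actWt (w : W N) (ζ : Wt N) (α : AffRoot N) :
    pairing (actWt w ζ) (w • α) = pairing ζ α := by
  rw [AffRoot.pairing, coroot_smul, pair_actWt]; rfl

theorem pairing_actWt_eq (w : W N) (ζ : Wt N) (α : AffRoot N) :
    pairing (actWt w ζ) α = pairing ζ (w⁻¹ • α) := by
  rw [← pairing_actWt w ζ, smul_inv_smul]

/-- An element of the stabilizer of `ζ` that preserves the positive roots orthogonal to `ζ` is
trivial. -/
theorem eq_one_of_stabilizer {ζ : Wt N} (hκ : ζ.2 ≠ 0) {g : W N} (hg : actWt g ζ = ζ)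
    (hp : ∀ a : AffRoot N, pairing ζ a = 0 → ((g • a).IsPos ↔ a.IsPos)) : g = 1 := by
  have hcoord : ∀ p, ζ.1 p + ζ.2 * (lat g (g.right p) : ℂ) = ζ.1 (g.right p) := by
    intro p
    have := congrFun (congrArg Prod.fst hg) (g.right p)
    simpa [actWt] using this
  -- `r p q` asks for a positive root ε_p - ε_q + kδ orthogonal to ζ. This is a strict partial
  -- order, irreflexive because ζ.2 ≠ 0, and `g.right` preserves it. Each p moved by `g.right` is
  -- comparable with its image, so following the orbit of p would give a cycle.
  let r : Fin N → Fin N → Prop := fun p q =>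
    ∃ k : ℤ, ζ.1 p - ζ.1 q + k * ζ.2 = 0 ∧ 0 < k * N + (q : ℕ) - (p : ℕ)
  have htrans : ∀ p q s, r p q → r q s → r p s := by
    rintro p q s ⟨k, h1, h2⟩ ⟨l, h3, h4⟩
    refine ⟨k + l, ?_, ?_⟩
    · push_cast; linear_combination h1 + h3
    · linarith
  have hirr : ∀ p, ¬ r p p := by
    rintro p ⟨k, h1, h2⟩
    have : (k : ℂ) * ζ.2 = 0 := by linear_combination h1
    rcases mul_eq_zero.1 this with h | h
    · rw [Int.cast_eq_zero.1 h] at h2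
      omega
    · exact hκ h
  have hpres : ∀ p q, r p q → r (g.right p) (g.right q) := by
    rintro p q ⟨k, h1, h2⟩
    have hpq : p ≠ q := fun h => hirr q ⟨k, by rwa [h] at h1, by rwa [h] at h2⟩
    have h3 := (hp ⟨p, q, hpq, k⟩ (by rw [pairing_eq]; exact h1)).2 ((isPos_iff _).2 h2)
    rw [isPos_iff] at h3
    refine ⟨_, ?_, h3⟩
    rw [smul_k]
    push_cast
    linear_combination h1 + hcoord q - hcoord p
  have hright : g.right = 1 := by
    by_contra hne
    obtain ⟨p, hp1⟩ : ∃ p, g.right p ≠ p := by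
      by_contra h
      push Not at h
      exact hne (Equiv.ext h)
    have hn := orderOf_pos g.right
    have hpow : (g.right ^ orderOf g.right) p = p := by rw [pow_orderOf_eq_one]; rfl
    obtain ⟨n, hn⟩ := Nat.exists_eq_succ_of_ne_zero hn.ne'
    rw [hn] at hpow
    -- As g fixes ζ, the coordinates of ζ at p and `g.right p` differ by this integer times ζ.2; the
    -- root is therefore orthogonal to ζ.
    let a : AffRoot N := ⟨p, g.right p, hp1.symm, lat g (g.right p)⟩
    have ha : pairing ζ a = 0 := by
      rw [pairing_eq]
      linear_combination hcoord p
    by_cases hpos : a.IsPos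
    · have h1 : r p (g.right p) := ⟨_, by rw [pairing_eq] at ha; exact ha, (isPos_iff a).1 hpos⟩
      have h2 : ∀ m : ℕ, r p ((g.right ^ (m + 1)) p) := by
        intro m
        induction m with
        | zero => simpa using h1
        | succ m ih =>
          rw [pow_succ', Equiv.Perm.mul_apply]
          exact htrans _ _ _ h1 (hpres _ _ ih)
      have := h2 n
      rw [Nat.succ_eq_add_one] at hpow
      rw [hpow] at this
      exact hirr p this
    · have hpos' := (isPos_neg_iff a).2 hpos
      have ha' : pairing ζ a.neg = 0 := by rw [pairing_neg, ha, neg_zero]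
      have h1 : r (g.right p) p :=
        ⟨_, by rw [pairing_eq] at ha'; exact ha', (isPos_iff a.neg).1 hpos'⟩
      have h2 : ∀ m : ℕ, r ((g.right ^ (m + 1)) p) p := by
        intro m
        induction m with
        | zero => simpa using h1
        | succ m ih =>
          rw [pow_succ', Equiv.Perm.mul_apply]
          exact htrans _ _ _ (hpres _ _ ih) h1
      have := h2 n
      rw [Nat.succ_eq_add_one] at hpow
      rw [hpow] at this
      exact hirr p this
  refine SemidirectProduct.ext ?_ hright
  apply Multiplicative.toAdd.injective
  funext m
  have := hcoord m
  rw [hright, Equiv.Perm.one_apply] at this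
  have h : ζ.2 * (lat g m : ℂ) = 0 := by linear_combination this
  rcases mul_eq_zero.1 h with h | h
  · exact absurd h hκ
  · exact Int.cast_eq_zero.1 h

theorem eq_of_actWt_eq {ζ : Wt N} (hκ : ζ.2 ≠ 0) {w w' : W N}
    (hw : ∀ a : AffRoot N, pairing ζ a = 0 → ((w • a).IsPos ↔ a.IsPos))
    (hw' : ∀ a : AffRoot N, pairing ζ a = 0 → ((w' • a).IsPos ↔ a.IsPos))
    (h : actWt w ζ = actWt w' ζ) : w = w' := by
  have hg : actWt (w⁻¹ * w') ζ = ζ := by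
    rw [actWt_mul, ← h, ← actWt_mul, inv_mul_cancel, actWt_one]
  have := eq_one_of_stabilizer hκ hg fun a ha => ?_
  · exact inv_mul_eq_one.1 this
  · have h1 : pairing ζ ((w⁻¹ * w') • a) = 0 := by
      rw [← ha, ← pairing_actWt (w⁻¹ * w') ζ a, hg]
    rw [← hw _ h1, ← mul_smul, mul_inv_cancel_left, hw' a ha]

variable {β : Composition N} {ζ : Wt N}

theorem pairing_ne_of_mem_S (hgen : IsGeneric β ζ) {w : W N} (hw : w ∈ WSup β) {a : AffRoot N}
    (ha : a ∈ S w) : pairing ζ a ≠ 1 ∧ pairing ζ a ≠ 0 ∧ pairing ζ a ≠ -1 := by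
  have := hgen a (Set.mem_iUnion₂.2 ⟨w, hw, ha⟩)
  simpa using this

/-- If w changes the sign of a root, then this root or its negative lies in S(w), where genericity
excludes the pairing 0. -/
theorem isPos_smul_iff_of_pairing_eq_zero (hgen : IsGeneric β ζ) {w : W N} (hw : w ∈ WSup β)
    (a : AffRoot N) (ha : pairing ζ a = 0) : (w • a).IsPos ↔ a.IsPos := by
  constructor
  · intro h
    by_contra h'
    refine (pairing_ne_of_mem_S hgen hw (a := a.neg) ⟨(isPos_neg_iff a).2 h', ?_⟩).2.1 ?_
    · rw [smul_neg_root, isPos_neg_iff, not_not]; exact h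
    · rw [pairing_neg, ha, neg_zero]
  · intro h
    by_contra h'
    exact (pairing_ne_of_mem_S hgen hw ⟨h, h'⟩).2.1 ha

/-- Genericity along an edge of `W^β`. -/
theorem pairing_ne_of_mem (hgen : IsGeneric β ζ) {w : W N} (hw : w ∈ WSup β) {α : AffRoot N}
    (hα : α.IsSimple) (hs : α.refl * w ∈ WSup β) :
    pairing (actWt w ζ) α ≠ 1 ∧ pairing (actWt w ζ) α ≠ 0 ∧ pairing (actWt w ζ) α ≠ -1 := by
  rw [pairing_actWt_eq]
  by_cases h : (w⁻¹ • α).IsPos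
  · refine pairing_ne_of_mem_S hgen hs ⟨h, ?_⟩
    rw [mul_smul, smul_inv_smul]
    exact simple_neg hα
  · have h1 := pairing_ne_of_mem_S hgen hw (a := (w⁻¹ • α).neg) ⟨(isPos_neg_iff _).2 h, by
      rw [smul_neg_root, smul_inv_smul, isPos_neg_iff, not_not]; exact IsSimple.isPos hα⟩
    rw [pairing_neg] at h1
    refine ⟨fun h2 => h1.2.2 (by rw [h2]), fun h2 => h1.2.1 (by rw [h2, neg_zero]),
      fun h2 => h1.1 (by rw [h2]; norm_num)⟩

theorem pairing_eq_neg_one (hζ : ζ ∈ tStar β) {w : W N} (hw : w ∈ WSup β) {α : AffRoot N}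
    (hα : α.IsSimple) (hs : α.refl * w ∉ WSup β) : pairing (actWt w ζ) α = -1 := by
  rw [pairing_actWt_eq]
  exact hζ _ (inv_smul_mem_PiBarOf hw hα hs)

theorem pairing_ne_zero (hζ : ζ ∈ tStar β) (hgen : IsGeneric β ζ) {w : W N} (hw : w ∈ WSup β)
    {α : AffRoot N} (hα : α.IsSimple) : pairing (actWt w ζ) α ≠ 0 := by
  by_cases hs : α.refl * w ∈ WSup β
  · exact (pairing_ne_of_mem hgen hw hα hs).2.1
  · rw [pairing_eq_neg_one hζ hw hα hs]; norm_num

theorem eq_of_actWt_eq_of_mem (hκ : ζ.2 ≠ 0) (hgen : IsGeneric β ζ) {w w' : W N}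
    (hw : w ∈ WSup β) (hw' : w' ∈ WSup β) (h : actWt w ζ = actWt w' ζ) : w = w' :=
  eq_of_actWt_eq hκ (isPos_smul_iff_of_pairing_eq_zero hgen hw)
    (isPos_smul_iff_of_pairing_eq_zero hgen hw') h

/-- Here s_α w may lie outside W^β; then its weight is not the weight of any element of W^β. The
sign criterion survives because s_α changes the sign of ±α only, and w⁻¹α is not orthogonal to ζ. -/
theorem eq_of_actWt_eq_refl_mul (hκ : ζ.2 ≠ 0) (hζ : ζ ∈ tStar β) (hgen : IsGeneric β ζ)
    {w w' : W N} (hw : w ∈ WSup β) (hw' : w' ∈ WSup β) {α : AffRoot N} (hα : α.IsSimple)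
    (h : actWt w' ζ = actWt (α.refl * w) ζ) : w' = α.refl * w := by
  by_cases hs : α.refl * w ∈ WSup β
  · exact eq_of_actWt_eq_of_mem hκ hgen hw' hs h
  · refine eq_of_actWt_eq hκ (isPos_smul_iff_of_pairing_eq_zero hgen hw') (fun a ha => ?_) h
    have h0 := pairing_ne_zero hζ hgen hw hα
    rw [pairing_actWt_eq] at h0
    rw [mul_smul, isPos_refl_smul_iff hα, isPos_smul_iff_of_pairing_eq_zero hgen hw a ha]
    · rintro h1
      rw [← h1, inv_smul_smul] at h0
      exact h0 ha
    · intro h1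
      have h2 : a = (w⁻¹ • α).neg := by rw [← smul_neg_root, ← h1, inv_smul_smul]
      rw [h2, pairing_neg, neg_eq_zero] at ha
      exact h0 ha

/-- Left factors of simple reflections can be removed inside `W^β`. -/
theorem mem_WSup_of_refl_mul {w : W N} {α : AffRoot N} (hα : α.IsSimple)
    (hs : α.refl * w ∈ WSup β) (hl : len (α.refl * w) = len w + 1) : w ∈ WSup β := by
  by_contra hw
  have e : α.refl * (α.refl * w) = w := by rw [← mul_assoc, refl_mul_refl, one_mul]
  -- Otherwise (s_α w)⁻¹α is a positive root, so that another s_α lengthens s_α w, although it gives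
  -- back the shorter element w.
  have h1 := inv_smul_mem_PiBarOf hs hα (by rwa [e])
  have h2 := isPos_smul_of_mem_WSup (one_mem_WSup β) (PiBarOf_subset_RBarPosOf β h1)
  rw [one_smul] at h2
  have h3 := len_refl_mul_of_isPos hα h2
  rw [e] at h3
  omega

end Combinatorics

/-! ### Sorted representatives of W̄ \ W / W̄_β. -/

section Sorting

variable {N : ℕ}

/-- The lattice part of `w` in the coordinates of the source; it depends only on `W̄ w`, and
determines this coset. -/
def latSrc (w : W N) (m : Fin N) : ℤ := lat w (w.right m)

theorem latSrc_fin_mul (u : Equiv.Perm (Fin N)) (w : W N) : latSrc (fin u * w) = latSrc w := by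
  funext m
  show lat (fin u * w) (u (w.right m)) = _
  rw [lat_mul]
  show 0 + lat w (u⁻¹ (u (w.right m))) = _
  rw [zero_add, perm_inv_apply]
  rfl

theorem eq_of_latSrc_eq {w v : W N} (h : latSrc w = latSrc v) (hr : w.right = v.right) : w = v := by
  refine SemidirectProduct.ext ?_ hr
  apply Multiplicative.toAdd.injective
  funext m
  have := congrFun h (w.right⁻¹ m)
  simp only [latSrc, ← hr, ← Equiv.Perm.mul_apply, mul_inv_cancel, Equiv.Perm.one_apply] at this
  exact this

/-- `ht` is N times the lattice part plus a position between 0 and N - 1, so it compares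
lexicographically. -/
theorem ht_lt_ht_iff (w : W N) (m n : Fin N) :
    ht w m < ht w n ↔ latSrc w m < latSrc w n ∨
      (latSrc w m = latSrc w n ∧ w.right m < w.right n) := by
  have h1 := (w.right m).2
  have h2 := (w.right n).2
  unfold ht latSrc
  rw [Fin.lt_def]
  generalize lat w (w.right m) = a
  generalize lat w (w.right n) = b
  rcases lt_trichotomy a b with h | h | h
  · have : (N : ℤ) * (a + 1) ≤ N * b := by gcongr; omega
    rw [mul_add] at this
    constructor <;> intro h' <;> omega
  · rw [h]; omega
  · have : (N : ℤ) * (b + 1) ≤ N * a := by gcongr; omega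
    rw [mul_add] at this
    constructor <;> intro h' <;> omega

/-- The order on indices with respect to which the elements of `X^β` are sorted: first by
the lattice part, then by blocks in decreasing order, then by indices. -/
def sortKey (β : Composition N) (h : Fin N → ℤ) (m : Fin N) :
    ℤ ×ₗ (Fin β.length)ᵒᵈ ×ₗ Fin N :=
  toLex (h m, toLex (OrderDual.toDual (β.index m), m))

theorem sortKey_lt_iff (β : Composition N) (h : Fin N → ℤ) (m n : Fin N) :
    sortKey β h m < sortKey β h n ↔ h m < h n ∨ (h m = h n ∧
      (β.index n < β.index m ∨ (β.index m = β.index n ∧ m < n))) := by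
  simp only [sortKey, Prod.Lex.toLex_lt_toLex, OrderDual.toDual_lt_toDual,
    OrderDual.toDual_inj]

theorem sortKey_injective (β : Composition N) (h : Fin N → ℤ) :
    Function.Injective (sortKey β h) := by
  intro m n e
  simp only [sortKey, EmbeddingLike.apply_eq_iff_eq, Prod.mk.injEq] at e
  exact e.2.2

/-- `w` sorts the indices with respect to `sortKey`. -/
def Sorted (β : Composition N) (w : W N) : Prop :=
  ∀ i j : Fin N, (i : ℕ) + 1 = j →
    sortKey β (latSrc w) (w.right⁻¹ i) < sortKey β (latSrc w) (w.right⁻¹ j)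

theorem Sorted.strictMono {β : Composition N} {w : W N} (h : Sorted β w) :
    StrictMono fun i => sortKey β (latSrc w) (w.right⁻¹ i) := fun _ _ hij =>
  strictMono_of_adjacent (f := fun i => sortKey β (latSrc w) (w.right⁻¹ i)) hij
    fun a b _ _ hab => h a b hab

theorem Sorted.lt_iff {β : Composition N} {w : W N} (h : Sorted β w) (m n : Fin N) :
    w.right m < w.right n ↔ sortKey β (latSrc w) m < sortKey β (latSrc w) n := by
  have := h.strictMono.lt_iff_lt (a := w.right m) (b := w.right n)
  simpa only [perm_inv_apply] using this.symm

/-- `latSrc` determines the total order on indices, and a finite totally ordered set has only one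
increasing enumeration. -/
theorem Sorted.eq {β : Composition N} {w v : W N} (hw : Sorted β w) (hv : Sorted β v)
    (h : latSrc w = latSrc v) : w = v := by
  refine eq_of_latSrc_eq h ?_
  have h1 := hw.strictMono
  have h2 := hv.strictMono
  rw [← h] at h2
  have hr : ∀ σ : Equiv.Perm (Fin N), Set.range (fun i => sortKey β (latSrc w) (σ i)) =
      Set.range (sortKey β (latSrc w)) := fun σ =>
    σ.surjective.range_comp (sortKey β (latSrc w))
  have h3 := (h1.range_inj h2).1 ((hr _).trans (hr _).symm)
  have h4 : w.right⁻¹ = v.right⁻¹ := Equiv.ext fun i => sortKey_injective β _ (congrFun h3 i)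
  exact inv_injective h4

theorem lat_eq_latSrc (w : W N) (i : Fin N) : lat w i = latSrc w (w.right⁻¹ i) := by
  rw [latSrc, ← Equiv.Perm.mul_apply, mul_inv_cancel, Equiv.Perm.one_apply]

theorem refl_mul_right {α : AffRoot N} (w : W N) :
    (α.refl * w).right = Equiv.swap α.i α.j * w.right := by
  rw [SemidirectProduct.mul_right, right_refl]

theorem latSrc_refl_mul {α : AffRoot N} (hα : α ∈ PiBar N) (w : W N) :
    latSrc (α.refl * w) = latSrc w := by
  rw [refl_of_mem hα, latSrc_fin_mul]

/-- A move along a finite simple reflection inside `W^β`. -/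
def Step (β : Composition N) (w v : W N) : Prop :=
  w ∈ WSup β ∧ v ∈ WSup β ∧ ∃ α ∈ PiBar N, v = α.refl * w

theorem inv_smul_right_i (w : W N) (α : AffRoot N) : (w⁻¹ • α).i = w.right⁻¹ α.i := rfl

theorem inv_smul_right_j (w : W N) (α : AffRoot N) : (w⁻¹ • α).j = w.right⁻¹ α.j := rfl

theorem inv_smul_k (w : W N) (α : AffRoot N) : (w⁻¹ • α).k = α.k + lat w α.i - lat w α.j := by
  have h := smul_k w (w⁻¹ • α)
  rw [smul_inv_smul, inv_smul_right_i, inv_smul_right_j] at h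
  simp only [← Equiv.Perm.mul_apply, mul_inv_cancel, Equiv.Perm.one_apply] at h
  linarith

/-- A move that leaves W^β exchanges two consecutive indices of one block with equal lattice part,
in increasing order; `sortKey` counts such a pair as sorted. Hence any adjacent pair in the wrong
order can be exchanged without leaving W^β. -/
theorem refl_mul_mem_WSup_of_not_lt {β : Composition N} {w : W N} (hw : w ∈ WSup β)
    {α : AffRoot N} (hα : α ∈ PiBar N)
    (h : ¬ sortKey β (latSrc w) (w.right⁻¹ α.i) < sortKey β (latSrc w) (w.right⁻¹ α.j)) :
    α.refl * w ∈ WSup β := by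
  by_contra hs
  have h1 := PiBarOf_subset_RBarPosOf _ (inv_smul_mem_PiBarOf hw (isSimple_of_mem hα) hs)
  apply h
  rw [sortKey_lt_iff, ← lat_eq_latSrc, ← lat_eq_latSrc]
  right
  have h2 := h1.1.1
  rw [inv_smul_k, hα.1] at h2
  exact ⟨by omega, Or.inr ⟨h1.2, h1.1.2⟩⟩

/-- A rearrangement inequality, by which the potential in `exists_sorted` grows. -/
theorem sum_swap_lt (r : Fin N → ℕ) {i j : Fin N} (hij : (i : ℕ) < j) (h : r j < r i) :
    ∑ k : Fin N, (k : ℕ) * r k < ∑ k : Fin N, (k : ℕ) * r (Equiv.swap i j k) := by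
  have hne : i ≠ j := fun e => by rw [e] at hij; omega
  have hji : j ∈ Finset.univ.erase i := by simp [hne.symm]
  have split : ∀ f : Fin N → ℕ, ∑ k, f k = ∑ k ∈ (Finset.univ.erase i).erase j, f k + f j + f i :=
    fun f => by
      rw [Finset.sum_erase_add _ _ hji, Finset.sum_erase_add _ _ (Finset.mem_univ i)]
  rw [split, split fun k : Fin N => (k : ℕ) * r (Equiv.swap i j k)]
  have e : ∑ k ∈ (Finset.univ.erase i).erase j, (k : ℕ) * r (Equiv.swap i j k) =
      ∑ k ∈ (Finset.univ.erase i).erase j, (k : ℕ) * r k := by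
    refine Finset.sum_congr rfl fun k hk => ?_
    simp only [Finset.mem_erase, Finset.mem_univ, and_true] at hk
    rw [Equiv.swap_apply_of_ne_of_ne hk.2 hk.1]
  rw [e, Equiv.swap_apply_left, Equiv.swap_apply_right]
  have h1 : (j : ℕ) * r j + i * r i < j * r i + i * r j := by nlinarith
  omega

/-- Every element of `W^β` is connected to a sorted one of the same coset `W̄ w`. -/
theorem exists_sorted {β : Composition N} {w : W N} (hw : w ∈ WSup β) :
    ∃ x ∈ WSup β, Sorted β x ∧ latSrc x = latSrc w ∧ Relation.ReflTransGen (Step β) w x := by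
  let r : (Fin N → ℤ) → Fin N → ℕ := fun h m =>
    (Finset.univ.filter fun n => sortKey β h n < sortKey β h m).card
  have hr : ∀ h m n, sortKey β h m < sortKey β h n → r h m < r h n := by
    intro h m n hmn
    refine Finset.card_lt_card ((Finset.ssubset_iff_of_subset ?_).2 ⟨m, ?_, ?_⟩)
    · intro p hp
      simp only [Finset.mem_filter, Finset.mem_univ, true_and] at hp ⊢
      exact hp.trans hmn
    · simpa using hmn
    · simp
  -- A finite move keeps `latSrc`, hence the ranks `r`. Exchanging two neighbours in the wrong order
  -- increases this sum, which is bounded, so bubble sort terminates.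
  let f : W N → ℕ := fun w => ∑ k : Fin N, (k : ℕ) * r (latSrc w) (w.right⁻¹ k)
  have hf : ∀ w, f w ≤ ∑ _k : Fin N, N * N := fun w =>
    Finset.sum_le_sum fun k _ => Nat.mul_le_mul k.2.le
      ((Finset.card_le_univ _).trans (Fintype.card_fin N).le)
  induction hn : (∑ _k : Fin N, N * N) - f w using Nat.strong_induction_on generalizing w with
  | _ n ih =>
    by_cases hs : Sorted β w
    · exact ⟨w, hw, hs, rfl, .refl⟩
    · unfold Sorted at hs
      push Not at hs
      obtain ⟨i, j, hij, hs⟩ := hs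
      have hne : i ≠ j := fun e => by rw [e] at hij; omega
      let α : AffRoot N := ⟨i, j, hne, 0⟩
      have hα : α ∈ PiBar N := ⟨rfl, hij⟩
      have hmem := refl_mul_mem_WSup_of_not_lt hw hα (not_lt.2 hs)
      have hlt : f w < f (α.refl * w) := by
        have h1 : sortKey β (latSrc w) (w.right⁻¹ j) < sortKey β (latSrc w) (w.right⁻¹ i) :=
          hs.lt_of_ne fun e => hne (w.right⁻¹.injective (sortKey_injective β _ e)).symm
        have h2 := sum_swap_lt (fun k => r (latSrc w) (w.right⁻¹ k)) (i := i) (j := j)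
          (by omega) (hr _ _ _ h1)
        refine h2.trans_eq (Finset.sum_congr rfl fun k _ => ?_)
        rw [latSrc_refl_mul hα, refl_mul_right, mul_inv_rev, Equiv.swap_inv]
        rfl
      have h3 := hf (α.refl * w)
      obtain ⟨x, hx, h4, h5, h6⟩ := ih _ (by omega) hmem rfl
      exact ⟨x, hx, h4, by rw [h5, latSrc_refl_mul hα], .head ⟨hw, hmem, α, hα, rfl⟩ h6⟩

variable {β : Composition N}

theorem right_tr_mul_fin (η : Fin N → ℤ) (σ : Equiv.Perm (Fin N)) : (tr η * fin σ).right = σ := by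
  simp [tr, fin]

theorem lat_tr_mul_fin (η : Fin N → ℤ) (σ : Equiv.Perm (Fin N)) : lat (tr η * fin σ) = η := by
  simp [tr, fin, lat]

theorem fin_mem_WSup_iff {σ : Equiv.Perm (Fin N)} :
    fin σ ∈ WSup β ↔ ∀ m n, m < n → β.index m = β.index n → σ m < σ n := by
  rw [mem_WSup_iff]
  have e : ∀ m, ht (fin σ) m = (σ m : ℕ) + N * 0 := fun m => rfl
  simp only [BlockIncr, e, mul_zero, add_zero, Nat.cast_lt, Fin.lt_def]

theorem mem_image_fin_iff {σ : Equiv.Perm (Fin N)} {α : AffRoot N} (hα : α.k = 0)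
    (P : Set (AffRoot N)) : α ∈ (fun γ => fin σ • γ) '' P ↔
      (⟨σ⁻¹ α.i, σ⁻¹ α.j, fun h => α.ne (σ⁻¹.injective h), 0⟩ : AffRoot N) ∈ P := by
  have e : (fin σ)⁻¹ • α = ⟨σ⁻¹ α.i, σ⁻¹ α.j, fun h => α.ne (σ⁻¹.injective h), 0⟩ := by
    refine AffRoot.ext rfl rfl ?_
    rw [inv_smul_k, hα]
    rfl
  rw [← e]
  constructor
  · rintro ⟨γ, hγ, rfl⟩
    simpa only [inv_smul_smul] using hγ
  · intro h
    exact ⟨_, h, smul_inv_smul _ _⟩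

/-- The vector η_w makes the lattice part jump exactly where w⁻¹ passes from one block to a later
one, that is, where equal lattice parts would break the decreasing order of blocks. At the other
positions w⁻¹ either increases inside a block, or decreases, and then passes to an earlier block
because w is increasing on blocks. Conversely the lattice part of a sorted element increases
strictly at each required jump, so subtracting η_w leaves an element of P̄_-. -/
theorem mem_X_iff [NeZero N] {x : W N} : x ∈ X β ↔ x ∈ WSup β ∧ Sorted β x := by
  constructor
  · rintro ⟨σ, hσ, μ, ⟨η, hη, e, ⟨-, -, he⟩, rfl⟩, rfl⟩
    have hσ' := fin_mem_WSup_iff.1 hσ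
    have hsort : Sorted β (tr (η + e) * fin σ) := by
      intro i j hij
      have hne : i ≠ j := fun e => by rw [e] at hij; omega
      have hlt : i < j := by rw [Fin.lt_def]; omega
      have h1 := hη ⟨i, j, hne, 0⟩ ⟨rfl, hlt⟩
      have h2 := he ⟨i, j, hne, 0⟩ ⟨rfl, hij⟩
      rw [mem_image_fin_iff rfl] at h2
      simp only [RBarPosOf, RBarPos, SameBlock, Set.mem_sdiff, Set.mem_inter_iff,
        Set.mem_ofPred_eq, true_and] at h1 h2
      rw [sortKey_lt_iff, ← lat_eq_latSrc, ← lat_eq_latSrc, right_tr_mul_fin, lat_tr_mul_fin]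
      simp only [Pi.add_apply]
      by_cases h3 : σ⁻¹ i < σ⁻¹ j
      · by_cases h4 : β.index (σ⁻¹ i) = β.index (σ⁻¹ j)
        · have := h2.2 (by tauto)
          by_cases h5 : η i = η j
          · right; exact ⟨by omega, Or.inr ⟨h4, h3⟩⟩
          · left; omega
        · have := h2.1 (by tauto)
          left; omega
      · have h6 := h2.2 (by tauto)
        by_cases h5 : η i = η j
        · right
          refine ⟨by omega, Or.inl ?_⟩
          have h7 : σ⁻¹ j < σ⁻¹ i :=
            (not_lt.1 h3).lt_of_ne fun e => hne (σ⁻¹.injective e).symm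
          refine (index_mono β h7.le).lt_of_ne fun h8 => ?_
          have := hσ' _ _ h7 h8
          simp only [← Equiv.Perm.mul_apply, mul_inv_cancel, Equiv.Perm.one_apply] at this
          exact absurd hlt this.not_gt
        · left; omega
    refine ⟨mem_WSup_iff.2 fun m n hmn hb => ?_, hsort⟩
    rw [ht_lt_ht_iff]
    have h1 : (tr (η + e) * fin σ).right m < (tr (η + e) * fin σ).right n := by
      rw [right_tr_mul_fin]
      exact hσ' m n hmn hb
    have h2 := (sortKey_lt_iff _ _ _ _).1 ((hsort.lt_iff m n).1 h1)
    rcases h2 with h2 | h2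
    · exact Or.inl h2
    · exact Or.inr ⟨h2.1, h1⟩
  · rintro ⟨hx, hs⟩
    classical
    let σ := x.right
    have hmem : ∀ m n, m < n → β.index m = β.index n → latSrc x m ≤ latSrc x n ∧ σ m < σ n := by
      intro m n hmn hb
      have h1 := (ht_lt_ht_iff x m n).1 (mem_WSup_iff.1 hx m n hmn hb)
      refine ⟨by omega, ?_⟩
      rcases h1 with h1 | h1
      · rw [hs.lt_iff, sortKey_lt_iff]; exact Or.inl h1
      · exact h1.2
    let A : Set (AffRoot N) := (fun γ => fin σ • γ) '' (RBarPos N \ RBarPosOf β)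
    -- η_w at i is the number of required jumps up to i. A jump is recorded at the second index of
    -- its simple root, which is never 0, whence `e 0 = 0`.
    let e : Fin N → ℤ := fun i => ((Finset.univ.filter fun j : Fin N =>
      j ≤ i ∧ ∃ α ∈ A, α ∈ PiBar N ∧ α.j = j).card : ℤ)
    have he : ∀ α ∈ PiBar N, (α ∈ A → e α.i - e α.j = -1) ∧ (α ∉ A → e α.i - e α.j = 0) := by
      intro α hα
      have hlt := hα.2
      have hexists : (∃ γ ∈ A, γ ∈ PiBar N ∧ γ.j = α.j) ↔ α ∈ A := by
        constructor
        · rintro ⟨γ, h1, h2, h3⟩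
          have : γ = α := by
            refine AffRoot.ext (Fin.ext ?_) h3 (h2.1.trans hα.1.symm)
            have := h2.2
            rw [h3] at this
            omega
          exact this ▸ h1
        · intro h
          exact ⟨α, h, hα, rfl⟩
      constructor
      · intro h
        have : (Finset.univ.filter fun j : Fin N =>
            j ≤ α.j ∧ ∃ γ ∈ A, γ ∈ PiBar N ∧ γ.j = j) =
            insert α.j (Finset.univ.filter fun j : Fin N =>
              j ≤ α.i ∧ ∃ γ ∈ A, γ ∈ PiBar N ∧ γ.j = j) := by
          ext j
          simp only [Finset.mem_filter, Finset.mem_univ, true_and, Finset.mem_insert]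
          by_cases hj : j = α.j
          · subst hj
            simp [hexists.2 h]
          · have hj' : (j : ℕ) ≠ α.j := fun e => hj (Fin.ext e)
            have : j ≤ α.j ↔ j ≤ α.i := by rw [Fin.le_def, Fin.le_def]; omega
            rw [this]
            tauto
        simp only [e]
        rw [this, Finset.card_insert_of_notMem]
        · push_cast; ring
        · simp only [Finset.mem_filter, not_and, Finset.mem_univ, true_and, Fin.le_def]
          omega
      · intro h
        have : (Finset.univ.filter fun j : Fin N =>
            j ≤ α.j ∧ ∃ γ ∈ A, γ ∈ PiBar N ∧ γ.j = j) =
            (Finset.univ.filter fun j : Fin N =>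
              j ≤ α.i ∧ ∃ γ ∈ A, γ ∈ PiBar N ∧ γ.j = j) := by
          ext j
          simp only [Finset.mem_filter, Finset.mem_univ, true_and]
          by_cases hj : j = α.j
          · subst hj
            rw [hexists]
            simp [h]
          · have hj' : (j : ℕ) ≠ α.j := fun e => hj (Fin.ext e)
            have : j ≤ α.j ↔ j ≤ α.i := by rw [Fin.le_def, Fin.le_def]; omega
            rw [this]
        simp only [e]
        rw [this, sub_self]
    have mono : ∀ f : Fin N → ℤ, (∀ α ∈ PiBar N, f α.i - f α.j ≤ 0) → f ∈ PMinus N := by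
      intro f hf α hα
      -- The index as second lexicographic coordinate turns weak monotonicity into the strict form.
      have := strictMono_of_adjacent (f := fun i => toLex (f i, i)) hα.2 fun a b _ _ hab => by
        have hne : a ≠ b := fun e => by rw [e] at hab; omega
        have := hf ⟨a, b, hne, 0⟩ ⟨rfl, hab⟩
        rw [Prod.Lex.toLex_lt_toLex, Fin.lt_def]
        simp only [] at this ⊢
        omega
      rw [Prod.Lex.toLex_lt_toLex] at this
      simp only [] at this
      omega
    refine ⟨σ, fin_mem_WSup_iff.2 fun m n h1 h2 => (hmem m n h1 h2).2, lat x,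
      ⟨lat x - e, ?_, e, ⟨?_, ?_, he⟩, by rw [sub_add_cancel]⟩, eq_tr_mul_fin x⟩
    · refine mono _ fun α hα => ?_
      have h1 := (sortKey_lt_iff _ _ _ _).1 (hs α.i α.j hα.2)
      rw [← lat_eq_latSrc, ← lat_eq_latSrc] at h1
      simp only [Pi.sub_apply]
      by_cases hA : α ∈ A
      · have h2 := (he α hα).1 hA
        have h3 := (mem_image_fin_iff hα.1 _).1 hA
        have h4 : σ⁻¹ α.i < σ⁻¹ α.j := h3.1.2
        have h5 : β.index (σ⁻¹ α.i) ≠ β.index (σ⁻¹ α.j) := fun h => h3.2 ⟨h3.1, h⟩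
        have h6 := index_mono β h4.le
        have h7 : lat x α.i < lat x α.j := by
          rcases h1 with h1 | ⟨-, h1 | h1⟩
          · exact h1
          · exact absurd h6 h1.not_ge
          · exact absurd h1.1 h5
        omega
      · have h2 := (he α hα).2 hA
        omega
    · refine mono _ fun α hα => ?_
      by_cases hA : α ∈ A
      · rw [(he α hα).1 hA]; norm_num
      · rw [(he α hα).2 hA]
    · simp only [e, Nat.cast_eq_zero, Finset.card_eq_zero, Finset.filter_eq_empty_iff,
        Finset.mem_univ, true_implies]
      rintro j ⟨hj, α, -, hα, rfl⟩
      have h1 := hα.2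
      rw [Fin.le_def, Fin.val_zero] at hj
      omega

/-- The translates of `x ∈ X^β` by the minimal representatives of `W̄ / W̄_{β(x)}` lie in `W^β`. -/
theorem fin_mul_mem_WSup [NeZero N] {x : W N} (hx : x ∈ X β) {u : Equiv.Perm (Fin N)}
    (hu : fin u ∈ WSup (betaOf β x)) : fin u * x ∈ WSup β := by
  obtain ⟨hx, hs⟩ := mem_X_iff.1 hx
  rw [fin_mem_WSup_iff] at hu
  rw [mem_WSup_iff]
  intro m n hmn hb
  rw [ht_lt_ht_iff, latSrc_fin_mul]
  have h1 := (ht_lt_ht_iff x m n).1 (mem_WSup_iff.1 hx m n hmn hb)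
  rcases h1 with h1 | ⟨h1, h2⟩
  · exact Or.inl h1
  refine Or.inr ⟨h1, ?_⟩
  show u (x.right m) < u (x.right n)
  -- m and n share lattice part and block. As x is sorted, so do the sources of all positions
  -- between `x.right m` and `x.right n`; hence each neighbouring pair there is a root of Π̄_{β(x)},
  -- on which u increases.
  refine strictMono_of_adjacent (f := u) h2 fun a b ha hb' hab => ?_
  have hab' : a < b := by rw [Fin.lt_def]; omega
  refine hu a b hab' ?_
  have hne := hab'.ne
  suffices h : (⟨a, b, hne, 0⟩ : AffRoot N) ∈ PiBarOf (betaOf β x) from h.2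
  rw [PiBarOf_betaOf]
  refine ⟨⟨rfl, hab⟩, x⁻¹ • ⟨a, b, hne, 0⟩, ?_, smul_inv_smul _ _⟩
  have k1 := hs.strictMono.monotone ha
  have k2 := hs.strictMono hab'
  have k3 := hs.strictMono.monotone hb'
  simp only [perm_inv_apply] at k1 k2 k3
  have lat_le : ∀ p q, sortKey β (latSrc x) p ≤ sortKey β (latSrc x) q →
      latSrc x p ≤ latSrc x q := by
    intro p q hpq
    rcases hpq.lt_or_eq with h | h
    · rw [sortKey_lt_iff] at h; omega
    · rw [sortKey_injective β _ h]
  have l1 := lat_le _ _ k1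
  have l2 := lat_le _ _ k2.le
  have l3 := lat_le _ _ k3
  have index_le : ∀ p q, latSrc x p = latSrc x q →
      sortKey β (latSrc x) p ≤ sortKey β (latSrc x) q → β.index q ≤ β.index p := by
    intro p q hl hpq
    rcases hpq.lt_or_eq with h | h
    · rw [sortKey_lt_iff] at h
      rcases h with h | ⟨-, h | h⟩
      · omega
      · exact h.le
      · exact h.1.ge
    · rw [sortKey_injective β _ h]
  have i1 := index_le _ _ (by omega) k1
  have i2 := index_le _ _ (by omega) k2.le
  have i3 := index_le _ _ (by omega) k3
  have hbl : β.index (x.right⁻¹ a) = β.index (x.right⁻¹ b) :=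
    le_antisymm (i1.trans (hb.le.trans i3)) i2
  have hk : latSrc x (x.right⁻¹ a) = latSrc x (x.right⁻¹ b) := by omega
  refine ⟨⟨?_, ?_⟩, hbl⟩
  · rw [inv_smul_k, lat_eq_latSrc, lat_eq_latSrc x b, hk]; ring
  · rw [sortKey_lt_iff] at k2
    rcases k2 with h | ⟨-, h | h⟩
    · omega
    · exact absurd hbl.symm h.ne
    · exact h.2

/-- The simple reflections of `W̄_{β(x)}` move `x` out of `W^β`. -/
theorem refl_mul_notMem_WSup {x : W N} {α : AffRoot N}
    (hα : α ∈ PiBarOf (betaOf β x)) : α.refl * x ∉ WSup β := by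
  rw [PiBarOf_betaOf] at hα
  obtain ⟨hα, γ, hγ, hγα⟩ := hα
  intro h
  have h1 := isPos_smul_of_mem_WSup h hγ
  have h2 : x • γ = α := hγα
  rw [mul_smul, h2] at h1
  exact simple_neg (isSimple_of_mem hα) h1

end Sorting

/-! ### Commutation relations in 𝓗. -/

section Relations

variable {N : ℕ} [NeZero N]

theorem H.ofW_mul_ofT {α : AffRoot N} (hα : α.IsSimple) (ξ : T N) :
    H.ofW α.refl * H.ofT ξ - H.ofT (actT α.refl ξ) * H.ofW α.refl =
      algebraMap ℂ (H N) (-α.eval ξ) := by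
  have := H.mk_rel (Rel.simple α hα ξ)
  rw [map_sub, map_mul, map_mul, AlgHom.commutes] at this
  exact this

theorem H.ofT_mul_ofW {α : AffRoot N} (hα : α.IsSimple) (ξ : T N) :
    H.ofT ξ * H.ofW α.refl =
      H.ofW α.refl * H.ofT (actT α.refl ξ) - algebraMap ℂ (H N) (α.eval ξ) := by
  have h := H.ofW_mul_ofT hα (actT α.refl ξ)
  rw [← actT_mul, refl_mul_refl, map_one, Module.End.one_apply, refl_smul_self_eq,
    _root_.neg_neg] at h
  rw [← h]
  abel

theorem H.ofW_pi_mul_ofT (ξ : T N) :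
    H.ofW piElt * H.ofT ξ = H.ofT (actT piElt ξ) * H.ofW (piElt : W N) := by
  have := H.mk_rel (Rel.pi ξ)
  rw [map_mul, map_mul] at this
  exact this

theorem H.ofT_mul_ofW_pi (ξ : T N) :
    H.ofT ξ * H.ofW piElt = H.ofW piElt * H.ofT (actT (piElt : W N)⁻¹ ξ) := by
  rw [H.ofW_pi_mul_ofT, actT_apply_inv]

theorem H.ofT_mul_ofW_pi_inv (ξ : T N) :
    H.ofT ξ * H.ofW piElt⁻¹ = H.ofW piElt⁻¹ * H.ofT (actT (piElt : W N) ξ) := by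
  have h := H.ofW_pi_mul_ofT ξ
  have e : H.ofW (piElt : W N)⁻¹ * H.ofW (piElt : W N) = 1 := by
    rw [← map_mul, inv_mul_cancel, map_one]
  have e' : H.ofW (piElt : W N) * H.ofW (piElt : W N)⁻¹ = 1 := by
    rw [← map_mul, mul_inv_cancel, map_one]
  calc H.ofT ξ * H.ofW piElt⁻¹
      = H.ofW piElt⁻¹ * (H.ofW piElt * H.ofT ξ) * H.ofW piElt⁻¹ := by
        rw [← mul_assoc, e, one_mul]
    _ = _ := by rw [h, mul_assoc, mul_assoc, e', mul_one]

theorem H.ofW_refl_mul_self (α : AffRoot N) : H.ofW α.refl * H.ofW α.refl = 1 := by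
  rw [← map_mul, refl_mul_refl, map_one]

theorem H.ofT_comm (ξ ξ' : T N) : H.ofT ξ * H.ofT ξ' = H.ofT ξ' * H.ofT ξ := by
  have := H.mk_rel (Rel.comm ξ ξ')
  rw [map_mul, map_mul] at this
  exact this

/-- Moving ξ past s_α leaves the scalar -α(ξ); times α^∨ it turns the summand ξ into s_α(ξ) = ξ -
α(ξ) α^∨. -/
theorem H.ofT_mul_phiSimple {α : AffRoot N} (hα : α.IsSimple) (ξ : T N) :
    H.ofT ξ * phiSimple α = phiSimple α * H.ofT (actT α.refl ξ) := by
  have e : H.ofT (actT α.refl ξ) = H.ofT ξ - algebraMap ℂ (H N) (α.eval ξ) * H.ofT α.coroot := by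
    rw [actT_refl, map_sub, map_smul, Algebra.smul_def]
  have e' : H.ofT ξ = H.ofT (actT α.refl ξ) + algebraMap ℂ (H N) (α.eval ξ) * H.ofT α.coroot := by
    rw [e, sub_add_cancel]
  rw [phiSimple, mul_add, mul_one, ← mul_assoc, H.ofT_mul_ofW hα, sub_mul, add_mul, one_mul,
    mul_assoc, H.ofT_comm, ← mul_assoc]
  nth_rewrite 1 [e']
  abel

theorem H.adjoin_eq_top :
    Algebra.adjoin ℂ (Set.range (H.ofW : W N → H N) ∪ Set.range (H.ofT : T N → H N)) = ⊤ := by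
  rw [eq_top_iff]
  have h1 : (H.mk (N := N)).range = ⊤ := by
    rw [AlgHom.range_eq_top]
    exact RingQuot.mkAlgHom_surjective ℂ (Rel N)
  rw [← h1, ← Algebra.map_top, ← FreeAlgebra.adjoin_range_ι, AlgHom.map_adjoin]
  refine Algebra.adjoin_mono ?_
  rintro _ ⟨_, ⟨w | ξ, rfl⟩, rfl⟩
  · exact Or.inl ⟨w, rfl⟩
  · exact Or.inr ⟨ξ, rfl⟩

end Relations

/-! ### Separation of joint eigenvectors. -/

section Separation

/-- A subspace that contains a sum of joint eigenvectors with distinct eigenvalues, and is stable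
under the operators, contains all the summands. -/
theorem mem_of_sum_mem {M Ξ ι : Type*} [AddCommGroup M] [Module ℂ M] (D : Ξ → M →ₗ[ℂ] M)
    (U : Submodule ℂ M) (hU : ∀ ξ, ∀ y ∈ U, D ξ y ∈ U) (χ : ι → Ξ → ℂ) (s : Finset ι)
    (hχ : Set.InjOn χ s) (y : ι → M) (hy : ∀ i ∈ s, ∀ ξ, D ξ (y i) = χ i ξ • y i)
    (hsum : ∑ i ∈ s, y i ∈ U) : ∀ i ∈ s, y i ∈ U := by
  classical
  induction s using Finset.induction_on generalizing y with
  | empty => simp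
  | insert a s ha ih =>
    rw [Finset.sum_insert ha] at hsum
    have h1 : ∀ i ∈ s, y i ∈ U := by
      intro i hi
      have hne : χ i ≠ χ a := fun h => ha
        (hχ (Finset.mem_coe.2 (Finset.mem_insert_of_mem hi))
          (Finset.mem_coe.2 (Finset.mem_insert_self a s)) h ▸ hi)
      obtain ⟨ξ, hξ⟩ := Function.ne_iff.1 hne
      -- The operator D ξ - χ a ξ kills y a and scales every other summand, y i by a nonzero factor.
      have h2 := ih (hχ.mono (by simp)) (fun j => (χ j ξ - χ a ξ) • y j)
        (fun j hj ξ' => by rw [map_smul, hy j (Finset.mem_insert_of_mem hj), smul_comm]) (by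
          have h3 := U.sub_mem (hU ξ _ hsum) (U.smul_mem (χ a ξ) hsum)
          rw [map_add, map_sum, hy a (Finset.mem_insert_self a s), smul_add,
            add_sub_add_left_eq_sub, Finset.smul_sum, ← Finset.sum_sub_distrib] at h3
          have h4 : ∑ j ∈ s, (χ j ξ - χ a ξ) • y j = ∑ j ∈ s, (D ξ (y j) - χ a ξ • y j) :=
            Finset.sum_congr rfl fun j hj => by
              rw [hy j (Finset.mem_insert_of_mem hj), sub_smul]
          rwa [h4]) i hi
      exact (U.smul_mem_iff (sub_ne_zero.2 hξ)).1 h2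
    intro i hi
    rcases Finset.mem_insert.1 hi with rfl | hi
    · have := U.sub_mem hsum (U.sum_mem h1)
      rwa [add_sub_cancel_right] at this
    · exact h1 i hi

end Separation

/-! ### The basis φ_w v of a cyclic module. -/

section WeightVectors

variable {N : ℕ} [NeZero N] {M : Type*} [AddCommGroup M] [Module (H N) M] [Module ℂ M]
  [IsScalarTower ℂ (H N) M]

theorem mem_of_generators {V : Submodule ℂ M}
    (hW : ∀ (w : W N), ∀ y ∈ V, H.ofW w • y ∈ V) (hT : ∀ (ξ : T N), ∀ y ∈ V, H.ofT ξ • y ∈ V)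
    (h : H N) : ∀ y ∈ V, h • y ∈ V := by
  have hh : h ∈ Algebra.adjoin ℂ (Set.range (H.ofW : W N → H N) ∪
      Set.range (H.ofT : T N → H N)) := by rw [H.adjoin_eq_top]; trivial
  induction hh using Algebra.adjoin_induction with
  | mem x hx =>
    rcases hx with ⟨w, rfl⟩ | ⟨ξ, rfl⟩
    · exact hW w
    · exact hT ξ
  | algebraMap r => intro y hy; rw [algebraMap_smul]; exact V.smul_mem r hy
  | add a b _ _ ha hb => intro y hy; rw [add_smul]; exact V.add_mem (ha y hy) (hb y hy)
  | mul a b _ _ ha hb => intro y hy; rw [mul_smul]; exact ha _ (hb y hy)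

/-- `y` is a vector of weight `z` for the action of `𝔱'`. -/
def IsWt (z : Wt N) (y : M) : Prop := ∀ ξ : T N, H.ofT ξ • y = pair z ξ • y

theorem smul_comm_H (a : ℂ) (h : H N) (y : M) : h • a • y = a • h • y := by
  rw [← algebraMap_smul (H N) a y, ← algebraMap_smul (H N) a (h • y), ← mul_smul, ← mul_smul,
    Algebra.commutes]

theorem IsWt.phiSimple_smul {z : Wt N} {y : M} (hy : IsWt z y) (α : AffRoot N) :
    phiSimple α • y = y + pairing z α • H.ofW α.refl • y := by
  rw [phiSimple, add_smul, one_smul, mul_smul, hy, smul_comm_H]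
  rfl

theorem IsWt.phi_smul {z : Wt N} {y : M} (hy : IsWt z y) {α : AffRoot N} (hα : α.IsSimple) :
    IsWt (actWt α.refl z) (phiSimple α • y) := by
  intro ξ
  rw [← mul_smul, H.ofT_mul_phiSimple hα, mul_smul, hy, smul_comm_H, pair_actWt_eq, refl_inv]

/-- The two factors meet opposite pairings with α, those of z and s_α z, and s_α² = 1. The scalar
vanishes only for the pairings ±1. -/
theorem IsWt.phi_phi_smul {z : Wt N} {y : M} (hy : IsWt z y) {α : AffRoot N}
    (hα : α.IsSimple) :
    phiSimple α • phiSimple α • y = (1 - pairing z α ^ 2) • y := by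
  have h1 := (hy.phi_smul hα).phiSimple_smul α
  rw [h1, hy.phiSimple_smul, pairing_actWt_eq, refl_inv, refl_smul_self', pairing_neg, smul_add,
    smul_comm_H, ← mul_smul (H.ofW α.refl), H.ofW_refl_mul_self, one_smul, smul_add, smul_smul, sub_smul, one_smul, sq, neg_smul,
    neg_mul, neg_smul]
  abel

theorem IsWt.zpow {z : Wt N} {y : M} (hy : IsWt z y) (k : ℤ) :
    IsWt (actWt (piElt ^ k) z) (H.ofW (piElt ^ k : W N) • y) := by
  have step : ∀ {z : Wt N} {y : M}, IsWt z y →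
      IsWt (actWt piElt z) (H.ofW (piElt : W N) • y) := by
    intro z y hy ξ
    rw [← mul_smul, H.ofT_mul_ofW_pi, mul_smul, hy, smul_comm_H, pair_actWt_eq]
  have step' : ∀ {z : Wt N} {y : M}, IsWt z y →
      IsWt (actWt piElt⁻¹ z) (H.ofW (piElt : W N)⁻¹ • y) := by
    intro z y hy ξ
    rw [← mul_smul, H.ofT_mul_ofW_pi_inv, mul_smul, hy, smul_comm_H, pair_actWt_eq, inv_inv]
  induction k with
  | zero => simpa [actWt_one] using hy
  | succ k ih =>
    have := step ih
    rwa [← actWt_mul, ← mul_smul, ← map_mul, ← zpow_one_add, add_comm] at this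
  | pred k ih =>
    have := step' ih
    rwa [← actWt_mul, ← mul_smul, ← map_mul, ← zpow_neg_one, ← zpow_add,
      show (-1 : ℤ) + -(k : ℤ) = -k - 1 by ring] at this

omit [Module ℂ M] [IsScalarTower ℂ (H N) M] in
theorem ofW_smul_ne_zero {y : M} (hy : y ≠ 0) (w : W N) : H.ofW w • y ≠ 0 := by
  intro h
  apply hy
  rw [← one_smul (H N) y, ← map_one (H.ofW (N := N)), ← inv_mul_cancel w, map_mul, mul_smul, h,
    smul_zero]

/-- The vectors `w v`, `l(w) < n`, span the `n`-th step of the length filtration. -/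
def lenSpan (N : ℕ) [NeZero N] {M : Type*} [AddCommGroup M] [Module (H N) M] [Module ℂ M]
    (v : M) (n : ℕ) : Submodule ℂ M :=
  Submodule.span ℂ {y | ∃ w : W N, len w < n ∧ y = H.ofW w • v}

omit [IsScalarTower ℂ (H N) M] in
theorem mem_lenSpan (v : M) {n : ℕ} {w : W N} (h : len w < n) : H.ofW w • v ∈ lenSpan N v n :=
  Submodule.subset_span ⟨w, h, rfl⟩

omit [IsScalarTower ℂ (H N) M] in
theorem lenSpan_mono (v : M) {m n : ℕ} (h : m ≤ n) : lenSpan N v m ≤ lenSpan N v n :=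
  Submodule.span_mono fun _ ⟨w, hw, e⟩ => ⟨w, hw.trans_le h, e⟩

theorem refl_smul_mem_lenSpan {v y : M} {n : ℕ} (hy : y ∈ lenSpan N v n) {α : AffRoot N}
    (hα : α.IsSimple) : H.ofW α.refl • y ∈ lenSpan N v (n + 1) := by
  induction hy using Submodule.span_induction with
  | mem y h =>
    obtain ⟨w, hw, rfl⟩ := h
    rw [← mul_smul, ← map_mul]
    refine mem_lenSpan v ?_
    by_cases h : (w⁻¹ • α).IsPos
    · rw [len_refl_mul_of_isPos hα h]; omega
    · have := len_refl_mul_of_not_isPos hα h; omega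
  | zero => rw [smul_zero]; exact Submodule.zero_mem _
  | add a b _ _ ha hb => rw [smul_add]; exact Submodule.add_mem _ ha hb
  | smul c a _ ha => rw [smul_comm_H]; exact Submodule.smul_mem _ _ ha

theorem zpow_smul_mem_lenSpan {v y : M} {n : ℕ} (hy : y ∈ lenSpan N v n) (k : ℤ) :
    H.ofW (piElt ^ k : W N) • y ∈ lenSpan N v n := by
  induction hy using Submodule.span_induction with
  | mem y h =>
    obtain ⟨w, hw, rfl⟩ := h
    rw [← mul_smul, ← map_mul]
    refine mem_lenSpan v ?_
    rwa [len_zpow_mul]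
  | zero => rw [smul_zero]; exact Submodule.zero_mem _
  | add a b _ _ ha hb => rw [smul_add]; exact Submodule.add_mem _ ha hb
  | smul c a _ ha => rw [smul_comm_H]; exact Submodule.smul_mem _ _ ha

/-- `v` generates the module, and spans the one-dimensional representation `ℂ 1_ζ` of `𝓗_β`. -/
structure IsCyclicVec (β : Composition N) (ζ : Wt N) (v : M) : Prop where
  ne_zero : v ≠ 0
  isWt : IsWt ζ v
  fixed : ∀ u ∈ WBarOf β, H.ofW (fin u) • v = v
  generates : ∀ y : M, ∃ h : H N, h • v = y

variable {β : Composition N} {ζ : Wt N} {v : M}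

/-- Induction on the word. Its suffixes stay in W^β by `mem_WSup_of_refl_mul`, so each new letter
acts on a weight vector whose pairing with α is not 1, 0 or -1. Avoiding ±1 keeps the vector
nonzero, since φ_α² is then a nonzero scalar; avoiding 0 keeps the leading coefficient nonzero. -/
theorem IsCyclicVec.word (hv : IsCyclicVec β ζ v) (hgen : IsGeneric β ζ)
    {js : List (AffRoot N)}
    (hjs : ∀ α ∈ js, α.IsSimple) (hlen : js.length = len (js.map AffRoot.refl).prod)
    (hmem : (js.map AffRoot.refl).prod ∈ WSup β) :
    IsWt (actWt (js.map AffRoot.refl).prod ζ) ((js.map phiSimple).prod • v) ∧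
    (js.map phiSimple).prod • v ≠ 0 ∧
    ∃ c : ℂ, c ≠ 0 ∧ (js.map phiSimple).prod • v - c • H.ofW (js.map AffRoot.refl).prod • v ∈
      lenSpan N v js.length := by
  induction js with
  | nil =>
    refine ⟨by simpa [actWt_one] using hv.isWt, by simpa using hv.ne_zero, 1, one_ne_zero, ?_⟩
    simp
  | cons α js ih =>
    have hα := hjs α List.mem_cons_self
    have hjs' : ∀ γ ∈ js, γ.IsSimple := fun γ hγ => hjs γ (List.mem_cons_of_mem _ hγ)
    rw [List.map_cons, List.prod_cons] at hlen hmem ⊢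
    rw [List.length_cons] at hlen
    have hle := len_prod_refl_le hjs'
    set p := (js.map AffRoot.refl).prod with hp
    have hl : len (α.refl * p) = len p + 1 := by
      by_cases h : (p⁻¹ • α).IsPos
      · exact len_refl_mul_of_isPos hα h
      · have := len_refl_mul_of_not_isPos hα h
        omega
    have hpmem := mem_WSup_of_refl_mul hα hmem hl
    obtain ⟨h1, h2, c, hc, h3⟩ := ih hjs' (by omega) hpmem
    have hne := pairing_ne_of_mem hgen hpmem hα hmem
    rw [List.map_cons, List.prod_cons, mul_smul, actWt_mul]
    refine ⟨h1.phi_smul hα, fun h => ?_, pairing (actWt p ζ) α * c,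
      mul_ne_zero hne.2.1 hc, ?_⟩
    · have h4 := h1.phi_phi_smul hα
      rw [h, smul_zero] at h4
      rcases smul_eq_zero.1 h4.symm with h5 | h5
      · have : (pairing (actWt p ζ) α - 1) * (pairing (actWt p ζ) α + 1) = 0 := by
          linear_combination -h5
        rcases mul_eq_zero.1 this with h6 | h6
        · exact hne.1 (by linear_combination h6)
        · exact hne.2.2 (by linear_combination h6)
      · exact h2 h5
    · set y := (js.map phiSimple).prod • v
      have hy : y ∈ lenSpan N v (js.length + 1) := by
        have h5 := mem_lenSpan (w := p) v (n := js.length + 1) (by omega)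
        have h6 := Submodule.add_mem _ (lenSpan_mono v (Nat.le_succ _) h3)
          (Submodule.smul_mem _ c h5)
        rwa [sub_add_cancel] at h6
      rw [h1.phiSimple_smul, List.length_cons, map_mul, mul_smul (H.ofW α.refl), add_sub_assoc]
      refine Submodule.add_mem _ hy ?_
      rw [mul_smul, ← smul_sub, ← smul_comm_H c, ← smul_sub]
      exact Submodule.smul_mem _ _ (refl_smul_mem_lenSpan h3 hα)

theorem IsCyclicVec.phi_spec (hv : IsCyclicVec β ζ v) (hgen : IsGeneric β ζ)
    {w : W N} (hw : w ∈ WSup β) :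
    IsWt (actWt w ζ) (phi w • v) ∧ phi w • v ≠ 0 ∧
    ∃ c : ℂ, c ≠ 0 ∧ phi w • v - c • H.ofW w • v ∈ lenSpan N v (len w) := by
  obtain ⟨h1, h2, h3⟩ := (exists_reduced w).choose_spec
  unfold phi
  set k := (exists_reduced w).choose.1
  set js := (exists_reduced w).choose.2
  have h4 : len w = len (js.map AffRoot.refl).prod := by
    conv_lhs => rw [h2, len_zpow_mul]
  have h5 : (js.map AffRoot.refl).prod ∈ WSup β := by
    intro u hu
    have := hw u hu
    rwa [h2, mul_assoc, len_zpow_mul, len_zpow_mul] at this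
  obtain ⟨h6, h7, c, hc, h8⟩ := hv.word hgen h1 (h3.trans h4) h5
  rw [mul_smul (H.ofW (piElt ^ k))]
  refine ⟨?_, ofW_smul_ne_zero h7 _, c, hc, ?_⟩
  · have := h6.zpow k
    rwa [← actWt_mul, ← h2] at this
  · have := zpow_smul_mem_lenSpan h8 k
    rwa [smul_sub, smul_comm_H, ← mul_smul _ (H.ofW _) v, ← map_mul, ← h2, h3] at this

/-- The span absorbs 𝔱': ξ is moved to the right through a word for w until it meets v, and each
simple reflection on the way leaves only a multiple of the word without that letter. -/
theorem IsCyclicVec.span_ofW (hv : IsCyclicVec β ζ v) :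
    Submodule.span ℂ (Set.range fun w : W N => H.ofW w • v) = (⊤ : Submodule ℂ M) := by
  set V := Submodule.span ℂ (Set.range fun w : W N => H.ofW w • v)
  have hV : ∀ w : W N, H.ofW w • v ∈ V := fun w => Submodule.subset_span ⟨w, rfl⟩
  have hW : ∀ (w : W N), ∀ y ∈ V, H.ofW w • y ∈ V := by
    intro w y hy
    induction hy using Submodule.span_induction with
    | mem y h =>
      obtain ⟨u, rfl⟩ := h
      change H.ofW w • H.ofW u • v ∈ V
      rw [← mul_smul, ← map_mul]
      exact hV _
    | zero => rw [smul_zero]; exact Submodule.zero_mem _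
    | add a b _ _ ha hb => rw [smul_add]; exact Submodule.add_mem _ ha hb
    | smul c a _ ha => rw [smul_comm_H]; exact Submodule.smul_mem _ _ ha
  have hT : ∀ (w : W N) (ξ : T N), H.ofT ξ • H.ofW w • v ∈ V := by
    intro w
    obtain ⟨k, js, hjs, rfl⟩ := exists_word w
    have h1 : ∀ ξ : T N, H.ofT ξ • H.ofW (js.map AffRoot.refl).prod • v ∈ V := by
      induction js with
      | nil =>
        intro ξ
        rw [List.map_nil, List.prod_nil, map_one, one_smul, hv.isWt]
        refine V.smul_mem _ ?_
        have := hV 1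
        rwa [map_one, one_smul] at this
      | cons α js ih =>
        intro ξ
        rw [List.map_cons, List.prod_cons, map_mul, mul_smul, ← mul_smul,
          H.ofT_mul_ofW (hjs α List.mem_cons_self), sub_smul, mul_smul, algebraMap_smul]
        exact V.sub_mem (hW _ _ (ih (fun γ hγ => hjs γ (List.mem_cons_of_mem _ hγ)) _))
          (V.smul_mem _ (hV _))
    induction k with
    | zero => simpa using h1
    | succ k ih =>
      intro ξ
      rw [add_comm, zpow_one_add, mul_assoc, map_mul, mul_smul, ← mul_smul, H.ofT_mul_ofW_pi,
        mul_smul]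
      exact hW _ _ (ih _)
    | pred k ih =>
      intro ξ
      rw [show -(k : ℤ) - 1 = -1 + -k by ring, zpow_add, zpow_neg_one, mul_assoc, map_mul, mul_smul,
        ← mul_smul, H.ofT_mul_ofW_pi_inv, mul_smul]
      exact hW _ _ (ih _)
  have hT' : ∀ (ξ : T N), ∀ y ∈ V, H.ofT ξ • y ∈ V := by
    intro ξ y hy
    induction hy using Submodule.span_induction with
    | mem y h => obtain ⟨u, rfl⟩ := h; exact hT u ξ
    | zero => rw [smul_zero]; exact Submodule.zero_mem _
    | add a b _ _ ha hb => rw [smul_add]; exact Submodule.add_mem _ ha hb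
    | smul c a _ ha => rw [smul_comm_H]; exact Submodule.smul_mem _ _ ha
  rw [eq_top_iff]
  rintro y -
  obtain ⟨h, rfl⟩ := hv.generates y
  have h0 := hV 1
  rw [map_one, one_smul] at h0
  exact mem_of_generators hW hT' h v h0

/-- As W̄_β fixes v, any w may be replaced by a representative in W^β that is not longer. There φ_w
v is a nonzero multiple of w v up to smaller lengths, and induction on length applies. -/
theorem IsCyclicVec.span_phi (hv : IsCyclicVec β ζ v) (hgen : IsGeneric β ζ)
    :
    Submodule.span ℂ (Set.range fun w : WSup β => phi (w : W N) • v) = ⊤ := by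
  set V := Submodule.span ℂ (Set.range fun w : WSup β => phi (w : W N) • v)
  have key : ∀ n, ∀ w : W N, len w < n → H.ofW w • v ∈ V := by
    intro n
    induction n with
    | zero => intro w hw; omega
    | succ n ih =>
      intro w hw
      obtain ⟨u, hu, h1, h2⟩ := exists_mul_mem_WSup β w
      have e : H.ofW w • v = H.ofW (w * fin u) • v := by
        rw [map_mul, mul_smul, hv.fixed u hu]
      obtain ⟨-, -, c, hc, h3⟩ := hv.phi_spec hgen h1
      have h4 : lenSpan N v (len (w * fin u)) ≤ V := by
        refine Submodule.span_le.2 ?_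
        rintro _ ⟨w', hw', rfl⟩
        exact ih w' (by omega)
      have h5 : phi (w * fin u) • v ∈ V := Submodule.subset_span ⟨⟨_, h1⟩, rfl⟩
      have h6 := V.sub_mem h5 (h4 h3)
      rw [sub_sub_cancel] at h6
      rw [e]
      exact (V.smul_mem_iff hc).1 h6
  rw [eq_top_iff, ← hv.span_ofW, Submodule.span_le]
  rintro _ ⟨w, rfl⟩
  exact key _ w (Nat.lt_succ_self _)

omit [NeZero N] in
-- W preserves the coordinate ζ.2, so nothing is lost by restricting weights to 𝔱̄. This is why 𝓗̄
-- suffices to isolate weight vectors.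
theorem actWt_fst_injOn (hκ : ζ.2 ≠ 0) (hgen : IsGeneric β ζ) :
    Function.Injective fun w : WSup β => (actWt (w : W N) ζ).1 := by
  intro w w' h
  exact Subtype.ext (eq_of_actWt_eq_of_mem hκ hgen w.2 w'.2 (Prod.ext h rfl))

/-- The coordinate operators of `𝔱̄`. -/
noncomputable def coordOp (N : ℕ) [NeZero N] (M : Type*) [AddCommGroup M] [Module (H N) M] [Module ℂ M]
    [IsScalarTower ℂ (H N) M] (m : Fin N) : M →ₗ[ℂ] M :=
  Algebra.lsmul ℂ ℂ M (H.ofT ((Pi.single m 1, 0) : T N))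

theorem IsWt.coordOp_apply {z : Wt N} {y : M} (hy : IsWt z y) (m : Fin N) :
    coordOp N M m y = z.1 m • y := by
  have := hy (Pi.single m 1, 0)
  simpa [coordOp, pair, Pi.single_apply] using this

theorem IsCyclicVec.phi_mem (hv : IsCyclicVec β ζ v) (hκ : ζ.2 ≠ 0)
    (hgen : IsGeneric β ζ) (U : Submodule ℂ M)
    (hU : ∀ m, ∀ y ∈ U, coordOp N M m y ∈ U) (c : WSup β →₀ ℂ)
    (hc : Finsupp.linearCombination ℂ (fun w : WSup β => phi (w : W N) • v) c ∈ U)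
    {w : WSup β} (hw : c w ≠ 0) : phi (w : W N) • v ∈ U := by
  have := mem_of_sum_mem (coordOp N M) U hU
    (fun w : WSup β => (actWt (w : W N) ζ).1)
    c.support (actWt_fst_injOn hκ hgen).injOn (fun w => c w • phi (w : W N) • v)
    (fun w _ m => by rw [map_smul, (hv.phi_spec hgen w.2).1.coordOp_apply, smul_comm]) hc w
    (Finsupp.mem_support_iff.2 hw)
  exact (U.smul_mem_iff hw).1 this

theorem IsCyclicVec.linearIndependent (hv : IsCyclicVec β ζ v) (hκ : ζ.2 ≠ 0)
    (hgen : IsGeneric β ζ) :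
    LinearIndependent ℂ fun w : WSup β => phi (w : W N) • v := by
  rw [linearIndependent_iff]
  intro c hc
  ext w
  by_contra h
  have := hv.phi_mem hκ hgen ⊥ (fun m y hy => by
    rw [Submodule.mem_bot] at hy ⊢; rw [hy, map_zero]) c (by rw [hc]; exact Submodule.zero_mem _) h
  exact (hv.phi_spec hgen w.2).2.1 ((Submodule.mem_bot ℂ).1 this)

theorem IsCyclicVec.exists_eq_linearCombination (hv : IsCyclicVec β ζ v)
    (hgen : IsGeneric β ζ) (y : M) : ∃ c : WSup β →₀ ℂ,
    Finsupp.linearCombination ℂ (fun w : WSup β => phi (w : W N) • v) c = y := by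
  have : y ∈ Submodule.span ℂ (Set.range fun w : WSup β => phi (w : W N) • v) := by
    rw [hv.span_phi hgen]; trivial
  exact (Finsupp.mem_span_range_iff_exists_finsupp).1 this

/-- Comparing coefficients in the independent family, c w times each coordinate of w(ζ) - z is zero.
-/
theorem IsCyclicVec.actWt_eq_of_isWt (hv : IsCyclicVec β ζ v) (hκ : ζ.2 ≠ 0)
    (hgen : IsGeneric β ζ) {z : Wt N} (hz : z.2 = ζ.2) {c : WSup β →₀ ℂ}
    (hc : IsWt z (Finsupp.linearCombination ℂ (fun w : WSup β => phi (w : W N) • v) c))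
    {w : WSup β} (hw : c w ≠ 0) : actWt (w : W N) ζ = z := by
  refine Prod.ext (funext fun m => ?_) hz.symm
  have h1 := hc.coordOp_apply m
  have h2 : Finsupp.linearCombination ℂ (fun w : WSup β => phi (w : W N) • v)
      (c.support.sum fun w => Finsupp.single w (c w * ((actWt (w : W N) ζ).1 m - z.1 m))) = 0 := by
    rw [map_sum]
    simp only [Finsupp.linearCombination_single]
    rw [Finsupp.linearCombination_apply, Finsupp.sum, map_sum, Finset.smul_sum, ← sub_eq_zero,
      ← Finset.sum_sub_distrib] at h1
    rw [← h1]
    refine Finset.sum_congr rfl fun w _ => ?_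
    rw [map_smul, (hv.phi_spec hgen w.2).1.coordOp_apply, mul_sub, sub_smul, smul_smul, smul_smul,
      mul_comm (z.1 m)]
  have h3 := linearIndependent_iff.1 (hv.linearIndependent hκ hgen) _ h2
  have h4 := DFunLike.congr_fun h3 w
  classical
  simp only [Finsupp.finsetSum_apply, Finsupp.single_apply, Finset.sum_ite_eq',
    Finsupp.mem_support_iff, Finsupp.coe_zero, Pi.zero_apply, ne_eq, hw, not_false_eq_true,
    if_true, mul_eq_zero, false_or] at h4
  exact sub_eq_zero.1 h4

/-- The vector has weight s_α w(ζ), which only a basis vector indexed by s_α w can carry. If there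
is one, φ_α² ≠ 0 on the weight of φ_w v shows that the multiple is not zero. -/
theorem IsCyclicVec.phiSimple_smul_phi (hv : IsCyclicVec β ζ v) (hκ : ζ.2 ≠ 0)
    (hgen : IsGeneric β ζ) (hζ : ζ ∈ tStar β) {w : W N} (hw : w ∈ WSup β) {α : AffRoot N}
    (hα : α.IsSimple) :
    (α.refl * w ∈ WSup β → ∃ a : ℂ, a ≠ 0 ∧
      phiSimple α • phi w • v = a • phi (α.refl * w) • v) ∧
    (α.refl * w ∉ WSup β → phiSimple α • phi w • v = 0) := by
  obtain ⟨h1, h2, -⟩ := hv.phi_spec hgen hw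
  have h3 := h1.phi_smul hα
  rw [← actWt_mul] at h3
  obtain ⟨c, hc⟩ := hv.exists_eq_linearCombination hgen
    (phiSimple α • phi w • v)
  have key : ∀ u : WSup β, c u ≠ 0 → (u : W N) = α.refl * w := fun u hu => by
    rw [← hc] at h3
    exact eq_of_actWt_eq_refl_mul hκ hζ hgen hw u.2 hα
      (hv.actWt_eq_of_isWt (z := actWt (α.refl * w) ζ) hκ hgen rfl h3 hu)
  constructor
  · intro hs
    have hc' : c = Finsupp.single ⟨_, hs⟩ (c ⟨_, hs⟩) := by
      ext u
      rw [Finsupp.single_apply]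
      split_ifs with h
      · rw [h]
      · by_contra hu
        exact h (Subtype.ext (key u hu).symm)
    rw [hc', Finsupp.linearCombination_single] at hc
    refine ⟨_, fun h => ?_, hc.symm⟩
    rw [h, zero_smul] at hc
    have h4 := h1.phi_phi_smul hα
    rw [← hc, smul_zero] at h4
    have hne := pairing_ne_of_mem hgen hw hα hs
    rcases smul_eq_zero.1 h4.symm with h5 | h5
    · have : (pairing (actWt w ζ) α - 1) * (pairing (actWt w ζ) α + 1) = 0 := by
        linear_combination -h5
      rcases mul_eq_zero.1 this with h6 | h6
      · exact hne.1 (by linear_combination h6)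
      · exact hne.2.2 (by linear_combination h6)
    · exact h2 h5
  · intro hs
    have : c = 0 := by
      ext u
      by_contra hu
      exact hs (key u hu ▸ u.2)
    rw [← hc, this, map_zero]

/-- On a weight vector with pairing a ≠ 0, s_α is a⁻¹(φ_α - 1). If s_α w leaves W^β, then φ_α gives
zero and a = -1, so s_α acts trivially. -/
theorem IsCyclicVec.refl_smul_phi (hv : IsCyclicVec β ζ v) (hκ : ζ.2 ≠ 0)
    (hgen : IsGeneric β ζ) (hζ : ζ ∈ tStar β) {w : W N} (hw : w ∈ WSup β) {α : AffRoot N}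
    (hα : α.IsSimple) :
    (α.refl * w ∈ WSup β → ∃ a b : ℂ,
      H.ofW α.refl • phi w • v = a • phi w • v + b • phi (α.refl * w) • v) ∧
    (α.refl * w ∉ WSup β → H.ofW α.refl • phi w • v = phi w • v) := by
  obtain ⟨h1, -, -⟩ := hv.phi_spec hgen hw
  have h3 := h1.phiSimple_smul α
  obtain ⟨h4, h5⟩ := hv.phiSimple_smul_phi hκ hgen hζ hw hα
  constructor
  · intro hs
    have hne := (pairing_ne_of_mem hgen hw hα hs).2.1
    obtain ⟨a, -, ha⟩ := h4 hs
    refine ⟨-(pairing (actWt w ζ) α)⁻¹, (pairing (actWt w ζ) α)⁻¹ * a, ?_⟩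
    rw [mul_smul, ← ha, h3, smul_add, smul_smul _ (pairing _ _), inv_mul_cancel₀ hne, one_smul,
      neg_smul, neg_add_cancel_left]
  · intro hs
    rw [h5 hs, pairing_eq_neg_one hζ hw hα hs, neg_smul, one_smul] at h3
    exact (sub_eq_zero.1 (by rw [sub_eq_add_neg]; exact h3.symm)).symm

end WeightVectors

/-! ### Modules induced from a character. -/

section InducedModules

variable {A B : Type} [Ring A] [Algebra ℂ A] [Ring B] [Algebra ℂ B]

/-- The cyclic vector of a module induced from a one-dimensional representation. -/
noncomputable def indVec (f : B →ₐ[ℂ] A) (χ : B →ₐ[ℂ] ℂ) : Induced f (oneDim χ) :=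
  Submodule.Quotient.mk ((1 : A) ⊗ₜ[ℂ] (1 : ℂ))

theorem smul_indVec (f : B →ₐ[ℂ] A) (χ : B →ₐ[ℂ] ℂ) (b : B) :
    f b • indVec f χ = χ b • indVec f χ := by
  rw [indVec, ← Submodule.Quotient.mk_smul, ← Submodule.Quotient.mk_smul, Submodule.Quotient.eq]
  refine Submodule.subset_span ⟨1, b, 1, ?_⟩
  rw [TensorProduct.smul_tmul', smul_eq_mul, mul_one, one_mul, ← TensorProduct.tmul_smul]
  rfl

theorem exists_smul_indVec (f : B →ₐ[ℂ] A) (χ : B →ₐ[ℂ] ℂ) (y : Induced f (oneDim χ)) :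
    ∃ a : A, a • indVec f χ = y := by
  obtain ⟨t, rfl⟩ := Submodule.Quotient.mk_surjective _ y
  refine ⟨TensorProduct.AlgebraTensorModule.rid ℂ A A t, ?_⟩
  rw [indVec, ← Submodule.Quotient.mk_smul]
  congr 1
  induction t using TensorProduct.induction_on with
  | zero => simp
  | tmul a c =>
    rw [TensorProduct.AlgebraTensorModule.rid_tmul, TensorProduct.smul_tmul', smul_eq_mul, mul_one,
      TensorProduct.smul_tmul, smul_eq_mul, mul_one]
  | add x y hx hy => rw [map_add, add_smul, hx, hy]

theorem exists_lift_induced (f : B →ₐ[ℂ] A) (χ : B →ₐ[ℂ] ℂ) {M : Type*} [AddCommGroup M]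
    [Module A M] [Module ℂ M] [IsScalarTower ℂ A M] (y : M) (hy : ∀ b, f b • y = χ b • y) :
    ∃ F : Induced f (oneDim χ) →ₗ[A] M, F (indVec f χ) = y := by
  let G : A ⊗[ℂ] ℂ →ₗ[A] M :=
    LinearMap.toSpanSingleton A M y ∘ₗ
      (TensorProduct.AlgebraTensorModule.rid ℂ A A).toLinearMap
  have hG : ∀ (a : A) (c : ℂ), G (a ⊗ₜ c) = (c • a) • y := fun a c => by
    simp only [G, LinearMap.comp_apply, LinearEquiv.coe_coe,
      TensorProduct.AlgebraTensorModule.rid_tmul, LinearMap.toSpanSingleton_apply]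
  refine ⟨Submodule.liftQ _ G (Submodule.span_le.2 ?_), ?_⟩
  · rintro _ ⟨a, b, c, rfl⟩
    rw [SetLike.mem_coe, LinearMap.mem_ker, map_sub, hG, hG]
    show (c • (a * f b)) • y - ((χ b * c) • a) • y = 0
    rw [smul_assoc, mul_smul, hy, mul_comm, mul_smul, smul_assoc, smul_assoc, sub_eq_zero,
      ← algebraMap_smul A (χ b) y, ← algebraMap_smul A (χ b) (a • y), ← mul_smul, ← mul_smul,
      Algebra.commutes]
  · rw [indVec, Submodule.liftQ_apply, hG, one_smul, one_smul]

end InducedModules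

/-! ### Nonvanishing of 𝟏_ζ. -/

section CyclicVector

variable {N : ℕ} [NeZero N] {β : Composition N} {ζ : Wt N}

/-- The span of the `w x`, with `x ∈ ℂ[W̄_β]` of augmentation zero; the kernel of
`ℂ[W] → ℂ[W / W̄_β]`. -/
noncomputable def augKer (β : Composition N) : Submodule ℂ (W N →₀ ℂ) :=
  Submodule.span ℂ {y | ∃ (w : W N) (x : W N →₀ ℂ), x ∈ blockSpan β ∧ augm x = 0 ∧ y = trans w x}

omit [NeZero N] in
theorem augm_eq_zero_of_mem {y : W N →₀ ℂ} (hy : y ∈ augKer β) : augm y = 0 := by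
  have : augKer β ≤ LinearMap.ker (augm (N := N)) := by
    refine Submodule.span_le.2 ?_
    rintro _ ⟨w, x, -, hx, rfl⟩
    rw [SetLike.mem_coe, LinearMap.mem_ker, augm_trans, hx]
  exact this hy

omit [NeZero N] in
theorem trans_mem_augKer (v : W N) {y : W N →₀ ℂ} (hy : y ∈ augKer β) :
    trans v y ∈ augKer β := by
  have : augKer β ≤ (augKer β).comap (trans v) := by
    refine Submodule.span_le.2 ?_
    rintro _ ⟨w, x, h1, h2, rfl⟩
    refine Submodule.subset_span ⟨v * w, x, h1, h2, ?_⟩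
    rw [map_mul, Module.End.mul_apply]
  exact this hy

/-- On ℂ[W̄_β] the operator of ξ multiplies the augmentation by ζ(ξ), so augmentation zero is kept.
For a translate by w, ξ is pushed through a word for w; the correction terms are again translates of
the same x. -/
theorem dOp_mem_augKer (hζ : ζ ∈ tStar β) (ξ : T N) {y : W N →₀ ℂ} (hy : y ∈ augKer β) :
    dOp ζ ξ y ∈ augKer β := by
  have hmem : ∀ (w : W N) (x : W N →₀ ℂ), x ∈ blockSpan β → augm x = 0 → trans w x ∈ augKer β :=
    fun w x h1 h2 => Submodule.subset_span ⟨w, x, h1, h2, rfl⟩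
  have key : ∀ (w : W N) (x : W N →₀ ℂ), x ∈ blockSpan β → augm x = 0 →
      ∀ ξ, dOp ζ ξ (trans w x) ∈ augKer β := by
    intro w x h1 h2
    obtain ⟨k, js, hjs, rfl⟩ := exists_word w
    have h3 : ∀ ξ, dOp ζ ξ (trans (js.map AffRoot.refl).prod x) ∈ augKer β := by
      induction js with
      | nil =>
        intro ξ
        have h4 := dOp_blockSpan hζ ξ h1
        have h5 := hmem 1 _ h4.1 (by rw [h4.2, h2, mul_zero])
        simpa using h5
      | cons α js ih =>
        intro ξ
        rw [List.map_cons, List.prod_cons, map_mul, Module.End.mul_apply,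
          dOp_simple_apply ζ (hjs α List.mem_cons_self)]
        exact Submodule.sub_mem _
          (trans_mem_augKer _ (ih (fun γ hγ => hjs γ (List.mem_cons_of_mem _ hγ)) _))
          (Submodule.smul_mem _ _ (hmem _ _ h1 h2))
    induction k with
    | zero => simpa using h3
    | succ k ih =>
      intro ξ
      rw [add_comm, zpow_one_add, mul_assoc, map_mul, Module.End.mul_apply, dOp_pi_apply]
      exact trans_mem_augKer _ (ih _)
    | pred k ih =>
      intro ξ
      rw [show -(k : ℤ) - 1 = -1 + -k by ring, zpow_add, zpow_neg_one, mul_assoc, map_mul,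
        Module.End.mul_apply, dOp_pi_inv_apply]
      exact trans_mem_augKer _ (ih _)
  have : augKer β ≤ (augKer β).comap (dOp ζ ξ) := by
    refine Submodule.span_le.2 ?_
    rintro _ ⟨w, x, h1, h2, rfl⟩
    exact key w x h1 h2 ξ
  exact this hy

theorem principal_mem_augKer (hζ : ζ ∈ tStar β) (h : H N) :
    ∀ y ∈ augKer β, principal ζ h y ∈ augKer β := by
  have hh : h ∈ Algebra.adjoin ℂ (Set.range (H.ofW : W N → H N) ∪
      Set.range (H.ofT : T N → H N)) := by rw [H.adjoin_eq_top]; trivial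
  induction hh using Algebra.adjoin_induction with
  | mem x hx =>
    rcases hx with ⟨w, rfl⟩ | ⟨ξ, rfl⟩
    · intro y hy; rw [principal_ofW]; exact trans_mem_augKer w hy
    · intro y hy; rw [principal_ofT]; exact dOp_mem_augKer hζ ξ hy
  | algebraMap r =>
    intro y hy
    rw [AlgHom.commutes, Module.algebraMap_end_apply]
    exact Submodule.smul_mem _ r hy
  | add a b _ _ ha hb =>
    intro y hy
    rw [map_add, LinearMap.add_apply]
    exact Submodule.add_mem _ (ha y hy) (hb y hy)
  | mul a b _ _ ha hb =>
    intro y hy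
    rw [map_mul, Module.End.mul_apply]
    exact ha _ (hb y hy)

/-- Acting on the basis vector at 1 in `principal ζ` sends the relations of the induced module into
`augKer β`, where the augmentation vanishes, whereas 1 ⊗ 1 goes to a vector of augmentation 1. -/
theorem oneVec_ne_zero (hζ : ζ ∈ tStar β) : oneVec β ζ hζ ≠ 0 := by
  intro h
  rw [oneVec, Submodule.Quotient.mk_eq_zero] at h
  let e := TensorProduct.AlgebraTensorModule.rid ℂ (H N) (H N)
  have key : ∀ t ∈ Submodule.span (H N) {t : H N ⊗[ℂ] ℂ | ∃ (a : H N) (b : HOf β) (v : ℂ),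
      t = (a * (HOf β).val b) ⊗ₜ[ℂ] v - a ⊗ₜ[ℂ] oneDim (character β ζ hζ) b v},
      principal ζ (e t) (Finsupp.single 1 1) ∈ augKer β := by
    intro t ht
    induction ht using Submodule.span_induction with
    | mem t ht =>
      obtain ⟨a, b, v, rfl⟩ := ht
      have h1 : Finsupp.single (1 : W N) (1 : ℂ) ∈ blockSpan β :=
        Submodule.subset_span ⟨1, one_mem _, by rw [map_one]⟩
      have h2 := principal_blockSpan hζ b.2 _ h1
      have h3 : e ((a * (HOf β).val b) ⊗ₜ[ℂ] v - a ⊗ₜ[ℂ] oneDim (character β ζ hζ) b v) =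
          v • (a * (b.1 - algebraMap ℂ (H N) (charFun ζ b.1))) := by
        rw [map_sub, TensorProduct.AlgebraTensorModule.rid_tmul,
          TensorProduct.AlgebraTensorModule.rid_tmul]
        show v • (a * b.1) - (charFun ζ b.1 * v) • a = _
        rw [mul_sub, ← Algebra.commutes, ← Algebra.smul_def, smul_sub, smul_smul, mul_comm v]
      rw [h3, map_smul, map_mul, LinearMap.smul_apply, Module.End.mul_apply]
      refine Submodule.smul_mem _ v (principal_mem_augKer hζ a _ ?_)
      rw [map_sub, AlgHom.commutes, LinearMap.sub_apply, Module.algebraMap_end_apply]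
      -- b minus its character value sends the basis vector at 1 to an element of ℂ[W̄_β] of
      -- augmentation zero.
      refine Submodule.subset_span ⟨1, _, Submodule.sub_mem _ h2.1 (Submodule.smul_mem _ _ h1),
        ?_, by rw [map_one]; rfl⟩
      rw [map_sub, h2.2, map_smul, smul_eq_mul, sub_self]
    | zero => rw [map_zero, map_zero]; exact Submodule.zero_mem _
    | add x y _ _ hx hy =>
      rw [map_add, map_add, LinearMap.add_apply]
      exact Submodule.add_mem _ hx hy
    | smul a x _ hx =>
      rw [map_smul, smul_eq_mul, map_mul, Module.End.mul_apply]
      exact principal_mem_augKer hζ a _ hx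
  have h1 := augm_eq_zero_of_mem (key _ h)
  rw [TensorProduct.AlgebraTensorModule.rid_tmul, one_smul, map_one, Module.End.one_apply,
    augm_single] at h1
  exact one_ne_zero h1

theorem isCyclicVec_oneVec (hζ : ζ ∈ tStar β) : IsCyclicVec β ζ (oneVec β ζ hζ) where
  ne_zero := oneVec_ne_zero hζ
  isWt ξ := by
    have := smul_indVec (HOf β).val (character β ζ hζ)
      ⟨H.ofT ξ, Algebra.subset_adjoin (Or.inr ⟨ξ, rfl⟩)⟩
    rw [character_ofT] at this
    exact this
  fixed u hu := by
    have := smul_indVec (HOf β).val (character β ζ hζ)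
      ⟨H.ofW (fin u), Algebra.subset_adjoin (Or.inl ⟨u, hu, rfl⟩)⟩
    rw [character_ofW β ζ hζ u hu, one_smul] at this
    exact this
  generates y := exists_smul_indVec _ _ y

end CyclicVector

/-! ### Generators of 𝓗̄ and spanning sets of its modules. -/

section FiniteAction

variable {N : ℕ} [NeZero N]

theorem perm_induction {P : Equiv.Perm (Fin N) → Prop} (h1 : P 1)
    (hs : ∀ α ∈ PiBar N, ∀ σ, P σ → P (Equiv.swap α.i α.j * σ)) (σ : Equiv.Perm (Fin N)) : P σ := by
  obtain ⟨n, rfl⟩ := Nat.exists_eq_succ_of_ne_zero (NeZero.ne N)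
  have hσ : σ ∈ Submonoid.closure
      (Set.range fun i : Fin n => Equiv.swap i.castSucc i.succ) := by
    rw [Equiv.Perm.mclosure_swap_castSucc_succ]; trivial
  induction hσ using Submonoid.closure_induction_left with
  | one => exact h1
  | mul_left x hx y _ hy =>
    obtain ⟨i, rfl⟩ := hx
    exact hs ⟨i.castSucc, i.succ, Fin.castSucc_lt_succ.ne, 0⟩ ⟨rfl, by simp⟩ y hy

/-- The element `σ ∈ W̄` of `𝓗̄`. -/
noncomputable def wBar (σ : Equiv.Perm (Fin N)) : Hbar N :=
  ⟨H.ofW (fin σ), Algebra.subset_adjoin (Or.inl ⟨σ, rfl⟩)⟩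

/-- The element `x ∈ 𝔱̄` of `𝓗̄`. -/
noncomputable def tBar (x : Fin N → ℂ) : Hbar N :=
  ⟨H.ofT (x, 0), Algebra.subset_adjoin (Or.inr ⟨x, rfl⟩)⟩

theorem wBar_mul (σ τ : Equiv.Perm (Fin N)) : wBar (σ * τ) = wBar σ * wBar τ :=
  Subtype.ext (by simp [wBar])

theorem wBar_one : wBar (1 : Equiv.Perm (Fin N)) = 1 :=
  Subtype.ext (by simp [wBar])

theorem tBar_mul_wBar {α : AffRoot N} (hα : α ∈ PiBar N) (x : Fin N → ℂ) :
    tBar x * wBar (Equiv.swap α.i α.j) =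
      wBar (Equiv.swap α.i α.j) * tBar (fun m => x (Equiv.swap α.i α.j m)) -
        algebraMap ℂ (Hbar N) (x α.i - x α.j) := by
  refine Subtype.ext ?_
  have h := H.ofT_mul_ofW (isSimple_of_mem hα) ((x, 0) : T N)
  have e : actT α.refl ((x, 0) : T N) = (fun m => x (Equiv.swap α.i α.j m), 0) := by
    rw [refl_of_mem hα]
    refine Prod.ext ?_ ?_
    · funext m
      show x ((Equiv.swap α.i α.j)⁻¹ m) = _
      rw [Equiv.swap_inv]
    · show (0 : ℂ) - ∑ m, ((0 : ℤ) : ℂ) * _ = 0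
      simp
  rw [e, refl_of_mem hα] at h
  exact h

theorem exists_adjoin_Hbar {P : Hbar N → Prop} (hW : ∀ α ∈ PiBar N, P (wBar (Equiv.swap α.i α.j)))
    (hT : ∀ x, P (tBar x)) (hC : ∀ r, P (algebraMap ℂ (Hbar N) r))
    (hadd : ∀ a b, P a → P b → P (a + b)) (hmul : ∀ a b, P a → P b → P (a * b)) (h : Hbar N) :
    P h := by
  obtain ⟨h, hh⟩ := h
  induction hh using Algebra.adjoin_induction with
  | mem x hx =>
    rcases hx with ⟨σ, rfl⟩ | ⟨x, rfl⟩
    · change P (wBar σ)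
      induction σ using perm_induction with
      | h1 =>
        rw [wBar_one, ← map_one (algebraMap ℂ (Hbar N))]
        exact hC 1
      | hs α hα σ ih => rw [wBar_mul]; exact hmul _ _ (hW α hα) ih
    · exact hT x
  | algebraMap r => exact hC r
  | add a b _ _ ha hb => exact hadd _ _ ha hb
  | mul a b _ _ ha hb => exact hmul _ _ ha hb

variable {M : Type*} [AddCommGroup M] [Module (Hbar N) M] [Module ℂ M]
  [IsScalarTower ℂ (Hbar N) M]

/-- A subspace stable under the generators of `𝓗̄` is stable under `𝓗̄`. -/
theorem Hbar_smul_mem {V : Submodule ℂ M}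
    (hW : ∀ α ∈ PiBar N, ∀ y ∈ V, wBar (Equiv.swap α.i α.j) • y ∈ V)
    (hT : ∀ x : Fin N → ℂ, ∀ y ∈ V, tBar x • y ∈ V) (h : Hbar N) : ∀ y ∈ V, h • y ∈ V := by
  induction h using exists_adjoin_Hbar with
  | hW α hα => exact hW α hα
  | hT x => exact hT x
  | hC r => intro y hy; rw [algebraMap_smul]; exact V.smul_mem r hy
  | hadd a b ha hb => intro y hy; rw [add_smul]; exact V.add_mem (ha y hy) (hb y hy)
  | hmul a b ha hb => intro y hy; rw [mul_smul]; exact ha _ (hb y hy)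

theorem smul_comm_Hbar (a : ℂ) (h : Hbar N) (y : M) : h • a • y = a • h • y := by
  rw [← algebraMap_smul (Hbar N) a y, ← algebraMap_smul (Hbar N) a (h • y), ← mul_smul,
    ← mul_smul, Algebra.commutes]

/-- A module over `𝓗̄` generated by a vector that spans a one-dimensional representation of
`𝓗̄_β` is spanned by the translates of this vector by `W̄^β`. -/
theorem span_wBar_eq_top {β : Composition N} {v : M} (hgen : ∀ y, ∃ h : Hbar N, h • v = y)
    (z : Fin N → ℂ) (hT : ∀ x : Fin N → ℂ, tBar x • v = (∑ m, z m * x m) • v)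
    (hW : ∀ u ∈ WBarOf β, wBar u • v = v) :
    Submodule.span ℂ (Set.range fun u : {u : Equiv.Perm (Fin N) // fin u ∈ WSup β} =>
      wBar u.1 • v) = ⊤ := by
  set V := Submodule.span ℂ (Set.range fun u : {u : Equiv.Perm (Fin N) // fin u ∈ WSup β} =>
      wBar u.1 • v)
  have hV : ∀ u : Equiv.Perm (Fin N), wBar u • v ∈ V := by
    intro u
    obtain ⟨τ, hτ, h1, -⟩ := exists_mul_mem_WSup β (fin u)
    rw [← map_mul] at h1
    have : wBar (u * τ) • v ∈ V := Submodule.subset_span ⟨⟨_, h1⟩, rfl⟩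
    rwa [wBar_mul, mul_smul, hW τ hτ] at this
  have hst : ∀ σ : Equiv.Perm (Fin N), ∀ y ∈ V, wBar σ • y ∈ V := by
    intro σ y hy
    induction hy using Submodule.span_induction with
    | mem y h =>
      obtain ⟨u, rfl⟩ := h
      change wBar σ • wBar u.1 • v ∈ V
      rw [← mul_smul, ← wBar_mul]
      exact hV _
    | zero => rw [smul_zero]; exact Submodule.zero_mem _
    | add a b _ _ ha hb => rw [smul_add]; exact Submodule.add_mem _ ha hb
    | smul c a _ ha => rw [smul_comm_Hbar]; exact Submodule.smul_mem _ _ ha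
  have hT1 : ∀ (u : Equiv.Perm (Fin N)) (x : Fin N → ℂ), tBar x • wBar u • v ∈ V := by
    intro u
    induction u using perm_induction with
    | h1 =>
      intro x
      have := hV 1
      rw [wBar_one, one_smul] at this ⊢
      rw [hT]
      exact V.smul_mem _ this
    | hs α hα σ ih =>
      intro x
      rw [wBar_mul, mul_smul, ← mul_smul, tBar_mul_wBar hα, sub_smul, mul_smul, algebraMap_smul]
      exact V.sub_mem (hst _ _ (ih _)) (V.smul_mem _ (hV σ))
  have hT2 : ∀ x : Fin N → ℂ, ∀ y ∈ V, tBar x • y ∈ V := by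
    intro x y hy
    induction hy using Submodule.span_induction with
    | mem y h => obtain ⟨u, rfl⟩ := h; exact hT1 u.1 x
    | zero => rw [smul_zero]; exact Submodule.zero_mem _
    | add a b _ _ ha hb => rw [smul_add]; exact Submodule.add_mem _ ha hb
    | smul c a _ ha => rw [smul_comm_Hbar]; exact Submodule.smul_mem _ _ ha
  rw [eq_top_iff]
  rintro y -
  obtain ⟨h, rfl⟩ := hgen y
  have h0 := hV 1
  rw [wBar_one, one_smul] at h0
  exact Hbar_smul_mem (fun α _ => hst _) hT2 h v h0

/-- A linear map out of the span of a finite family is injective if its range contains a linearly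
independent family of the same size. -/
theorem injective_of_linearIndependent {V V' ι : Type*} [AddCommGroup V] [Module ℂ V]
    [AddCommGroup V'] [Module ℂ V'] [Fintype ι] (F : V →ₗ[ℂ] V') {e : ι → V}
    (he : Submodule.span ℂ (Set.range e) = ⊤) {g : ι → V'} (hg : LinearIndependent ℂ g)
    (hgF : ∀ i, g i ∈ LinearMap.range F) : Function.Injective F := by
  have : Module.Finite ℂ V := ⟨⟨(Set.finite_range e).toFinset, by simpa using he⟩⟩
  have h1 : Module.finrank ℂ V ≤ Fintype.card ι := by
    rw [← finrank_top, ← he]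
    exact finrank_range_le_card e
  have h2 : LinearIndependent ℂ fun i => (⟨g i, hgF i⟩ : LinearMap.range F) :=
    LinearIndependent.of_comp (LinearMap.range F).subtype hg
  have h3 := h2.fintype_card_le_finrank
  have h4 := LinearMap.finrank_range_add_finrank_ker F
  rw [← LinearMap.ker_eq_bot, ← Submodule.finrank_eq_zero (R := ℂ)]
  omega

end FiniteAction

/-! ### Decomposition under 𝓗̄. -/

section Decomposition

variable {N : ℕ} [NeZero N] {M : Type*} [AddCommGroup M] [Module (H N) M] [Module ℂ M]
  [IsScalarTower ℂ (H N) M] {β : Composition N} {ζ : Wt N} {v : M}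

omit [Module ℂ M] [IsScalarTower ℂ (H N) M] in
theorem wBar_smul (σ : Equiv.Perm (Fin N)) (y : M) : wBar σ • y = H.ofW (fin σ) • y := rfl

omit [Module ℂ M] [IsScalarTower ℂ (H N) M] in
theorem tBar_smul (x : Fin N → ℂ) (y : M) : tBar x • y = H.ofT (x, 0) • y := rfl

omit [NeZero N] in
theorem pair_zero_snd (z : Wt N) (x : Fin N → ℂ) : pair z (x, 0) = ∑ m, z.1 m * x m := by
  simp [pair]

theorem phiSimple_mem_Hbar {α : AffRoot N} (hα : α ∈ PiBar N) : phiSimple α ∈ Hbar N := by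
  have h1 := (wBar (Equiv.swap α.i α.j)).2
  have h2 := (tBar (N := N) (Pi.single α.i 1 - Pi.single α.j 1)).2
  have e : α.coroot = (Pi.single α.i 1 - Pi.single α.j 1, 0) := by
    rw [AffRoot.coroot, hα.1, Int.cast_zero]
  rw [phiSimple, refl_of_mem hα, e]
  exact add_mem (one_mem _) (mul_mem h1 h2)

theorem coordOp_mem (U : Submodule (Hbar N) M) (m : Fin N) {y : M} (hy : y ∈ U) :
    coordOp N M m y ∈ U :=
  U.smul_mem (tBar (Pi.single m 1)) hy

/-- The span of the weight vectors `φ_w v`, for `w ∈ W^β` in a given set of cosets of `W̄`. -/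
def cosetSpan (β : Composition N) (v : M) (A : Set (Fin N → ℤ)) : Submodule ℂ M :=
  Submodule.span ℂ ((fun w : WSup β => phi (w : W N) • v) '' {w | latSrc (w : W N) ∈ A})

omit [IsScalarTower ℂ (H N) M] in
theorem phi_mem_cosetSpan {A : Set (Fin N → ℤ)} {w : W N} (hw : w ∈ WSup β) (h : latSrc w ∈ A) :
    phi w • v ∈ cosetSpan β v A := Submodule.subset_span ⟨⟨w, hw⟩, h, rfl⟩

variable (hv : IsCyclicVec β ζ v) (hκ : ζ.2 ≠ 0) (hgen : IsGeneric β ζ) (hζ : ζ ∈ tStar β)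

include hv hκ hgen hζ in
-- 𝔱̄ acts diagonally, and a finite s_α takes φ_w v to a combination of φ_w v and, if s_α w ∈ W^β,
-- φ_{s_α w} v, with the same `latSrc`.
theorem IsCyclicVec.Hbar_smul_mem_cosetSpan (A : Set (Fin N → ℤ)) (h : Hbar N) :
    ∀ y ∈ cosetSpan β v A, h • y ∈ cosetSpan β v A := by
  refine Hbar_smul_mem ?_ ?_ h
  · intro α hα y hy
    rw [wBar_smul, ← refl_of_mem hα]
    induction hy using Submodule.span_induction with
    | mem y h =>
      obtain ⟨⟨w, hw⟩, h, rfl⟩ := h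
      obtain ⟨h1, h2⟩ := hv.refl_smul_phi hκ hgen hζ hw (isSimple_of_mem hα)
      show H.ofW α.refl • phi w • v ∈ _
      by_cases hs : α.refl * w ∈ WSup β
      · obtain ⟨a, b, h3⟩ := h1 hs
        rw [h3]
        refine Submodule.add_mem _ (Submodule.smul_mem _ _ (phi_mem_cosetSpan hw h))
          (Submodule.smul_mem _ _ (phi_mem_cosetSpan hs ?_))
        rwa [latSrc_refl_mul hα]
      · rw [h2 hs]
        exact phi_mem_cosetSpan hw h
    | zero => rw [smul_zero]; exact Submodule.zero_mem _
    | add a b _ _ ha hb => rw [smul_add]; exact Submodule.add_mem _ ha hb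
    | smul c a _ ha => rw [smul_comm_H]; exact Submodule.smul_mem _ _ ha
  · intro x y hy
    rw [tBar_smul]
    induction hy using Submodule.span_induction with
    | mem y h =>
      obtain ⟨⟨w, hw⟩, h, rfl⟩ := h
      show H.ofT (x, 0) • phi w • v ∈ _
      rw [(hv.phi_spec hgen hw).1]
      exact Submodule.smul_mem _ _ (phi_mem_cosetSpan hw h)
    | zero => rw [smul_zero]; exact Submodule.zero_mem _
    | add a b _ _ ha hb => rw [smul_add]; exact Submodule.add_mem _ ha hb
    | smul c a _ ha => rw [smul_comm_H]; exact Submodule.smul_mem _ _ ha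

include hv hκ hgen hζ in
theorem IsCyclicVec.span_le_cosetSpan {x : W N} (hx : x ∈ WSup β) {A : Set (Fin N → ℤ)}
    (h : latSrc x ∈ A) {y : M} (hy : y ∈ Submodule.span (Hbar N) {phi x • v}) :
    y ∈ cosetSpan β v A := by
  obtain ⟨a, rfl⟩ := Submodule.mem_span_singleton.1 hy
  exact hv.Hbar_smul_mem_cosetSpan hκ hgen hζ A a _ (phi_mem_cosetSpan hx h)

include hv hκ hgen hζ in
-- For finite α, φ_α lies in 𝓗̄, and along an edge inside W^β it takes one basis vector to a nonzero
-- multiple of the next.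
theorem IsCyclicVec.mem_of_step {w w' : W N} (hs : Step β w w') (U : Submodule (Hbar N) M)
    (h : phi w • v ∈ U) : phi w' • v ∈ U := by
  obtain ⟨hw, hw', α, hα, rfl⟩ := hs
  obtain ⟨a, ha, h1⟩ := (hv.phiSimple_smul_phi hκ hgen hζ hw (isSimple_of_mem hα)).1 hw'
  have h2 : phiSimple α • phi w • v ∈ U := U.smul_mem ⟨_, phiSimple_mem_Hbar hα⟩ h
  rw [h1] at h2
  exact ((U.restrictScalars ℂ).smul_mem_iff ha).1 h2

omit [NeZero N] in
theorem Step.symm {w w' : W N} (hs : Step β w w') : Step β w' w := by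
  obtain ⟨hw, hw', α, hα, rfl⟩ := hs
  exact ⟨hw', hw, α, hα, by rw [← mul_assoc, refl_mul_refl, one_mul]⟩

include hv hκ hgen hζ in
theorem IsCyclicVec.mem_iff_of_reflTransGen {w w' : W N} (hs : Relation.ReflTransGen (Step β) w w')
    (U : Submodule (Hbar N) M) : phi w • v ∈ U ↔ phi w' • v ∈ U := by
  induction hs with
  | refl => rfl
  | tail _ h ih =>
    rw [ih]
    exact ⟨hv.mem_of_step hκ hgen hζ h U, hv.mem_of_step hκ hgen hζ h.symm U⟩

include hv hκ hgen hζ in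
/-- The representatives `X^β` meet all the components of `W^β`. -/
theorem IsCyclicVec.exists_mem_X {w : W N} (hw : w ∈ WSup β) :
    ∃ x ∈ X β, latSrc x = latSrc w ∧
      ∀ U : Submodule (Hbar N) M, phi w • v ∈ U ↔ phi x • v ∈ U := by
  obtain ⟨x, hx, hs, h1, h2⟩ := exists_sorted hw
  exact ⟨x, mem_X_iff.2 ⟨hx, hs⟩, h1, hv.mem_iff_of_reflTransGen hκ hgen hζ h2⟩

theorem eq_of_mem_X {x y : W N} (hx : x ∈ X β) (hy : y ∈ X β) (h : latSrc x = latSrc y) : x = y :=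
  (mem_X_iff.1 hx).2.eq (mem_X_iff.1 hy).2 h

include hv hκ hgen in
theorem IsCyclicVec.latSrc_mem_of_phi_mem {w : W N} (hw : w ∈ WSup β) {A : Set (Fin N → ℤ)}
    (h : phi w • v ∈ cosetSpan β v A) : latSrc w ∈ A := by
  by_contra h'
  exact (hv.linearIndependent hκ hgen).notMem_span_image (x := ⟨w, hw⟩) h' h

include hv hκ hgen hζ in
-- The operators of 𝔱̄ isolate some φ_w v inside any nonzero submodule. This w lies in W̄x, and
-- reversible moves connect it with the only element of X^β in that coset, which is x; so the
-- submodule contains the generator.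
theorem IsCyclicVec.isSimpleModule {x : W N} (hx : x ∈ X β) :
    IsSimpleModule (Hbar N) (Submodule.span (Hbar N) {phi x • v}) := by
  have hx' := (mem_X_iff.1 hx).1
  rw [isSimpleModule_iff_isAtom]
  refine ⟨fun h => (hv.phi_spec hgen hx').2.1 (Submodule.span_singleton_eq_bot.1 h), fun U hU => ?_⟩
  by_contra hne
  obtain ⟨y, hy, hy0⟩ := Submodule.exists_mem_ne_zero_of_ne_bot hne
  obtain ⟨c, rfl⟩ := hv.exists_eq_linearCombination hgen y
  obtain ⟨w, hw⟩ : ∃ w, c w ≠ 0 := by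
    by_contra h
    push Not at h
    exact hy0 (by rw [show c = 0 from Finsupp.ext h, map_zero])
  have h1 : phi (w : W N) • v ∈ U :=
    hv.phi_mem hκ hgen (U.restrictScalars ℂ) (fun m y hy => coordOp_mem U m hy) c hy hw
  have h2 := hv.latSrc_mem_of_phi_mem hκ hgen w.2
    (hv.span_le_cosetSpan hκ hgen hζ hx' (Set.mem_singleton _) (hU.le h1))
  obtain ⟨x', hx1, hx2, hx3⟩ := hv.exists_mem_X hκ hgen hζ w.2
  have hxx : x' = x := eq_of_mem_X hx1 hx (hx2.trans h2)
  rw [hx3, hxx] at h1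
  exact hU.not_ge (Submodule.span_le.2 (Set.singleton_subset_iff.2 h1))

include hv hκ hgen hζ in
-- The summand at x lies in the span of the basis vectors from W̄x, all other summands in the span
-- of those from the remaining cosets. Together the summands contain each φ_w v, since w is
-- connected with an element of X^β.
theorem IsCyclicVec.isInternal :
    DirectSum.IsInternal fun x : X β => Submodule.span (Hbar N) {phi (x : W N) • v} := by
  refine DirectSum.isInternal_submodule_of_iSupIndep_of_iSup_eq_top ?_ ?_
  · rw [iSupIndep_def]
    intro x
    rw [Submodule.disjoint_def]
    intro y h1 h2
    have h3 := hv.span_le_cosetSpan hκ hgen hζ (mem_X_iff.1 x.2).1 (Set.mem_singleton _) h1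
    have h4 : y ∈ cosetSpan β v {latSrc (x : W N)}ᶜ := by
      -- The span over the other cosets is made an 𝓗̄-submodule so that it can bound the supremum of
      -- the other summands.
      let Z : Submodule (Hbar N) M :=
        { (cosetSpan β v {latSrc (x : W N)}ᶜ).toAddSubmonoid with
          smul_mem' := fun a y hy => hv.Hbar_smul_mem_cosetSpan hκ hgen hζ _ a y hy }
      have h5 : (⨆ x', ⨆ (_ : x' ≠ x), Submodule.span (Hbar N) {phi (x' : W N) • v}) ≤ Z := by
        refine iSup₂_le fun x' hx' => Submodule.span_le.2 (Set.singleton_subset_iff.2 ?_)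
        exact phi_mem_cosetSpan (mem_X_iff.1 x'.2).1
          fun e => hx' (Subtype.ext (eq_of_mem_X x'.2 x.2 e))
      exact h5 h2
    have h6 := (hv.linearIndependent hκ hgen).disjoint_span_image
      (s := {w | latSrc (w : W N) ∈ ({latSrc (x : W N)} : Set (Fin N → ℤ))})
      (t := {w | latSrc (w : W N) ∈ ({latSrc (x : W N)}ᶜ : Set (Fin N → ℤ))})
      (Set.disjoint_left.2 fun w h h' => h' h)
    exact Submodule.disjoint_def.1 h6 y h3 h4
  · rw [eq_top_iff]
    rintro y -
    have h1 : y ∈ Submodule.span ℂ (Set.range fun w : WSup β => phi (w : W N) • v) := by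
      rw [hv.span_phi hgen]; trivial
    refine (Submodule.span_le (p := (⨆ x : X β,
      Submodule.span (Hbar N) {phi (x : W N) • v}).restrictScalars ℂ)).2 ?_ h1
    rintro _ ⟨w, rfl⟩
    obtain ⟨x, hx, -, h2⟩ := hv.exists_mem_X hκ hgen hζ w.2
    exact (h2 _).2 (Submodule.mem_iSup_of_mem (⟨x, hx⟩ : X β)
      (Submodule.mem_span_singleton_self _))

omit [NeZero N] in
include hζ in
-- The reflections of Π̄_{β(x)} move x out of W^β, which forces the pairing -1.
theorem fst_actWt_mem_tBarStar {x : W N} (hx : x ∈ WSup β) :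
    (actWt x ζ).1 ∈ tBarStar (betaOf β x) := by
  intro α hα
  have h1 := pairing_eq_neg_one hζ hx (isSimple_of_mem hα.1) (refl_mul_notMem_WSup hα)
  rwa [pairing_eq, hα.1.1, Int.cast_zero, zero_mul, add_zero] at h1

include hv hκ hgen hζ in
theorem IsCyclicVec.wBar_smul_phi {x : W N} (hx : x ∈ WSup β) {u : Equiv.Perm (Fin N)}
    (hu : u ∈ WBarOf (betaOf β x)) : wBar u • phi x • v = phi x • v := by
  induction hu using Subgroup.closure_induction with
  | mem u h =>
    obtain ⟨α, hα, rfl⟩ := h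
    rw [wBar_smul, ← refl_of_mem hα.1]
    exact (hv.refl_smul_phi hκ hgen hζ hx (isSimple_of_mem hα.1)).2 (refl_mul_notMem_WSup hα)
  | one => rw [wBar_one, one_smul]
  | mul a b _ _ ha hb => rw [wBar_mul, mul_smul, hb, ha]
  | inv a _ ha =>
    nth_rewrite 1 [← ha]
    rw [← mul_smul, ← wBar_mul, inv_mul_cancel, wBar_one, one_smul]

/-- A character of a subalgebra that describes the action of the generators on `y` describes the
action of the whole subalgebra. -/
theorem smul_eq_of_adjoin {S : Subalgebra ℂ (H N)} {s : Set (H N)} (hS : S = Algebra.adjoin ℂ s)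
    (χ : S →ₐ[ℂ] ℂ) {y : M} (h : ∀ (b : H N) (_ : b ∈ s) (hb : b ∈ S), b • y = χ ⟨b, hb⟩ • y)
    (b : S) : (b : H N) • y = χ b • y := by
  subst hS
  obtain ⟨b, hb⟩ := b
  induction hb using Algebra.adjoin_induction with
  | mem b hb => exact h b hb _
  | algebraMap r => exact (algebraMap_smul (H N) r y).trans (congrArg (· • y) (χ.commutes r).symm)
  | add a b ha hb iha ihb =>
    have h1 : χ ⟨a + b, add_mem ha hb⟩ = χ ⟨a, ha⟩ + χ ⟨b, hb⟩ := map_add χ ⟨a, ha⟩ ⟨b, hb⟩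
    refine Eq.trans ?_ ((congrArg (· • y) h1).trans (add_smul _ _ _)).symm
    exact (add_smul a b y).trans (congrArg₂ (· + ·) iha ihb)
  | mul a b ha hb iha ihb =>
    have h1 : χ ⟨a * b, mul_mem ha hb⟩ = χ ⟨a, ha⟩ * χ ⟨b, hb⟩ := map_mul χ ⟨a, ha⟩ ⟨b, hb⟩
    rw [mul_comm] at h1
    refine Eq.trans ?_ ((congrArg (· • y) h1).trans (mul_smul _ _ _)).symm
    calc (a * b) • y = a • b • y := mul_smul a b y
      _ = a • χ ⟨b, hb⟩ • y := congrArg (a • ·) ihb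
      _ = χ ⟨b, hb⟩ • a • y := smul_comm_H _ _ _
      _ = _ := congrArg (χ ⟨b, hb⟩ • ·) iha

theorem characterBar_ofW {z : Fin N → ℂ} (hz : z ∈ tBarStar β) {σ : Equiv.Perm (Fin N)}
    (hσ : σ ∈ WBarOf β) (h : H.ofW (fin σ) ∈ HBarOf β) :
    characterBar β z hz ⟨H.ofW (fin σ), h⟩ = 1 :=
  character_ofW β _ (mem_tStar_of_mem_tBarStar hz) σ hσ

theorem characterBar_ofT {z : Fin N → ℂ} (hz : z ∈ tBarStar β) (x : Fin N → ℂ)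
    (h : H.ofT (x, 0) ∈ HBarOf β) :
    characterBar β z hz ⟨H.ofT (x, 0), h⟩ = ∑ m, z m * x m :=
  (character_ofT β _ (mem_tStar_of_mem_tBarStar hz) _).trans (pair_zero_snd _ _)

include hv hκ hgen hζ in
theorem IsCyclicVec.smul_phi_eq_character {x : W N} (hx : x ∈ WSup β)
    (b : HBarOf (betaOf β x)) : (b : H N) • phi x • v =
      characterBar (betaOf β x) _ (fst_actWt_mem_tBarStar hζ hx) b • phi x • v := by
  refine smul_eq_of_adjoin (S := HBarOf (betaOf β x)) rfl _ ?_ b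
  rintro _ (⟨σ, hσ, rfl⟩ | ⟨y, rfl⟩) hb
  · refine (hv.wBar_smul_phi hκ hgen hζ hx hσ).trans ?_
    exact ((congrArg (· • phi x • v) (characterBar_ofW _ hσ hb)).trans (one_smul _ _)).symm
  · refine Eq.trans ?_ (congrArg (· • phi x • v) (characterBar_ofT _ y hb)).symm
    have h2 := (hv.phi_spec hgen hx).1 (y, 0)
    rwa [pair_zero_snd] at h2

include hv hκ hgen hζ in
-- The universal property of the induced module gives a surjection onto the summand. Its source is
-- spanned by the translates of the cyclic vector by u ∈ W̄^{β(x)}, and its image contains the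
-- independent vectors φ_{ux} v for the same u, so injectivity follows by counting dimensions.
theorem IsCyclicVec.nonempty_equiv {x : W N} (hx : x ∈ X β) :
    Nonempty (Submodule.span (Hbar N) {phi x • v} ≃ₗ[Hbar N]
      YBar (betaOf β x) _ (fst_actWt_mem_tBarStar hζ (mem_X_iff.1 hx).1)) := by
  classical
  have hx' := (mem_X_iff.1 hx).1
  let f := Subalgebra.inclusion (HBarOf_le_Hbar (betaOf β x))
  let χ := characterBar (betaOf β x) _ (fst_actWt_mem_tBarStar hζ hx')
  obtain ⟨F, hF⟩ := exists_lift_induced f χ (phi x • v)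
    (hv.smul_phi_eq_character hκ hgen hζ hx')
  have hrange : LinearMap.range F = Submodule.span (Hbar N) {phi x • v} := by
    ext y
    rw [LinearMap.mem_range, Submodule.mem_span_singleton]
    constructor
    · rintro ⟨y, rfl⟩
      obtain ⟨a, rfl⟩ := exists_smul_indVec f χ y
      exact ⟨a, by rw [map_smul, hF]⟩
    · rintro ⟨a, rfl⟩
      exact ⟨a • indVec f χ, by rw [map_smul, hF]⟩
  have hspan := span_wBar_eq_top (β := betaOf β x) (exists_smul_indVec f χ) (actWt x ζ).1
    (fun y => by
      have h1 := smul_indVec f χ ⟨H.ofT (y, 0), Algebra.subset_adjoin (Or.inr ⟨y, rfl⟩)⟩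
      exact h1.trans (congrArg (· • indVec f χ) (characterBar_ofT _ y _)))
    (fun u hu => by
      have h1 := smul_indVec f χ ⟨H.ofW (fin u), Algebra.subset_adjoin (Or.inl ⟨u, hu, rfl⟩)⟩
      exact h1.trans ((congrArg (· • indVec f χ) (characterBar_ofW _ hu _)).trans (one_smul _ _)))
  have hinj : Function.Injective (F.restrictScalars ℂ) := by
    let j : {u : Equiv.Perm (Fin N) // fin u ∈ WSup (betaOf β x)} → WSup β :=
      fun u => ⟨fin u.1 * x, fin_mul_mem_WSup hx u.2⟩
    have hj : Function.Injective j := by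
      intro u u' h
      have h1 := congrArg (fun w : WSup β => (w : W N).right) h
      exact Subtype.ext (mul_right_cancel (b := x.right) h1)
    refine injective_of_linearIndependent (F.restrictScalars ℂ) hspan
      ((hv.linearIndependent hκ hgen).comp j hj) fun u => ?_
    show phi (fin u.1 * x) • v ∈ LinearMap.range F
    rw [hrange]
    -- The element of X^β connected with ux lies in the coset W̄x, hence is x itself.
    obtain ⟨x', hx1, hx2, hx3⟩ := hv.exists_mem_X hκ hgen hζ (fin_mul_mem_WSup hx u.2)
    rw [latSrc_fin_mul] at hx2
    rw [hx3, eq_of_mem_X hx1 hx hx2]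
    exact Submodule.mem_span_singleton_self _
  exact ⟨(LinearEquiv.ofInjective F hinj ≪≫ₗ LinearEquiv.ofEq _ _ hrange).symm⟩

end Decomposition

end DDAHA

/-! ### The theorem, with v = 𝟏_ζ. -/

theorem mainTheorem1 (N : ℕ) [NeZero N] (β : Composition N) (ζ : DDAHA.Wt N)
    (hζ : ζ ∈ DDAHA.tStar β) (hgen : DDAHA.IsGeneric β ζ) (hδ : DDAHA.pair ζ (0, 1) ≠ 0) :
    DirectSum.IsInternal (fun x : DDAHA.X β => DDAHA.summand β ζ hζ x) ∧
    ∀ x ∈ DDAHA.X β,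
      IsSimpleModule (DDAHA.Hbar N) (DDAHA.summand β ζ hζ x) ∧
      ∃ hx : (DDAHA.actWt x ζ).1 ∈ DDAHA.tBarStar (DDAHA.betaOf β x),
        Nonempty (DDAHA.summand β ζ hζ x ≃ₗ[DDAHA.Hbar N]
          DDAHA.YBar (DDAHA.betaOf β x) (DDAHA.actWt x ζ).1 hx) := by
  have hκ : ζ.2 ≠ 0 := by simpa [DDAHA.pair] using hδ
  have hv := DDAHA.isCyclicVec_oneVec hζ
  exact ⟨hv.isInternal hκ hgen hζ, fun x hx => ⟨hv.isSimpleModule hκ hgen hζ hx,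
    DDAHA.fst_actWt_mem_tBarStar hζ (DDAHA.mem_X_iff.1 hx).1, hv.nonempty_equiv hκ hgen hζ hx⟩⟩
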